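/- There is a deterministic algorithm that, given a construction sequence of an $n$-vertex graph $G$ of length $m$ and radius-1 width $d$, solves All-Pairs Shortest Path on the (undirected, unweighted) graph $G$, computing all distances and, for every source, a shortest-path tree, in time $O(m + d n^2 \log n)$. In particular, for $n \ge 2$ the running time is $O(d n^2 \log n)$ whenever no two resolve operations of the sequence are between the same pair of parts (such a sequence has length $O(n^2)$). The width $d$ is not part of the input. Time is counted in unit-cost steps on a word RAM with words of $w$ bits, for any $w \ge c \log(n+m)$, where $c$ is a constant. Here a construction sequence on the vertex set $V$ is a sequence $(\mathcal P_1,E_1,N_1),\dots,(\mathcal P_m,E_m,N_m)$, where $\mathcal P_1$ is the partition of $V$ into singletons, $E_1=N_1=\varnothing$, and each triple is obtained from the previous one by one of three operations: merging two distinct parts $A,B$ into $A\cup B$; resolving positively two (possibly equal) parts $A,B$, that is, $E_{i+1}=E_i\cup(AB\setminus N_i)$, where $AB$ is the set of pairs of distinct vertices with one in $A$ and one in $B$; or resolving negatively, that is, $N_{i+1}=N_i\cup(AB\setminus E_i)$. It constructs the graph $G=(V,E_m)$. Its radius-1 width is the maximum, over all $i$ and all $v\in V$, of the number of parts of $\mathcal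 P_i$ at distance at most $1$ from $v$ in the graph $(V,E_i\cup N_i)$. The algorithm is given the list of operations, each with a vertex from each of the two parts involved. -/

import Mathlib

/-! ## A word RAM with a step count -/

namespace WordRAM

/-- Arithmetic operations and comparisons of the machine. -/
inductive BinOp
  | add | sub | mul | div | mod | lt | eq

/-- Value of an operation on natural numbers (subtraction is truncated at `0`, division and
remainder by `0` are those of `ℕ`, a comparison gives `1` for true and `0` for false). -/
def BinOp.eval : BinOp → ℕ → ℕ → ℕ
  | .add, a, b => a + b
  | .sub, a, b => a - b
  | .mul, a, b => a * b
  | .div, a, b => a / b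
  | .mod, a, b => a % b
  | .lt, a, b => if a < b then 1 else 0
  | .eq, a, b => if a = b then 1 else 0

/-- Expressions: constants, registers, memory reads (indirect addressing), operations. -/
inductive Expr
  | const (k : ℕ)
  | reg (r : ℕ)
  | load (addr : Expr)
  | bin (o : BinOp) (a b : Expr)

/-- A machine state: registers (a program mentions only finitely many of them) and memory. -/
structure State where
  regs : ℕ → ℕ
  mem : ℕ → ℕ

/-- Value of an expression on the machine with `w`-bit words: constants and results of operations
are reduced modulo `2 ^ w`. -/
def Expr.eval (w : ℕ) (σ : State) : Expr → ℕ
  | .const k => k % 2 ^ w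
  | .reg r => σ.regs r
  | .load a => σ.mem (a.eval w σ)
  | .bin o a b => o.eval (a.eval w σ) (b.eval w σ) % 2 ^ w

/-- Number of steps for evaluating an expression: one for each constant, register access,
memory access and operation. -/
def Expr.cost : Expr → ℕ
  | .const _ => 1
  | .reg _ => 1
  | .load a => a.cost + 1
  | .bin _ a b => a.cost + b.cost + 1

/-- Programs. A test succeeds when the value of the expression is not `0`. -/
inductive Program
  | skip
  | assign (r : ℕ) (e : Expr)
  | store (addr e : Expr)
  | seq (p q : Program)
  | ite (e : Expr) (p q : Program)
  | while (e : Expr) (p : Program)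

def State.setReg (σ : State) (r x : ℕ) : State :=
  { σ with regs := Function.update σ.regs r x }

def State.setMem (σ : State) (a x : ℕ) : State :=
  { σ with mem := Function.update σ.mem a x }

/-- `Exec w p σ t τ`: on the machine with `w`-bit words, the program `p` started in the state `σ`
halts in the state `τ` after exactly `t` steps. -/
inductive Exec (w : ℕ) : Program → State → ℕ → State → Prop
  | skip (σ : State) : Exec w .skip σ 1 σ
  | assign (σ : State) (r : ℕ) (e : Expr) :
      Exec w (.assign r e) σ (e.cost + 1) (σ.setReg r (e.eval w σ))
  | store (σ : State) (a e : Expr) :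
      Exec w (.store a e) σ (a.cost + e.cost + 1) (σ.setMem (a.eval w σ) (e.eval w σ))
  | seq {p q : Program} {σ τ ρ : State} {s t : ℕ} :
      Exec w p σ s τ → Exec w q τ t ρ → Exec w (.seq p q) σ (s + t) ρ
  | ite_true {e : Expr} {p q : Program} {σ τ : State} {t : ℕ} :
      e.eval w σ ≠ 0 → Exec w p σ t τ → Exec w (.ite e p q) σ (e.cost + 1 + t) τ
  | ite_false {e : Expr} {p q : Program} {σ τ : State} {t : ℕ} :
      e.eval w σ = 0 → Exec w q σ t τ → Exec w (.ite e p q) σ (e.cost + 1 + t) τ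
  | while_true {e : Expr} {p : Program} {σ τ ρ : State} {s t : ℕ} :
      e.eval w σ ≠ 0 → Exec w p σ s τ → Exec w (.while e p) τ t ρ →
        Exec w (.while e p) σ (e.cost + 1 + s + t) ρ
  | while_false {e : Expr} {p : Program} {σ : State} :
      e.eval w σ = 0 → Exec w (.while e p) σ (e.cost + 1) σ

/-- The initial state for a given input: the input occupies the first memory cells, all other
cells and all registers are `0`. -/
def State.init (input : List ℕ) : State where
  regs := fun _ => 0
  mem := fun a => input.getD a 0

end WordRAM

/-! ## Construction sequences and their width -/

namespace MergeWidth

/-- A step `(𝒫, E, N)`: a set of parts, the resolved edges and the resolved non-edges. -/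
structure Stage (V : Type*) where
  parts : Finset (Finset V)
  E : Finset (Sym2 V)
  N : Finset (Sym2 V)

/-- The instructions of a construction sequence as they are given to an algorithm. A part is
named by any vertex that belongs to it. -/
inductive Instr (V : Type*)
  | merge (u v : V)
  | resolvePos (u v : V)
  | resolveNeg (u v : V)

section

variable {V : Type*} [Fintype V] [DecidableEq V]

/-- The partition into singletons, nothing resolved. -/
def Stage.initial (V : Type*) [Fintype V] [DecidableEq V] : Stage V where
  parts := Finset.univ.image fun v : V => {v}
  E := ∅
  N := ∅

/-- The set `AB` of all unordered pairs of distinct vertices, one in `A` and one in `B`. -/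
def pairsBetween (A B : Finset V) : Finset (Sym2 V) :=
  ((A ×ˢ B).filter fun p => p.1 ≠ p.2).image fun p => s(p.1, p.2)

/-- `Step s i s'`: the instruction `i` turns `s` into `s'`. -/
inductive Step : Stage V → Instr V → Stage V → Prop
  | merge {s : Stage V} {A B : Finset V} {u v : V} :
      A ∈ s.parts → B ∈ s.parts → A ≠ B → u ∈ A → v ∈ B →
        Step s (.merge u v) ⟨insert (A ∪ B) ((s.parts.erase A).erase B), s.E, s.N⟩
  | resolvePos {s : Stage V} {A B : Finset V} {u v : V} :
      A ∈ s.parts → B ∈ s.parts → u ∈ A → v ∈ B →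
        Step s (.resolvePos u v) ⟨s.parts, s.E ∪ (pairsBetween A B \ s.N), s.N⟩
  | resolveNeg {s : Stage V} {A B : Finset V} {u v : V} :
      A ∈ s.parts → B ∈ s.parts → u ∈ A → v ∈ B →
        Step s (.resolveNeg u v) ⟨s.parts, s.E, s.N ∪ (pairsBetween A B \ s.E)⟩

/-- The graph `(V, R)` of resolved pairs, `R = E ∪ N`. -/
def Stage.resolvedGraph (s : Stage V) : SimpleGraph V :=
  SimpleGraph.fromEdgeSet (↑(s.E ∪ s.N) : Set (Sym2 V))

open scoped Classical in
/-- The number of parts at distance at most `r` from `v` in the graph of resolved pairs. -/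
noncomputable def Stage.ballParts (s : Stage V) (r : ℕ) (v : V) : ℕ :=
  (s.parts.filter fun A => ∃ u ∈ A, s.resolvedGraph.edist v u ≤ r).card

end

/-- A construction sequence with steps `stage 0, …, stage numInstr`, where `instr i` leads from
`stage i` to `stage (i + 1)`. -/
structure ConstructionSequence (V : Type*) [Fintype V] [DecidableEq V] where
  numInstr : ℕ
  stage : Fin (numInstr + 1) → Stage V
  instr : Fin numInstr → Instr V
  stage_zero : stage 0 = Stage.initial V
  step : ∀ i : Fin numInstr, Step (stage i.castSucc) (instr i) (stage i.succ)

namespace ConstructionSequence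

variable {V : Type*} [Fintype V] [DecidableEq V]

/-- The length `m` of a sequence `(𝒫₁, E₁, N₁), …, (𝒫ₘ, Eₘ, Nₘ)`. -/
def length (S : ConstructionSequence V) : ℕ := S.numInstr + 1

/-- `S` constructs the graph `(V, Eₘ)`. -/
def Constructs (S : ConstructionSequence V) (G : SimpleGraph V) : Prop :=
  G = SimpleGraph.fromEdgeSet (↑(S.stage (Fin.last S.numInstr)).E : Set (Sym2 V))

/-- The radius-`r` width: the maximum, over all steps and all vertices, of the number of parts at
distance at most `r` from the vertex in the graph of resolved pairs. -/
noncomputable def width (S : ConstructionSequence V) (r : ℕ) : ℕ :=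
  Finset.univ.sup fun i : Fin (S.numInstr + 1) =>
    Finset.univ.sup fun v : V => (S.stage i).ballParts r v

/-- The `i`-th instruction resolves the pair of parts `A`, `B`, positively or negatively. -/
def Resolves (S : ConstructionSequence V) (i : Fin S.numInstr) (A B : Finset V) : Prop :=
  A ∈ (S.stage i.castSucc).parts ∧ B ∈ (S.stage i.castSucc).parts ∧
    ∃ u ∈ A, ∃ v ∈ B, S.instr i = .resolvePos u v ∨ S.instr i = .resolveNeg u v

/-- No two resolve operations are between the exact same (unordered) pair of parts. -/
def Irredundant (S : ConstructionSequence V) : Prop :=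
  ∀ i j : Fin S.numInstr, i < j → ∀ A B : Finset V, S.Resolves i A B →
    ¬ S.Resolves j A B ∧ ¬ S.Resolves j B A

end ConstructionSequence

/-- An instruction is encoded by three words. -/
def Instr.encode {n : ℕ} : Instr (Fin n) → List ℕ
  | .merge u v => [0, u, v]
  | .resolvePos u v => [1, u, v]
  | .resolveNeg u v => [2, u, v]

/-- The input of an algorithm: the number of vertices, the number of instructions, and the
instructions in their order. -/
def ConstructionSequence.encode {n : ℕ} (S : ConstructionSequence (Fin n)) : List ℕ :=
  n :: S.numInstr :: (List.ofFn S.instr).flatMap Instr.encode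

end MergeWidth

/-! ## The output of All-Pairs Shortest Path -/

namespace WordRAM

/-- The state holds a solution of All-Pairs Shortest Path for `G`, distances and shortest-path
trees: register `0` holds the address of an `n × n` table (row by row) whose entry at `(u, v)` is
the distance of `u` and `v`, or `n` when no path joins them, and register `1` holds the address of
an `n × n` table whose entry at `(u, v)` is the parent of `v` in a shortest-path tree of `G` rooted
at `u`, or `n` when `v = u` or `v` is not in that tree. -/
def State.SolvesAPSP {n : ℕ} (τ : State) (G : SimpleGraph (Fin n)) : Prop :=
  ∀ u v : Fin n,
    (G.Reachable u v → τ.mem (τ.regs 0 + u * n + v) = G.dist u v) ∧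
    (¬ G.Reachable u v → τ.mem (τ.regs 0 + u * n + v) = n) ∧
    (G.Reachable u v → u ≠ v →
      ∃ x : Fin n, τ.mem (τ.regs 1 + u * n + v) = x ∧ G.Adj x v ∧
        G.Reachable u x ∧ G.dist u x + 1 = G.dist u v) ∧
    (u = v ∨ ¬ G.Reachable u v → τ.mem (τ.regs 1 + u * n + v) = n)

end WordRAM

/-! Order the vertices so that every part of every stage is an interval: lay out the final parts one
after another and, going backwards, split the interval of a merged part into those of the two parts
it came from. In this order the adjacency matrix has only $O(dn)$ corners, that is, windows of size
two by two whose alternating sum is nonzero. To see this, let `t` be the last stage at which the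
boundary between positions `a - 1` and `a` separates two parts, and let `(a, b)` be a corner such
that the boundary `b` survives at least as long. If no pair of the window were equal or resolved at
stage `t`, its four values would be decided only later, when `a - 1` and `a` lie in one part; the
two rows would agree and there would be no corner. So `b` bounds a part within distance 1 of one of
the vertices at `a - 1` and `a`, which leaves at most `4 * d` choices for `b`
(`closeBoundary_of_isCorner`, `card_closeBoundary`, `card_corners`).

Describe each row by its maximal runs of ones. A run that is absent from the neighbouring row forces
a corner within its extent, so the tables of runs of consecutive rows differ in $O(dn)$ places
altogether (`card_changes`), and only $O(dn)$ different intervals occur (`card_runIntervals`). Each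
run is stored at the maximal dyadic blocks of rows to which it is common. Each of the $O(\log n)$
levels has $O(dn)$ such entries (`card_entries`), and the runs of a row are the entries of the
blocks that contain it (`exists_entry`).

A breadth-first search treats each block once and each interval once: a position in an interval
treated before has already been visited, so nothing is lost by skipping it. Unvisited positions of
an interval are found in time $O(\log n)$ with a binary tree. A search thus costs $O(\log n)$ per
interval and per vertex and $O(1)$ per entry, in total $O(dn \log n)$; the amortization is
`potential`, with `node_runs`, `pop_runs` and `search_runs`. There are `n` searches. The distances
are correct because visited vertices are closed under edges that raise the distance by at most one,
while every parent is exactly one closer to the source (`IsTreeOutput`).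

The preparation takes $O(m + n^2 \log n)$ steps: there are at most `n` merges, each causing $O(n)$
updates, and every resolve takes constant time. The number of merges also shows that at most `2 * n`
parts ever occur, so an irredundant sequence has at most `4 * n ^ 2` resolves.

The algorithm is verified in a small language with arrays and then compiled to the word RAM with a
constant factor (`AExec.simulate`). Construction sequences enter through `Script`, which replaces
parts by representatives. -/

set_option linter.constructorNameAsVariable false

namespace WordRAM

/-! ## A small imperative language with arrays -/

/-- Registers of the array language. -/
inductive Reg
  | t | x | y | a | b | c | k | i | l | e | s | h | tl | u | j | p | rr | f
  deriving DecidableEq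

/-- Names of the three-dimensional arrays. -/
inductive Arr
  | inp | comp | size | start | val | ord | mat | run | lst | cnt | full | done | idone | q
  | dist | par
  deriving DecidableEq

/-- Expressions: `n`, `m`, `L` are parameters that stay fixed during a run. -/
inductive AExp
  | n | m | L
  | c (k : ℕ)
  | r (i : Reg)
  | ld (x : Arr) (k i j : AExp)
  | op (o : BinOp) (a b : AExp)

instance (k : ℕ) : OfNat AExp k := ⟨AExp.c k⟩
instance : Add AExp := ⟨AExp.op .add⟩
instance : Sub AExp := ⟨AExp.op .sub⟩
instance : Mul AExp := ⟨AExp.op .mul⟩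
instance : Div AExp := ⟨AExp.op .div⟩

inductive Cmd
  | skip
  | set (r : Reg) (e : AExp)
  | st (x : Arr) (k i j e : AExp)
  | put (i e : AExp)
  | seq (p q : Cmd)
  | ite (e : AExp) (p q : Cmd)
  | whl (e : AExp) (p : Cmd)

structure AState where
  regs : Reg → ℕ
  arr : Arr → ℕ → ℕ → ℕ → ℕ
  out : ℕ → ℕ

/-- Values of the parameters, the bound `E` on indices and the bound `W` on words. -/
structure Env where
  n : ℕ
  m : ℕ
  L : ℕ
  E : ℕ
  W : ℕ

def AExp.aeval (V : Env) (S : AState) : AExp → ℕ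
  | .n => V.n
  | .m => V.m
  | .L => V.L
  | .c k => k
  | .r i => S.regs i
  | .ld x k i j => S.arr x (k.aeval V S) (i.aeval V S) (j.aeval V S)
  | .op o a b => o.eval (a.aeval V S) (b.aeval V S)

/-- No overflow in a single operation. -/
def BinOp.Safe (W : ℕ) : BinOp → ℕ → ℕ → Prop
  | .add, a, b => a + b < W
  | .mul, a, b => a * b < W
  | _, _, _ => True

/-- The evaluation does not overflow and all indices are in range. -/
def AExp.Ok (V : Env) (S : AState) : AExp → Prop
  | .c k => k < V.W
  | .ld _ k i j => (k.Ok V S ∧ i.Ok V S ∧ j.Ok V S) ∧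
      k.aeval V S < V.E ∧ i.aeval V S < V.E ∧ j.aeval V S < V.E
  | .op o a b => (a.Ok V S ∧ b.Ok V S) ∧ o.Safe V.W (a.aeval V S) (b.aeval V S)
  | _ => True

def AState.setReg (S : AState) (r : Reg) (v : ℕ) : AState :=
  { S with regs := Function.update S.regs r v }

def AState.setArr (S : AState) (x : Arr) (k i j v : ℕ) : AState :=
  { S with arr := fun x' k' i' j' => if x' = x ∧ k' = k ∧ i' = i ∧ j' = j then v
                                      else S.arr x' k' i' j' }

def AState.setOut (S : AState) (i v : ℕ) : AState :=
  { S with out := Function.update S.out i v }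

section StateLemmas

variable (S : AState) (V : Env)

@[simp] theorem setReg_regs (r r' : Reg) (v : ℕ) :
    (S.setReg r v).regs r' = if r' = r then v else S.regs r' := by
  simp [AState.setReg, Function.update_apply]
@[simp] theorem setReg_arr (r : Reg) (v : ℕ) : (S.setReg r v).arr = S.arr := rfl
@[simp] theorem setReg_out (r : Reg) (v : ℕ) : (S.setReg r v).out = S.out := rfl
@[simp] theorem setArr_regs (x : Arr) (k i j v : ℕ) : (S.setArr x k i j v).regs = S.regs := rfl
@[simp] theorem setArr_out (x : Arr) (k i j v : ℕ) : (S.setArr x k i j v).out = S.out := rfl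
@[simp] theorem setArr_arr (x x' : Arr) (k i j v k' i' j' : ℕ) :
    (S.setArr x k i j v).arr x' k' i' j' =
      if x' = x ∧ k' = k ∧ i' = i ∧ j' = j then v else S.arr x' k' i' j' := rfl
@[simp] theorem setOut_regs (i v : ℕ) : (S.setOut i v).regs = S.regs := rfl
@[simp] theorem setOut_arr (i v : ℕ) : (S.setOut i v).arr = S.arr := rfl
@[simp] theorem setOut_out (i v i' : ℕ) :
    (S.setOut i v).out i' = if i' = i then v else S.out i' := by
  simp [AState.setOut, Function.update_apply]

@[simp] theorem aeval_n : AExp.n.aeval V S = V.n := rfl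
@[simp] theorem aeval_m : AExp.m.aeval V S = V.m := rfl
@[simp] theorem aeval_L : AExp.L.aeval V S = V.L := rfl
@[simp] theorem aeval_c (k : ℕ) : (AExp.c k).aeval V S = k := rfl
@[simp] theorem aeval_ofNat (k : ℕ) :
    (no_index (OfNat.ofNat k : AExp)).aeval V S = OfNat.ofNat k := rfl
@[simp] theorem aeval_r (i : Reg) : (AExp.r i).aeval V S = S.regs i := rfl
@[simp] theorem aeval_ld (x : Arr) (k i j : AExp) :
    (AExp.ld x k i j).aeval V S = S.arr x (k.aeval V S) (i.aeval V S) (j.aeval V S) := rfl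
@[simp] theorem aeval_add (a b : AExp) : (a + b).aeval V S = a.aeval V S + b.aeval V S := rfl
@[simp] theorem aeval_sub (a b : AExp) : (a - b).aeval V S = a.aeval V S - b.aeval V S := rfl
@[simp] theorem aeval_mul (a b : AExp) : (a * b).aeval V S = a.aeval V S * b.aeval V S := rfl
@[simp] theorem aeval_div (a b : AExp) : (a / b).aeval V S = a.aeval V S / b.aeval V S := rfl
@[simp] theorem aeval_lt (a b : AExp) :
    (AExp.op .lt a b).aeval V S = if a.aeval V S < b.aeval V S then 1 else 0 := rfl
@[simp] theorem aeval_eq (a b : AExp) :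
    (AExp.op .eq a b).aeval V S = if a.aeval V S = b.aeval V S then 1 else 0 := rfl

@[simp] theorem ok_n : AExp.n.Ok V S := trivial
@[simp] theorem ok_m : AExp.m.Ok V S := trivial
@[simp] theorem ok_L : AExp.L.Ok V S := trivial
@[simp] theorem ok_c (k : ℕ) : (AExp.c k).Ok V S ↔ k < V.W := Iff.rfl
@[simp] theorem ok_ofNat (k : ℕ) :
    (no_index (OfNat.ofNat k : AExp)).Ok V S ↔ OfNat.ofNat k < V.W := Iff.rfl
@[simp] theorem ok_r (i : Reg) : (AExp.r i).Ok V S := trivial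
@[simp] theorem ok_ld (x : Arr) (k i j : AExp) :
    (AExp.ld x k i j).Ok V S ↔ (k.Ok V S ∧ i.Ok V S ∧ j.Ok V S) ∧
      k.aeval V S < V.E ∧ i.aeval V S < V.E ∧ j.aeval V S < V.E := Iff.rfl
@[simp] theorem ok_add (a b : AExp) :
    (a + b).Ok V S ↔ (a.Ok V S ∧ b.Ok V S) ∧ a.aeval V S + b.aeval V S < V.W := Iff.rfl
@[simp] theorem ok_mul (a b : AExp) :
    (a * b).Ok V S ↔ (a.Ok V S ∧ b.Ok V S) ∧ a.aeval V S * b.aeval V S < V.W := Iff.rfl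
@[simp] theorem ok_sub (a b : AExp) : (a - b).Ok V S ↔ a.Ok V S ∧ b.Ok V S := and_iff_left trivial
@[simp] theorem ok_div (a b : AExp) : (a / b).Ok V S ↔ a.Ok V S ∧ b.Ok V S := and_iff_left trivial
@[simp] theorem ok_lt (a b : AExp) :
    (AExp.op .lt a b).Ok V S ↔ a.Ok V S ∧ b.Ok V S := and_iff_left trivial
@[simp] theorem ok_eq (a b : AExp) :
    (AExp.op .eq a b).Ok V S ↔ a.Ok V S ∧ b.Ok V S := and_iff_left trivial

end StateLemmas

/-! ### Execution -/

/-- Every assignment, store, test and `skip` takes one unit of time. -/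
inductive AExec (V : Env) : Cmd → AState → ℕ → AState → Prop
  | skip (S : AState) : AExec V .skip S 1 S
  | set {S : AState} {r : Reg} {e : AExp} : e.Ok V S →
      AExec V (.set r e) S 1 (S.setReg r (e.aeval V S))
  | st {S : AState} {x : Arr} {k i j e : AExp} :
      ((AExp.ld x k i j).Ok V S ∧ e.Ok V S) → AExec V (.st x k i j e) S 1
        (S.setArr x (k.aeval V S) (i.aeval V S) (j.aeval V S) (e.aeval V S))
  | put {S : AState} {i e : AExp} : (i.Ok V S ∧ e.Ok V S) → i.aeval V S < V.E * V.E →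
      AExec V (.put i e) S 1 (S.setOut (i.aeval V S) (e.aeval V S))
  | seq {p q : Cmd} {S S' S'' : AState} {t t' : ℕ} :
      AExec V p S t S' → AExec V q S' t' S'' → AExec V (.seq p q) S (t + t') S''
  | ite_true {e : AExp} {p q : Cmd} {S S' : AState} {t : ℕ} :
      e.Ok V S → e.aeval V S ≠ 0 → AExec V p S t S' → AExec V (.ite e p q) S (1 + t) S'
  | ite_false {e : AExp} {p q : Cmd} {S S' : AState} {t : ℕ} :
      e.Ok V S → e.aeval V S = 0 → AExec V q S t S' → AExec V (.ite e p q) S (1 + t) S'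
  | whl_true {e : AExp} {p : Cmd} {S S' S'' : AState} {t t' : ℕ} :
      e.Ok V S → e.aeval V S ≠ 0 → AExec V p S t S' → AExec V (.whl e p) S' t' S'' →
        AExec V (.whl e p) S (1 + t + t') S''
  | whl_false {e : AExp} {p : Cmd} {S : AState} :
      e.Ok V S → e.aeval V S = 0 → AExec V (.whl e p) S 1 S

/-- The command halts, and the final state and the running time satisfy `Q`. -/
def Runs (V : Env) (p : Cmd) (S : AState) (Q : AState → ℕ → Prop) : Prop :=
  ∃ t S', AExec V p S t S' ∧ Q S' t

section Rules

variable {V : Env} {S : AState} {Q : AState → ℕ → Prop}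

theorem Runs.mono {p : Cmd} {Q' : AState → ℕ → Prop} (h : Runs V p S Q)
    (hQ : ∀ S' t, Q S' t → Q' S' t) : Runs V p S Q' := by
  obtain ⟨t, S', h1, h2⟩ := h
  exact ⟨t, S', h1, hQ _ _ h2⟩

@[simp] theorem runs_skip : Runs V .skip S Q ↔ Q S 1 :=
  ⟨fun ⟨_, _, h, hQ⟩ => by cases h; exact hQ, fun h => ⟨_, _, .skip S, h⟩⟩

@[simp] theorem runs_set {r : Reg} {e : AExp} :
    Runs V (.set r e) S Q ↔ e.Ok V S ∧ Q (S.setReg r (e.aeval V S)) 1 :=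
  ⟨fun ⟨_, _, h, hQ⟩ => by cases h with | set h => exact ⟨h, hQ⟩,
    fun h => ⟨_, _, .set h.1, h.2⟩⟩

@[simp] theorem runs_st {x : Arr} {k i j e : AExp} :
    Runs V (.st x k i j e) S Q ↔ ((AExp.ld x k i j).Ok V S ∧ e.Ok V S) ∧
      Q (S.setArr x (k.aeval V S) (i.aeval V S) (j.aeval V S) (e.aeval V S)) 1 :=
  ⟨fun ⟨_, _, h, hQ⟩ => by cases h with | st h => exact ⟨h, hQ⟩,
    fun h => ⟨_, _, .st h.1, h.2⟩⟩

@[simp] theorem runs_put {i e : AExp} :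
    Runs V (.put i e) S Q ↔ ((i.Ok V S ∧ e.Ok V S) ∧ i.aeval V S < V.E * V.E) ∧
      Q (S.setOut (i.aeval V S) (e.aeval V S)) 1 :=
  ⟨fun ⟨_, _, h, hQ⟩ => by cases h with | put h h' => exact ⟨⟨h, h'⟩, hQ⟩,
    fun h => ⟨_, _, .put h.1.1 h.1.2, h.2⟩⟩

@[simp] theorem runs_seq {p q : Cmd} :
    Runs V (.seq p q) S Q ↔ Runs V p S fun S' t => Runs V q S' fun S'' t' => Q S'' (t + t') := by
  constructor
  · rintro ⟨_, _, h, hQ⟩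
    cases h with | seq h1 h2 => exact ⟨_, _, h1, _, _, h2, hQ⟩
  · rintro ⟨_, _, h1, _, _, h2, hQ⟩
    exact ⟨_, _, .seq h1 h2, hQ⟩

@[simp] theorem runs_ite {e : AExp} {p q : Cmd} :
    Runs V (.ite e p q) S Q ↔ e.Ok V S ∧
      (e.aeval V S ≠ 0 → Runs V p S fun S' t => Q S' (1 + t)) ∧
      (e.aeval V S = 0 → Runs V q S fun S' t => Q S' (1 + t)) := by
  constructor
  · rintro ⟨_, _, h, hQ⟩
    cases h with
    | ite_true h1 h2 h3 => exact ⟨h1, fun _ => ⟨_, _, h3, hQ⟩, fun h => absurd h h2⟩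
    | ite_false h1 h2 h3 => exact ⟨h1, fun h => absurd h2 h, fun _ => ⟨_, _, h3, hQ⟩⟩
  · rintro ⟨h1, h2, h3⟩
    by_cases h : e.aeval V S = 0
    · obtain ⟨_, _, h4, h5⟩ := h3 h
      exact ⟨_, _, .ite_false h1 h h4, h5⟩
    · obtain ⟨_, _, h4, h5⟩ := h2 h
      exact ⟨_, _, .ite_true h1 h h4, h5⟩

/-! ### Frames -/

def Cmd.regsMod : Cmd → List Reg
  | .set r _ => [r]
  | .seq p q => p.regsMod ++ q.regsMod
  | .ite _ p q => p.regsMod ++ q.regsMod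
  | .whl _ p => p.regsMod
  | _ => []

def Cmd.arrMod : Cmd → List Arr
  | .st x _ _ _ _ => [x]
  | .seq p q => p.arrMod ++ q.arrMod
  | .ite _ p q => p.arrMod ++ q.arrMod
  | .whl _ p => p.arrMod
  | _ => []

/-- `S'` differs from `S` at most in what the command `p` may modify. -/
def Frame (p : Cmd) (S S' : AState) : Prop :=
  (∀ r, r ∉ p.regsMod → S'.regs r = S.regs r) ∧ (∀ x, x ∉ p.arrMod → S'.arr x = S.arr x)

theorem Frame.refl (p : Cmd) (S : AState) : Frame p S S := ⟨fun _ _ => rfl, fun _ _ => rfl⟩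

theorem Frame.trans {p : Cmd} {S S' S'' : AState} (h : Frame p S S') (h' : Frame p S' S'') :
    Frame p S S'' :=
  ⟨fun r hr => (h'.1 r hr).trans (h.1 r hr), fun x hx => (h'.2 x hx).trans (h.2 x hx)⟩

theorem Frame.weaken {p q : Cmd} {S S' : AState} (h : Frame p S S')
    (h1 : p.regsMod ⊆ q.regsMod) (h2 : p.arrMod ⊆ q.arrMod) : Frame q S S' :=
  ⟨fun r hr => h.1 r fun h => hr (h1 h), fun x hx => h.2 x fun h => hx (h2 h)⟩

/-- Membership in `regsMod` and `arrMod` is decidable for a concrete command, so later proofs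
recover untouched registers and arrays by `decide` instead of carrying them through loop invariants.
-/
theorem AExec.frame {p : Cmd} {S' : AState} {t : ℕ} (h : AExec V p S t S') : Frame p S S' := by
  induction h with
  | skip S => exact Frame.refl _ _
  | set h =>
    refine ⟨fun r' hr => ?_, fun x _ => rfl⟩
    simp [Cmd.regsMod] at hr
    simp [hr]
  | st h =>
    refine ⟨fun r' hr => rfl, fun x' hx => ?_⟩
    simp only [Cmd.arrMod, List.mem_singleton] at hx
    funext k' i' j'
    simp [hx]
  | put h h' => exact ⟨fun r' hr => rfl, fun x _ => rfl⟩
  | seq _ _ ih1 ih2 =>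
    exact (ih1.weaken (by simp [Cmd.regsMod]) (by simp [Cmd.arrMod])).trans
      (ih2.weaken (by simp [Cmd.regsMod]) (by simp [Cmd.arrMod]))
  | ite_true _ _ _ ih => exact ih.weaken (by simp [Cmd.regsMod]) (by simp [Cmd.arrMod])
  | ite_false _ _ _ ih => exact ih.weaken (by simp [Cmd.regsMod]) (by simp [Cmd.arrMod])
  | whl_true _ _ _ _ ih1 ih2 =>
    exact (ih1.weaken (by simp [Cmd.regsMod]) (by simp [Cmd.arrMod])).trans ih2
  | whl_false _ _ => exact Frame.refl _ _

theorem Runs.frame {p : Cmd} (h : Runs V p S Q) :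
    Runs V p S fun S' t => Q S' t ∧ Frame p S S' := by
  obtain ⟨t, S', h1, h2⟩ := h
  exact ⟨t, S', h1, h2, h1.frame⟩

/-! ### Loops -/

/-- A loop whose invariant `Inv` speaks of the time spent so far, which is bounded by `B`. -/
theorem runs_whl {e : AExp} {p : Cmd} (Inv : AState → ℕ → Prop) (B : ℕ)
    (h0 : Inv S 0)
    (hok : ∀ S' c, Inv S' c → Frame p S S' → e.Ok V S')
    (hB : ∀ S' c, Inv S' c → c ≤ B)
    (hstep : ∀ S' c, Inv S' c → Frame p S S' → e.aeval V S' ≠ 0 →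
      Runs V p S' fun S'' t => Inv S'' (c + (1 + t)))
    (hpost : ∀ S' c, Inv S' c → Frame p S S' → e.aeval V S' = 0 → Q S' (c + 1)) :
    Runs V (.whl e p) S Q := by
  -- Termination: every iteration takes at least one step, so the remaining budget `b` shrinks; once
  -- it is used up, a further iteration would contradict `hB`.
  have key : ∀ (b : ℕ) (S' : AState) (c : ℕ), Inv S' c → Frame p S S' → B ≤ c + b →
      Runs V (.whl e p) S' fun S'' t => Q S'' (c + t) := by
    intro b
    induction b with
    | zero =>
      intro S' c hI hF hb
      have ho := hok _ _ hI hF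
      by_cases hz : e.aeval V S' = 0
      · exact ⟨_, _, .whl_false ho hz, hpost _ _ hI hF hz⟩
      · obtain ⟨t, S'', h1, h2⟩ := hstep _ _ hI hF hz
        have := hB _ _ h2
        omega
    | succ b ih =>
      intro S' c hI hF hb
      have ho := hok _ _ hI hF
      by_cases hz : e.aeval V S' = 0
      · exact ⟨_, _, .whl_false ho hz, hpost _ _ hI hF hz⟩
      · obtain ⟨t, S'', h1, h2⟩ := hstep _ _ hI hF hz
        obtain ⟨t', S3, h3, h4⟩ := ih S'' _ h2 (hF.trans h1.frame) (by omega)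
        refine ⟨_, _, .whl_true ho hz h1 h3, ?_⟩
        have : c + (1 + t + t') = c + (1 + t) + t' := by ring
        simpa only [this] using h4
  obtain ⟨t, S', h1, h2⟩ := key B S 0 h0 (Frame.refl _ _) (by omega)
  exact ⟨t, S', h1, by simpa using h2⟩

/-- `for r in [0, e) do p`. -/
def Cmd.loop (r : Reg) (e : AExp) (p : Cmd) : Cmd :=
  .seq (.set r 0) (.whl (.op .lt (.r r) e) (.seq p (.set r (.r r + 1))))

theorem Frame.setReg {p : Cmd} {S S' : AState} {r : Reg} {v : ℕ} (h : Frame p S S')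
    (hr : r ∈ p.regsMod) : Frame p S (S'.setReg r v) := by
  refine ⟨fun r' hr' => ?_, h.2⟩
  have : r' ≠ r := fun e => hr' (e ▸ hr)
  simp [this, h.1 r' hr']

/-- The bound `e` is evaluated anew at each test, hence the requirement that its value stay `N`.
Each iteration adds two steps to the body, the test and the increment; the initial assignment and
the last test add one each. -/
theorem runs_loop {r : Reg} {e : AExp} {p : Cmd} {N : ℕ} (Inv : ℕ → AState → ℕ → Prop)
    (hW : N < V.W)
    (h0 : Inv 0 (S.setReg r 0) 1)
    (hok : ∀ i S' c, i ≤ N → Inv i S' c → S'.regs r = i → Frame (.loop r e p) S S' →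
      e.Ok V S' ∧ e.aeval V S' = N)
    (hstep : ∀ i S' c, i < N → Inv i S' c → S'.regs r = i → Frame (.loop r e p) S S' →
      Runs V p S' fun S'' t => S''.regs r = i ∧ Inv (i + 1) (S''.setReg r (i + 1)) (c + t + 2))
    (hpost : ∀ S' c, Inv N S' c → S'.regs r = N → Frame (.loop r e p) S S' → Q S' (c + 1)) :
    Runs V (.loop r e p) S Q := by
  have key : ∀ (b : ℕ) (S' : AState) (c i : ℕ), i + b = N → Inv i S' c → S'.regs r = i →
      Frame (.loop r e p) S S' →
      Runs V (.whl (.op .lt (.r r) e) (.seq p (.set r (.r r + 1)))) S'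
        fun S'' t => Q S'' (c + t) := by
    intro b
    induction b with
    | zero =>
      intro S' c i hi hI hr hF
      obtain ⟨ho, hv⟩ := hok i S' c (by omega) hI hr hF
      refine ⟨_, _, .whl_false (by simpa using ho) (by simp [hv, hr]; omega), ?_⟩
      obtain rfl : i = N := by omega
      exact hpost _ _ hI hr hF
    | succ b ih =>
      intro S' c i hi hI hr hF
      obtain ⟨ho, hv⟩ := hok i S' c (by omega) hI hr hF
      obtain ⟨t, S'', h1, h2, h3⟩ := hstep i S' c (by omega) hI hr hF
      have hset : AExec V (.set r (.r r + 1)) S'' 1 (S''.setReg r (i + 1)) := by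
        have : AExp.Ok V S'' (.r r + 1) := by simp [h2]; omega
        simpa [h2] using AExec.set (r := r) this
      have hF' : Frame (.loop r e p) S (S''.setReg r (i + 1)) :=
        (hF.trans (h1.frame.weaken (by simp [Cmd.loop, Cmd.regsMod])
          (by simp [Cmd.loop, Cmd.arrMod]))).setReg (by simp [Cmd.loop, Cmd.regsMod])
      obtain ⟨t', S3, h4, h5⟩ := ih _ _ (i + 1) (by omega) h3 (by simp) hF'
      refine ⟨_, _, .whl_true (by simpa using ho) (by simp [hv, hr]; omega) (.seq h1 hset) h4, ?_⟩
      have : c + (1 + (t + 1) + t') = c + t + 2 + t' := by ring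
      simpa only [this] using h5
  have h1 : AExec V (.set r 0) S 1 (S.setReg r 0) :=
    AExec.set (e := 0) (by simp; omega)
  obtain ⟨t, S', h2, h3⟩ := key N _ 1 0 (by omega) h0 (by simp)
    ((Frame.refl _ S).setReg (by simp [Cmd.loop, Cmd.regsMod]))
  exact ⟨_, _, .seq h1 h2, h3⟩

end Rules

/-! ### Compilation -/

/-- Address of an array cell. -/
def address (E x k i j : ℕ) : ℕ := ((x * E + k) * E + i) * E + j

theorem address_inj {E x k i j x' k' i' j' : ℕ} (hk : k < E) (hi : i < E) (hj : j < E)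
    (hk' : k' < E) (hi' : i' < E) (hj' : j' < E)
    (h : address E x k i j = address E x' k' i' j') : x = x' ∧ k = k' ∧ i = i' ∧ j = j' := by
  have key : ∀ {a b a' b' : ℕ}, b < E → b' < E → a * E + b = a' * E + b' → a = a' ∧ b = b' := by
    intro a b a' b' hb hb' h
    have h1 : (a * E + b) / E = a := by
      rw [mul_comm, Nat.mul_add_div (by omega), Nat.div_eq_of_lt hb, add_zero]
    have h2 : (a' * E + b') / E = a' := by
      rw [mul_comm, Nat.mul_add_div (by omega), Nat.div_eq_of_lt hb', add_zero]
    have h3 : a = a' := by rw [← h1, ← h2, h]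
    subst h3
    exact ⟨rfl, by omega⟩
  obtain ⟨h1, h2⟩ := key hj hj' h
  obtain ⟨h3, h4⟩ := key hi hi' h1
  obtain ⟨h5, h6⟩ := key hk hk' h3
  exact ⟨h5, h6, h4, h2⟩

theorem address_lt {E x k i j X : ℕ} (hk : k < E) (hi : i < E) (hj : j < E) (hx : x < X) :
    address E x k i j < X * E * E * E := by
  have h1 : x * E + k < X * E := by nlinarith
  have h2 : (x * E + k) * E + i < X * E * E := by nlinarith
  unfold address
  nlinarith

def AExp.comp : AExp → Expr
  | .n => .reg 3
  | .m => .reg 4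
  | .L => .reg 5
  | .c k => .const k
  | .r i => .reg (i.ctorIdx + 6)
  | .ld x k i j =>
    .load (.bin .add (.bin .mul (.bin .add (.bin .mul (.bin .add (.bin .mul
      (.const x.ctorIdx) (.reg 2)) k.comp) (.reg 2)) i.comp) (.reg 2)) j.comp)
  | .op o a b => .bin o a.comp b.comp

def cellExpr (x : Arr) (k i j : AExp) : Expr :=
  .bin .add (.bin .mul (.bin .add (.bin .mul (.bin .add (.bin .mul
      (.const x.ctorIdx) (.reg 2)) k.comp) (.reg 2)) i.comp) (.reg 2)) j.comp

/-- Address of the cell `i` of the output area. -/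
def outExpr (i : AExp) : Expr :=
  -- There are 16 arrays of `E ^ 3` cells each, and the output area follows them.
  .bin .add (.bin .mul (.bin .mul (.bin .mul (.const 16) (.reg 2)) (.reg 2)) (.reg 2)) i.comp

def Cmd.compile : Cmd → Program
  | .skip => .skip
  | .set r e => .assign (r.ctorIdx + 6) e.comp
  | .st x k i j e => .store (cellExpr x k i j) e.comp
  | .put i e => .store (outExpr i) e.comp
  | .seq p q => .seq p.compile q.compile
  | .ite e p q => .ite e.comp p.compile q.compile
  | .whl e p => .while e.comp p.compile

/-- A bound for the cost of a single step of the compiled program. -/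
def Cmd.stepCost : Cmd → ℕ
  | .skip => 1
  | .set _ e => e.comp.cost + 1
  | .st x k i j e => (cellExpr x k i j).cost + e.comp.cost + 1
  | .put i e => (outExpr i).cost + e.comp.cost + 1
  | .seq p q => max p.stepCost q.stepCost
  | .ite e p q => max (e.comp.cost + 1) (max p.stepCost q.stepCost)
  | .whl e p => max (e.comp.cost + 1) p.stepCost

/-- The machine state `σ` represents the abstract state `S`. -/
structure Repr (V : Env) (σ : State) (S : AState) : Prop where
  regE : σ.regs 2 = V.E
  regn : σ.regs 3 = V.n
  regm : σ.regs 4 = V.m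
  regL : σ.regs 5 = V.L
  regs : ∀ r : Reg, σ.regs (r.ctorIdx + 6) = S.regs r
  arr : ∀ (x : Arr) (k i j : ℕ), k < V.E → i < V.E → j < V.E →
    σ.mem (address V.E x.ctorIdx k i j) = S.arr x k i j
  -- The output area needs no bound on its values, since no expression reads it.
  out : ∀ i, i < V.E * V.E → σ.mem (16 * V.E * V.E * V.E + i) = S.out i
  regs_lt : ∀ r, S.regs r < V.W
  arr_lt : ∀ (x : Arr) (k i j : ℕ), k < V.E → i < V.E → j < V.E → S.arr x k i j < V.W

/-- The parameters fit into words. -/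
structure Env.Fits (V : Env) : Prop where
  n_lt : V.n < V.W
  m_lt : V.m < V.W
  L_lt : V.L < V.W
  pos : 0 < V.E
  E_lt : 17 * V.E * V.E * V.E < V.W

section Simulation

variable {V : Env} {w : ℕ}

theorem Reg.ctorIdx_inj {r r' : Reg} (h : r.ctorIdx = r'.ctorIdx) : r = r' := by
  cases r <;> cases r' <;> first | rfl | exact absurd h (by decide)

theorem Arr.ctorIdx_inj {r r' : Arr} (h : r.ctorIdx = r'.ctorIdx) : r = r' := by
  cases r <;> cases r' <;> first | rfl | exact absurd h (by decide)

theorem Arr.ctorIdx_lt (x : Arr) : x.ctorIdx < 16 := by cases x <;> decide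

theorem cellExpr_eval (hV : V.Fits) (hw : 2 ^ w = V.W) {σ : State} {S : AState}
    (hR : Repr V σ S) {x : Arr} {k i j : AExp} (hk : k.comp.eval w σ = k.aeval V S)
    (hi : i.comp.eval w σ = i.aeval V S) (hj : j.comp.eval w σ = j.aeval V S)
    (hk' : k.aeval V S < V.E) (hi' : i.aeval V S < V.E) (hj' : j.aeval V S < V.E) :
    (cellExpr x k i j).eval w σ =
      address V.E x.ctorIdx (k.aeval V S) (i.aeval V S) (j.aeval V S) := by
  have hlt := address_lt hk' hi' hj' x.ctorIdx_lt
  have hx := x.ctorIdx_lt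
  have hE := hV.E_lt
  have hp := hV.pos
  set K := k.aeval V S
  set I := i.aeval V S
  set J := j.aeval V S
  set X := x.ctorIdx
  set E := V.E
  have h16 : 16 * E * E * E ≤ 17 * E * E * E := by nlinarith [mul_pos (mul_pos hp hp) hp]
  -- As `E` is positive, every partial Horner sum is at most the final address, so no reduction
  -- modulo the word size takes place.
  have h3 : ((X * E + K) * E + I) * E + J < V.W := by unfold address at hlt; omega
  have h2 : ((X * E + K) * E + I) * E < V.W := by omega
  have h1 : (X * E + K) * E + I < V.W := lt_of_le_of_lt (Nat.le_mul_of_pos_right _ hp) h2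
  have h0 : (X * E + K) * E < V.W := by omega
  have hm : X * E + K < V.W := lt_of_le_of_lt (Nat.le_mul_of_pos_right _ hp) h0
  have hm' : X * E < V.W := by omega
  have hm2 : X < V.W := lt_of_le_of_lt (Nat.le_mul_of_pos_right _ hp) hm'
  simp only [cellExpr, Expr.eval, BinOp.eval, hk, hi, hj, hR.regE, hw, address]
  change ((((((((X % V.W * E) % V.W + K) % V.W) * E) % V.W) + I) % V.W * E) % V.W + J) % V.W = _
  rw [Nat.mod_eq_of_lt hm2, Nat.mod_eq_of_lt hm', Nat.mod_eq_of_lt hm, Nat.mod_eq_of_lt h0,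
    Nat.mod_eq_of_lt h1, Nat.mod_eq_of_lt h2, Nat.mod_eq_of_lt h3]

theorem AExp.eval_comp (hV : V.Fits) (hw : 2 ^ w = V.W) {σ : State} {S : AState}
    (hR : Repr V σ S) (e : AExp) (he : e.Ok V S) :
    e.comp.eval w σ = e.aeval V S ∧ e.aeval V S < V.W := by
  induction e with
  | n => exact ⟨hR.regn, hV.n_lt⟩
  | m => exact ⟨hR.regm, hV.m_lt⟩
  | L => exact ⟨hR.regL, hV.L_lt⟩
  | c k => exact ⟨by simpa [AExp.comp, Expr.eval, hw] using Nat.mod_eq_of_lt he, he⟩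
  | r i => exact ⟨hR.regs i, hR.regs_lt i⟩
  | ld x k i j ihk ihi ihj =>
    obtain ⟨⟨hk, hi, hj⟩, hk', hi', hj'⟩ := he
    have := cellExpr_eval hV hw hR (x := x) (ihk hk).1 (ihi hi).1 (ihj hj).1 hk' hi' hj'
    refine ⟨?_, hR.arr_lt _ _ _ _ hk' hi' hj'⟩
    have h2 : (AExp.ld x k i j).comp.eval w σ = σ.mem ((cellExpr x k i j).eval w σ) := rfl
    rw [h2, this, hR.arr _ _ _ _ hk' hi' hj', aeval_ld]
  | op o a b iha ihb =>
    obtain ⟨⟨ha, hb⟩, hs⟩ := he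
    obtain ⟨ha1, ha2⟩ := iha ha
    obtain ⟨hb1, hb2⟩ := ihb hb
    have h1 : (1 : ℕ) < V.W := by
      have := hV.E_lt; have hp := hV.pos
      nlinarith [mul_pos (mul_pos hp hp) hp]
    have hlt : o.eval (a.aeval V S) (b.aeval V S) < V.W := by
      cases o <;> simp only [BinOp.eval, BinOp.Safe] at hs ⊢
      · exact hs
      · omega
      · exact hs
      · exact lt_of_le_of_lt (Nat.div_le_self _ _) ha2
      · exact lt_of_le_of_lt (Nat.mod_le _ _) ha2
      · split_ifs <;> omega
      · split_ifs <;> omega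
    refine ⟨?_, hlt⟩
    simp only [AExp.comp, Expr.eval, ha1, hb1, hw]
    exact Nat.mod_eq_of_lt hlt

theorem Repr.setReg {σ : State} {S : AState} (hR : Repr V σ S) (r : Reg) {v : ℕ}
    (hv : v < V.W) : Repr V (σ.setReg (r.ctorIdx + 6) v) (S.setReg r v) := by
  have aux : ∀ c, c < 6 → (σ.setReg (r.ctorIdx + 6) v).regs c = σ.regs c := by
    intro c hc
    simp only [State.setReg, Function.update_apply]
    rw [if_neg (by omega)]
  refine ⟨(aux 2 (by omega)).trans hR.regE, (aux 3 (by omega)).trans hR.regn,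
    (aux 4 (by omega)).trans hR.regm, (aux 5 (by omega)).trans hR.regL, fun r' => ?_,
    hR.arr, hR.out, fun r' => ?_, hR.arr_lt⟩
  · simp only [State.setReg, Function.update_apply, setReg_regs, add_left_inj]
    by_cases h : r' = r
    · simp [h]
    · rw [if_neg (fun h' => h (Reg.ctorIdx_inj h')), if_neg h, hR.regs]
  · rw [setReg_regs]
    split_ifs
    · exact hv
    · exact hR.regs_lt r'

theorem Repr.setArr {σ : State} {S : AState} (hR : Repr V σ S) (x : Arr) {k i j v : ℕ}
    (hk : k < V.E) (hi : i < V.E) (hj : j < V.E) (hv : v < V.W) :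
    Repr V (σ.setMem (address V.E x.ctorIdx k i j) v) (S.setArr x k i j v) := by
  refine ⟨hR.regE, hR.regn, hR.regm, hR.regL, hR.regs, fun x' k' i' j' hk' hi' hj' => ?_,
    fun i' hi' => ?_, hR.regs_lt, fun x' k' i' j' hk' hi' hj' => ?_⟩
  · simp only [State.setMem, Function.update_apply, setArr_arr]
    by_cases h : address V.E x'.ctorIdx k' i' j' = address V.E x.ctorIdx k i j
    · obtain ⟨h1, h2, h3, h4⟩ := address_inj hk' hi' hj' hk hi hj h
      rw [if_pos h, if_pos ⟨Arr.ctorIdx_inj h1, h2, h3, h4⟩]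
    · rw [if_neg h, if_neg (by rintro ⟨rfl, rfl, rfl, rfl⟩; exact h rfl), hR.arr _ _ _ _ hk' hi' hj']
  · have := address_lt hk hi hj x.ctorIdx_lt
    simp only [State.setMem, Function.update_apply]
    rw [if_neg (by omega), setArr_out, hR.out _ hi']
  · rw [setArr_arr]
    split_ifs
    · exact hv
    · exact hR.arr_lt _ _ _ _ hk' hi' hj'

theorem Repr.setOut {σ : State} {S : AState} (hR : Repr V σ S) {i : ℕ} (v : ℕ) :
    Repr V (σ.setMem (16 * V.E * V.E * V.E + i) v) (S.setOut i v) := by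
  refine ⟨hR.regE, hR.regn, hR.regm, hR.regL, hR.regs, fun x' k' i' j' hk' hi' hj' => ?_,
    fun i' hi' => ?_, hR.regs_lt, hR.arr_lt⟩
  · have := address_lt hk' hi' hj' x'.ctorIdx_lt
    simp only [State.setMem, Function.update_apply]
    rw [if_neg (by omega), setOut_arr, hR.arr _ _ _ _ hk' hi' hj']
  · simp only [State.setMem, Function.update_apply, setOut_out, add_right_inj]
    rw [hR.out _ hi']

theorem outExpr_eval (hV : V.Fits) (hw : 2 ^ w = V.W) {σ : State} {S : AState}
    (hR : Repr V σ S) {i : AExp} (hi : i.comp.eval w σ = i.aeval V S)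
    (hi' : i.aeval V S < V.E * V.E) :
    (outExpr i).eval w σ = 16 * V.E * V.E * V.E + i.aeval V S := by
  have hE := hV.E_lt
  have hp := hV.pos
  set I := i.aeval V S
  set E := V.E
  have h3 : 16 * E * E * E + I < V.W := by nlinarith [mul_pos hp hp]
  have h2 : 16 * E * E * E < V.W := by omega
  have h1 : 16 * E * E < V.W := lt_of_le_of_lt (Nat.le_mul_of_pos_right _ hp) h2
  have h0 : 16 * E < V.W := lt_of_le_of_lt (Nat.le_mul_of_pos_right _ hp) h1
  have hm : 16 < V.W := lt_of_le_of_lt (Nat.le_mul_of_pos_right _ hp) h0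
  simp only [outExpr, Expr.eval, BinOp.eval, hi, hR.regE, hw]
  change ((((16 % V.W * E) % V.W * E) % V.W * E) % V.W + I) % V.W = _
  rw [Nat.mod_eq_of_lt hm, Nat.mod_eq_of_lt h0, Nat.mod_eq_of_lt h1, Nat.mod_eq_of_lt h2,
    Nat.mod_eq_of_lt h3]

/-- One abstract step becomes one assignment, store or test, whose cost is bounded by a constant of
the program text. Time is therefore distorted only by the factor `κ`. -/
theorem AExec.simulate (hV : V.Fits) (hw : 2 ^ w = V.W) {p : Cmd} {S S' : AState} {t : ℕ}
    (h : AExec V p S t S') {κ : ℕ} (hκ : p.stepCost ≤ κ) {σ : State} (hR : Repr V σ S) :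
    ∃ t' τ, Exec w p.compile σ t' τ ∧ t' ≤ κ * t ∧ Repr V τ S' := by
  induction h generalizing σ with
  | skip S => exact ⟨_, _, .skip σ, by simpa [Cmd.stepCost] using hκ, hR⟩
  | set h =>
    obtain ⟨h1, h2⟩ := AExp.eval_comp hV hw hR _ h
    refine ⟨_, _, .assign σ _ _, by simpa [Cmd.stepCost] using hκ, ?_⟩
    rw [h1]
    exact hR.setReg _ h2
  | st h =>
    obtain ⟨⟨⟨hk, hi, hj⟩, hk', hi', hj'⟩, he⟩ := h
    refine ⟨_, _, .store σ _ _, by simpa [Cmd.stepCost] using hκ, ?_⟩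
    rw [cellExpr_eval hV hw hR (AExp.eval_comp hV hw hR _ hk).1 (AExp.eval_comp hV hw hR _ hi).1
      (AExp.eval_comp hV hw hR _ hj).1 hk' hi' hj', (AExp.eval_comp hV hw hR _ he).1]
    exact hR.setArr _ hk' hi' hj' (AExp.eval_comp hV hw hR _ he).2
  | put h h' =>
    refine ⟨_, _, .store σ _ _, by simpa [Cmd.stepCost] using hκ, ?_⟩
    rw [outExpr_eval hV hw hR (AExp.eval_comp hV hw hR _ h.1).1 h',
      (AExp.eval_comp hV hw hR _ h.2).1]
    exact hR.setOut _
  | seq _ _ ih1 ih2 =>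
    simp only [Cmd.stepCost, max_le_iff] at hκ
    obtain ⟨t1, τ1, h1, h2, h3⟩ := ih1 hκ.1 hR
    obtain ⟨t2, τ2, h4, h5, h6⟩ := ih2 hκ.2 h3
    exact ⟨_, _, .seq h1 h4, by rw [mul_add]; omega, h6⟩
  | ite_true h h' _ ih =>
    simp only [Cmd.stepCost, max_le_iff] at hκ
    obtain ⟨t1, τ1, h1, h2, h3⟩ := ih hκ.2.1 hR
    refine ⟨_, _, .ite_true ?_ h1, by rw [mul_add]; omega, h3⟩
    rwa [(AExp.eval_comp hV hw hR _ h).1]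
  | ite_false h h' _ ih =>
    simp only [Cmd.stepCost, max_le_iff] at hκ
    obtain ⟨t1, τ1, h1, h2, h3⟩ := ih hκ.2.2 hR
    refine ⟨_, _, .ite_false ?_ h1, by rw [mul_add]; omega, h3⟩
    rwa [(AExp.eval_comp hV hw hR _ h).1]
  | whl_true h h' _ _ ih1 ih2 =>
    have hκ' := hκ
    simp only [Cmd.stepCost, max_le_iff] at hκ
    obtain ⟨t1, τ1, h1, h2, h3⟩ := ih1 hκ.2 hR
    obtain ⟨t2, τ2, h4, h5, h6⟩ := ih2 hκ' h3
    refine ⟨_, _, .while_true ?_ h1 h4, by rw [mul_add, mul_add]; omega, h6⟩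
    rwa [(AExp.eval_comp hV hw hR _ h).1]
  | whl_false h h' =>
    simp only [Cmd.stepCost, max_le_iff] at hκ
    refine ⟨_, _, .while_false ?_, by omega, hR⟩
    rwa [(AExp.eval_comp hV hw hR _ h).1]

end Simulation

end WordRAM

namespace MergeWidth

/-! ## Construction sequences on natural numbers -/

/-- A list of `m` instructions on the vertices `0, …, n - 1`. Operation `0` is a merge, `1` a
positive and `2` a negative resolve. -/
structure Script where
  n : ℕ
  m : ℕ
  op : ℕ → ℕ
  a : ℕ → ℕ
  b : ℕ → ℕ

namespace Script

variable (c : Script)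

/-- A representative of the part of a vertex after `t` instructions. -/
def rep : ℕ → ℕ → ℕ
  | 0, x => x
  | t + 1, x => if c.op t = 0 ∧ rep t x = rep t (c.b t) then rep t (c.a t) else rep t x

/-- Representatives of the two parts used by instruction `t`. -/
def ra (t : ℕ) : ℕ := c.rep t (c.a t)
def rb (t : ℕ) : ℕ := c.rep t (c.b t)

structure Valid : Prop where
  op_le : ∀ t < c.m, c.op t ≤ 2
  a_lt : ∀ t < c.m, c.a t < c.n
  b_lt : ∀ t < c.m, c.b t < c.n
  ne : ∀ t < c.m, c.op t = 0 → c.ra t ≠ c.rb t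

theorem rep_succ (t x : ℕ) :
    c.rep (t + 1) x = if c.op t = 0 ∧ c.rep t x = c.rb t then c.ra t else c.rep t x := rfl

theorem rep_succ_of_ne {t : ℕ} (h : c.op t ≠ 0) (x : ℕ) : c.rep (t + 1) x = c.rep t x := by
  simp [rep_succ, h]

theorem rep_congr_succ {t x y : ℕ} (h : c.rep t x = c.rep t y) :
    c.rep (t + 1) x = c.rep (t + 1) y := by
  simp [rep_succ, h]

theorem rep_congr {s t x y : ℕ} (hst : s ≤ t) (h : c.rep s x = c.rep s y) :
    c.rep t x = c.rep t y := by
  induction t, hst using Nat.le_induction with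
  | base => exact h
  | succ t _ ih => exact c.rep_congr_succ ih

variable {c}

theorem Valid.rep_lt (hc : c.Valid) {t : ℕ} (ht : t ≤ c.m) {x : ℕ} (hx : x < c.n) :
    c.rep t x < c.n := by
  induction t generalizing x with
  | zero => exact hx
  | succ t ih =>
    rw [rep_succ]
    split_ifs
    · exact ih (by omega) (hc.a_lt t (by omega))
    · exact ih (by omega) hx

theorem Valid.ra_lt (hc : c.Valid) {t : ℕ} (ht : t < c.m) : c.ra t < c.n :=
  hc.rep_lt ht.le (hc.a_lt t ht)

theorem Valid.rb_lt (hc : c.Valid) {t : ℕ} (ht : t < c.m) : c.rb t < c.n :=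
  hc.rep_lt ht.le (hc.b_lt t ht)

theorem Valid.rep_rep (hc : c.Valid) {t : ℕ} (ht : t ≤ c.m) (x : ℕ) :
    c.rep t (c.rep t x) = c.rep t x := by
  induction t generalizing x with
  | zero => rfl
  | succ t ih =>
    have ih' := ih (by omega)
    have ha : c.rep t (c.ra t) = c.ra t := ih' _
    by_cases h0 : c.op t = 0
    · have hne := hc.ne t (by omega) h0
      by_cases h1 : c.rep t x = c.rb t
      · simp [rep_succ, h0, h1, ha, hne]
      · simp [rep_succ, h0, h1, ih']
    · simp only [rep_succ_of_ne _ h0, ih']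

theorem rep_ra_succ (hc : c.Valid) {t : ℕ} (ht : t < c.m) : c.rep t (c.ra t) = c.ra t :=
  hc.rep_rep ht.le _

theorem rep_rb_succ (hc : c.Valid) {t : ℕ} (ht : t < c.m) : c.rep t (c.rb t) = c.rb t :=
  hc.rep_rep ht.le _

variable (c)

/-- Instruction `t` concerns the pair of parts of `x` and `y`. -/
def Covers (t x y : ℕ) : Prop :=
  (c.rep t x = c.ra t ∧ c.rep t y = c.rb t) ∨ (c.rep t x = c.rb t ∧ c.rep t y = c.ra t)

open scoped Classical in
/-- The adjacency that the last `j` instructions give to a pair that is not resolved before. -/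
noncomputable def fut : ℕ → ℕ → ℕ → ℕ
  | 0, _, _ => 0
  | j + 1, x, y =>
    if c.op (c.m - (j + 1)) ≠ 0 ∧ c.Covers (c.m - (j + 1)) x y
    then (if c.op (c.m - (j + 1)) = 1 then 1 else 0) else fut j x y

/-- The pair is resolved by one of the first `t` instructions. -/
def Cov (t x y : ℕ) : Prop := ∃ i < t, c.op i ≠ 0 ∧ c.Covers i x y

/-- The adjacency matrix (the diagonal is treated like all other pairs). -/
noncomputable def adj (x y : ℕ) : ℕ := c.fut c.m x y

theorem covers_comm {t x y : ℕ} : c.Covers t x y ↔ c.Covers t y x := by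
  unfold Covers
  tauto

theorem fut_le_one (j x y : ℕ) : c.fut j x y ≤ 1 := by
  induction j with
  | zero => simp [fut]
  | succ j ih => unfold fut; split_ifs <;> omega

theorem fut_comm (j x y : ℕ) : c.fut j x y = c.fut j y x := by
  induction j with
  | zero => rfl
  | succ j ih => classical unfold fut; rw [ih]; exact if_congr (and_congr_right fun _ => c.covers_comm) rfl rfl

theorem fut_step {t : ℕ} (ht : t < c.m) (x y : ℕ) [Decidable (c.Covers t x y)] :
    c.fut (c.m - t) x y = if c.op t ≠ 0 ∧ c.Covers t x y
      then (if c.op t = 1 then 1 else 0) else c.fut (c.m - (t + 1)) x y := by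
  obtain ⟨j, hj⟩ : ∃ j, c.m - t = j + 1 := ⟨c.m - t - 1, by omega⟩
  have h1 : c.m - (j + 1) = t := by omega
  have h2 : c.m - (t + 1) = j := by omega
  rw [hj, h2, fut, h1]
  congr

theorem fut_of_not_covers {t : ℕ} (ht : t < c.m) {x y : ℕ}
    (h : ¬ (c.op t ≠ 0 ∧ c.Covers t x y)) :
    c.fut (c.m - t) x y = c.fut (c.m - (t + 1)) x y := by
  classical
  rw [c.fut_step ht, if_neg h]

/-- Vertices that share a part are never separated again, so all remaining instructions treat them
alike. -/
theorem fut_congr {j : ℕ} (hj : j ≤ c.m) {x x' y : ℕ}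
    (h : c.rep (c.m - j) x = c.rep (c.m - j) x') : c.fut j x y = c.fut j x' y := by
  classical
  induction j with
  | zero => rfl
  | succ j ih =>
    have h' : c.rep (c.m - j) x = c.rep (c.m - j) x' := c.rep_congr (by omega) h
    unfold fut
    rw [ih (by omega) h']
    exact if_congr (and_congr_right fun _ => by simp only [Covers, h]) rfl rfl

/-- In `fut` the earliest instruction that covers a pair wins; instructions that do not resolve the
pair can be dropped from the front. -/
theorem adj_of_not_cov {t : ℕ} (ht : t ≤ c.m) {x y : ℕ} (h : ¬ c.Cov t x y) :
    c.adj x y = c.fut (c.m - t) x y := by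
  induction t with
  | zero => rfl
  | succ t ih =>
    rw [ih (by omega) fun ⟨i, hi, h'⟩ => h ⟨i, by omega, h'⟩]
    exact c.fut_of_not_covers (by omega) fun h' => h ⟨t, by omega, h'⟩

theorem adj_comm (x y : ℕ) : c.adj x y = c.adj y x := c.fut_comm _ _ _

theorem adj_le_one (x y : ℕ) : c.adj x y ≤ 1 := c.fut_le_one _ _ _

/-! ### Sizes and positions of parts -/

/-- The size of the part represented by `ℓ`. -/
def size : ℕ → ℕ → ℕ
  | 0, _ => 1
  | t + 1, ℓ => if c.op t = 0 ∧ ℓ = c.ra t then size t (c.ra t) + size t (c.rb t) else size t ℓ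

/-- The first position of the part represented by `ℓ`, before the last `j` instructions. -/
def startBack : ℕ → ℕ → ℕ
  -- Final parts are laid out in the order of their representatives. The offset `1` keeps position
  -- `0` free as a border of the matrix and as the code of a missing parent.
  | 0, ℓ => 1 + ∑ y ∈ (Finset.range ℓ).filter (fun y => c.rep c.m y = y), c.size c.m y
  | j + 1, ℓ =>
    if c.op (c.m - (j + 1)) = 0 ∧ ℓ = c.rb (c.m - (j + 1))
    then startBack j (c.ra (c.m - (j + 1))) + c.size (c.m - (j + 1)) (c.ra (c.m - (j + 1)))
    else startBack j ℓ

/-- The first position of the part represented by `ℓ` after `t` instructions. -/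
def start (t ℓ : ℕ) : ℕ := c.startBack (c.m - t) ℓ

/-- The position of a vertex; positions are `1, …, n`. -/
def pos (x : ℕ) : ℕ := c.start 0 x

theorem start_step {t : ℕ} (ht : t < c.m) (ℓ : ℕ) :
    c.start t ℓ = if c.op t = 0 ∧ ℓ = c.rb t then c.start (t + 1) (c.ra t) + c.size t (c.ra t)
      else c.start (t + 1) ℓ := by
  obtain ⟨j, hj⟩ : ∃ j, c.m - t = j + 1 := ⟨c.m - t - 1, by omega⟩
  have h1 : c.m - (j + 1) = t := by omega
  have h2 : c.m - (t + 1) = j := by omega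
  rw [start, start, start, hj, h2, startBack, h1]

/-- The representatives after `t` instructions. -/
def live (t : ℕ) : Finset ℕ := (Finset.range c.n).filter fun y => c.rep t y = y

variable {c}

theorem mem_live {t y : ℕ} : y ∈ c.live t ↔ y < c.n ∧ c.rep t y = y := by simp [live]

theorem Valid.ra_mem_live (hc : c.Valid) {t : ℕ} (ht : t < c.m) : c.ra t ∈ c.live t :=
  mem_live.2 ⟨hc.ra_lt ht, rep_ra_succ hc ht⟩

theorem Valid.rb_mem_live (hc : c.Valid) {t : ℕ} (ht : t < c.m) : c.rb t ∈ c.live t :=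
  mem_live.2 ⟨hc.rb_lt ht, rep_rb_succ hc ht⟩

theorem Valid.rep_mem_live (hc : c.Valid) {t : ℕ} (ht : t ≤ c.m) {x : ℕ} (hx : x < c.n) :
    c.rep t x ∈ c.live t :=
  mem_live.2 ⟨hc.rep_lt ht hx, hc.rep_rep ht x⟩

theorem live_succ_of_ne {t : ℕ} (h : c.op t ≠ 0) : c.live (t + 1) = c.live t := by
  ext y; simp [mem_live, rep_succ_of_ne _ h]

theorem Valid.live_succ (hc : c.Valid) {t : ℕ} (ht : t < c.m) (h : c.op t = 0) :
    c.live (t + 1) = (c.live t).erase (c.rb t) := by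
  ext y
  have hne := hc.ne t ht h
  have hb := rep_rb_succ hc ht
  simp only [mem_live, Finset.mem_erase, rep_succ, h, true_and]
  constructor
  · rintro ⟨h1, h2⟩
    split_ifs at h2 with h3
    · subst h2
      exact absurd ((rep_ra_succ hc ht).symm.trans h3) hne
    · refine ⟨fun h4 => h3 (by rw [h4, hb]), h1, h2⟩
  · rintro ⟨h1, h2, h3⟩
    refine ⟨h2, ?_⟩
    rw [if_neg (by rw [h3]; exact h1), h3]

theorem Valid.sum_size (hc : c.Valid) {t : ℕ} (ht : t ≤ c.m) :
    ∑ y ∈ c.live t, c.size t y = c.n := by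
  induction t with
  | zero =>
    have : c.live 0 = Finset.range c.n := by ext y; simp [mem_live, rep]
    simp [this, size]
  | succ t ih =>
    have ih := ih (by omega)
    by_cases h : c.op t = 0
    · rw [hc.live_succ (by omega) h]
      have hne := hc.ne t (by omega) h
      have hb := hc.rb_mem_live (t := t) (by omega)
      have ha : c.ra t ∈ (c.live t).erase (c.rb t) :=
        Finset.mem_erase.2 ⟨hne, hc.ra_mem_live (by omega)⟩
      rw [← Finset.add_sum_erase _ _ hb, ← Finset.add_sum_erase _ _ ha] at ih
      rw [← Finset.add_sum_erase _ _ ha]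
      have h1 : c.size (t + 1) (c.ra t) = c.size t (c.ra t) + c.size t (c.rb t) := by
        simp [size, h]
      have h2 : ∑ y ∈ ((c.live t).erase (c.rb t)).erase (c.ra t), c.size (t + 1) y =
          ∑ y ∈ ((c.live t).erase (c.rb t)).erase (c.ra t), c.size t y := by
        refine Finset.sum_congr rfl fun y hy => ?_
        simp [size, Finset.ne_of_mem_erase hy]
      rw [h1, h2]
      omega
    · rw [live_succ_of_ne h, ← ih]
      refine Finset.sum_congr rfl fun y hy => ?_
      simp [size, h]

theorem Valid.size_add_size_le (hc : c.Valid) {t : ℕ} (ht : t < c.m) (h : c.op t = 0) :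
    c.size t (c.ra t) + c.size t (c.rb t) ≤ c.n := by
  have h1 : ({c.ra t, c.rb t} : Finset ℕ) ⊆ c.live t := by
    intro y hy
    simp only [Finset.mem_insert, Finset.mem_singleton] at hy
    obtain rfl | rfl := hy
    · exact hc.ra_mem_live ht
    · exact hc.rb_mem_live ht
  have h2 := Finset.sum_le_sum_of_subset (f := c.size t) h1
  rwa [Finset.sum_pair (hc.ne t ht h), hc.sum_size ht.le] at h2

/-- Each merge removes exactly one representative. The resulting bound on the number of merges pays
for the linear time that a merge takes in both passes over the instructions. -/
theorem Valid.card_live (hc : c.Valid) {t : ℕ} (ht : t ≤ c.m) :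
    (c.live t).card + ((Finset.range t).filter fun i => c.op i = 0).card = c.n := by
  induction t with
  | zero =>
    have : c.live 0 = Finset.range c.n := by ext y; simp [mem_live, rep]
    simp [this]
  | succ t ih =>
    have ih := ih (by omega)
    rw [Finset.range_add_one, Finset.filter_insert]
    by_cases h : c.op t = 0
    · rw [if_pos h, Finset.card_insert_of_notMem (by simp), hc.live_succ (by omega) h,
        Finset.card_erase_of_mem (hc.rb_mem_live (by omega))]
      have := Finset.card_pos.2 ⟨_, hc.rb_mem_live (t := t) (by omega)⟩
      omega
    · rw [if_neg h, live_succ_of_ne h, ih]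

/-- The number of merges is at most `n`. -/
theorem Valid.card_merge_le (hc : c.Valid) {t : ℕ} (ht : t ≤ c.m) :
    ((Finset.range t).filter fun i => c.op i = 0).card ≤ c.n := by
  have := hc.card_live ht
  omega

/-- Distinct parts occupy disjoint intervals of positions in `1, …, n`. -/
theorem Valid.start_disjoint (hc : c.Valid) {t : ℕ} (ht : t ≤ c.m) :
    (∀ x ∈ c.live t, 1 ≤ c.start t x ∧ c.start t x + c.size t x ≤ c.n + 1) ∧
    ∀ x ∈ c.live t, ∀ y ∈ c.live t, x ≠ y →
      c.start t x + c.size t x ≤ c.start t y ∨ c.start t y + c.size t y ≤ c.start t x := by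
  -- The intervals are defined from the last stage backwards, so the induction is on the number of
  -- remaining instructions.
  obtain ⟨j, hj⟩ : ∃ j, j = c.m - t := ⟨_, rfl⟩
  induction j generalizing t with
  | zero =>
    obtain rfl : t = c.m := by omega
    have key : ∀ x ∈ c.live c.m, ∀ y, x < y → y ≤ c.n →
        c.start c.m x + c.size c.m x ≤ 1 +
          ∑ z ∈ (Finset.range y).filter (fun y => c.rep c.m y = y), c.size c.m z := by
      intro x hx y hxy hy
      have h1 : insert x ((Finset.range x).filter (fun y => c.rep c.m y = y)) ⊆
          (Finset.range y).filter (fun y => c.rep c.m y = y) := by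
        intro z hz
        simp only [Finset.mem_insert, Finset.mem_filter, Finset.mem_range] at hz ⊢
        obtain rfl | ⟨h1, h2⟩ := hz
        · exact ⟨hxy, (mem_live.1 hx).2⟩
        · exact ⟨by omega, h2⟩
      have h2 := Finset.sum_le_sum_of_subset (f := c.size c.m) h1
      rw [Finset.sum_insert (by simp)] at h2
      simp only [start, Nat.sub_self, startBack]
      omega
    refine ⟨fun x hx => ⟨?_, ?_⟩, fun x hx y hy hxy => ?_⟩
    · simp [start, startBack]
    · have h1 := key x hx c.n (mem_live.1 hx).1 le_rfl
      have h2 := hc.sum_size (t := c.m) le_rfl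
      unfold live at h2
      omega
    · rcases Nat.lt_or_gt_of_ne hxy with h | h
      · left
        simpa [start, startBack] using key x hx y h (mem_live.1 hy).1.le
      · right
        simpa [start, startBack] using key y hy x h (mem_live.1 hx).1.le
  | succ j ih =>
    have ht' : t < c.m := by omega
    obtain ⟨ih1, ih2⟩ := ih (t := t + 1) (by omega) (by omega)
    by_cases h : c.op t = 0
    · have hne := hc.ne t ht' h
      have hl := hc.live_succ ht' h
      have ha : c.ra t ∈ c.live (t + 1) := by
        rw [hl]; exact Finset.mem_erase.2 ⟨hne, hc.ra_mem_live ht'⟩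
      have hsa : c.size (t + 1) (c.ra t) = c.size t (c.ra t) + c.size t (c.rb t) := by
        simp [size, h]
      have hta : c.start t (c.ra t) = c.start (t + 1) (c.ra t) := by
        rw [c.start_step ht', if_neg (by tauto)]
      have htb : c.start t (c.rb t) = c.start (t + 1) (c.ra t) + c.size t (c.ra t) := by
        rw [c.start_step ht', if_pos ⟨h, rfl⟩]
      have hso : ∀ z, z ≠ c.ra t → c.size (t + 1) z = c.size t z := by
        intro z hz; simp [size, hz]
      have hto : ∀ z, z ≠ c.rb t → c.start t z = c.start (t + 1) z := by
        intro z hz; rw [c.start_step ht', if_neg (by tauto)]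
      have hmem : ∀ z ∈ c.live t, z ≠ c.rb t → z ∈ c.live (t + 1) := by
        intro z hz hz'; rw [hl]; exact Finset.mem_erase.2 ⟨hz', hz⟩
      have ha1 := ih1 _ ha
      refine ⟨fun x hx => ?_, ?_⟩
      · by_cases hxb : x = c.rb t
        · subst hxb; omega
        · have h1 := ih1 x (hmem x hx hxb)
          by_cases hxa : x = c.ra t
          · subst hxa; omega
          · rw [hto x hxb, ← hso x hxa]; exact h1
      · have aux : ∀ x ∈ c.live t, x ≠ c.rb t →
            c.start t x + c.size t x ≤ c.start t (c.rb t) ∨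
            c.start t (c.rb t) + c.size t (c.rb t) ≤ c.start t x := by
          intro x hx hxb
          by_cases hxa : x = c.ra t
          · subst hxa; omega
          · have h2 := ih2 x (hmem x hx hxb) _ ha hxa
            have h3 := hto x hxb
            have h4 := hso x hxa
            omega
        intro x hx y hy hxy
        by_cases hxb : x = c.rb t
        · subst hxb
          exact (aux y hy (Ne.symm hxy)).symm
        · by_cases hyb : y = c.rb t
          · subst hyb
            exact aux x hx hxy
          · have h2 := ih2 x (hmem x hx hxb) y (hmem y hy hyb) hxy
            have h3 := hto x hxb
            have h4 := hto y hyb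
            by_cases hxa : x = c.ra t
            · have h5 := hso y (fun h => hxy (hxa.trans h.symm))
              subst hxa
              omega
            · have h5 := hso x hxa
              by_cases hya : y = c.ra t
              · subst hya; omega
              · have h6 := hso y hya
                omega
    · have hs : ∀ z, c.size (t + 1) z = c.size t z := by intro z; simp [size, h]
      have hst : ∀ z, c.start t z = c.start (t + 1) z := by
        intro z; rw [c.start_step ht', if_neg (by tauto)]
      rw [live_succ_of_ne h] at ih1 ih2
      simp only [hs, ← hst] at ih1 ih2
      exact ⟨ih1, ih2⟩

/-- The position of a vertex lies in the interval of its part. -/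
theorem Valid.pos_mem (hc : c.Valid) {t : ℕ} (ht : t ≤ c.m) (x : ℕ) :
    c.start t (c.rep t x) ≤ c.pos x ∧
      c.pos x < c.start t (c.rep t x) + c.size t (c.rep t x) := by
  induction t with
  | zero => simp [pos, rep, size]
  | succ t ih =>
    have ih := ih (by omega)
    have ht' : t < c.m := by omega
    rw [rep_succ]
    by_cases h : c.op t = 0
    · have hne := hc.ne t ht' h
      have hsa : c.size (t + 1) (c.ra t) = c.size t (c.ra t) + c.size t (c.rb t) := by
        simp [size, h]
      have hta : c.start t (c.ra t) = c.start (t + 1) (c.ra t) := by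
        rw [c.start_step ht', if_neg (by tauto)]
      have htb : c.start t (c.rb t) = c.start (t + 1) (c.ra t) + c.size t (c.ra t) := by
        rw [c.start_step ht', if_pos ⟨h, rfl⟩]
      by_cases h1 : c.rep t x = c.rb t
      · rw [if_pos ⟨h, h1⟩]
        rw [h1] at ih
        omega
      · rw [if_neg (by tauto)]
        rw [c.start_step ht', if_neg (by tauto)] at ih
        by_cases h2 : c.rep t x = c.ra t
        · rw [h2] at ih ⊢; omega
        · have : c.size (t + 1) (c.rep t x) = c.size t (c.rep t x) := by simp [size, h2]
          omega
    · rw [if_neg (by tauto)]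
      rw [c.start_step ht', if_neg (by tauto)] at ih
      have : c.size (t + 1) (c.rep t x) = c.size t (c.rep t x) := by simp [size, h]
      omega

theorem Valid.pos_bounds (hc : c.Valid) {x : ℕ} (hx : x < c.n) : 1 ≤ c.pos x ∧ c.pos x ≤ c.n := by
  have h0 : x ∈ c.live 0 := mem_live.2 ⟨hx, rfl⟩
  have := (hc.start_disjoint (Nat.zero_le _)).1 x h0
  simp only [size] at this
  unfold pos
  omega

/-- Every part is convex in the order of positions. -/
theorem Valid.convex (hc : c.Valid) {t : ℕ} (ht : t ≤ c.m) {x y z : ℕ} (hx : x < c.n)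
    (hy : y < c.n) (hxz : c.rep t x = c.rep t z) (h1 : c.pos x ≤ c.pos y)
    (h2 : c.pos y ≤ c.pos z) : c.rep t y = c.rep t x := by
  by_contra hne
  have hd := (hc.start_disjoint ht).2 _ (hc.rep_mem_live ht hy) _ (hc.rep_mem_live ht hx) hne
  have hpx := hc.pos_mem ht x
  have hpy := hc.pos_mem ht y
  have hpz := hc.pos_mem ht z
  rw [← hxz] at hpz
  omega

theorem Valid.pos_injOn (hc : c.Valid) {x y : ℕ} (hx : x < c.n) (hy : y < c.n)
    (h : c.pos x = c.pos y) : x = y := by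
  have := hc.convex (t := 0) (Nat.zero_le _) hx hy rfl h.le h.ge
  exact this.symm

theorem Valid.exists_pos (hc : c.Valid) {p : ℕ} (h1 : 1 ≤ p) (h2 : p ≤ c.n) :
    ∃ x < c.n, c.pos x = p := by
  have h := Finset.surj_on_of_inj_on_of_card_le (s := Finset.range c.n) (t := Finset.Icc 1 c.n)
    (fun x _ => c.pos x) (fun x hx => by
      have := hc.pos_bounds (Finset.mem_range.1 hx)
      simpa using this)
    (fun x y hx hy h => hc.pos_injOn (Finset.mem_range.1 hx) (Finset.mem_range.1 hy) h)
    (by simp) p (by simp [h1, h2])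
  obtain ⟨x, hx, rfl⟩ := h
  exact ⟨x, Finset.mem_range.1 hx, rfl⟩

variable (c)

open scoped Classical in
/-- The vertex at position `p`. -/
noncomputable def ord (p : ℕ) : ℕ := if h : ∃ x < c.n, c.pos x = p then h.choose else 0

/-- The adjacency matrix with rows and columns ordered by position. -/
noncomputable def mat (p q : ℕ) : ℕ :=
  if (1 ≤ p ∧ p ≤ c.n) ∧ (1 ≤ q ∧ q ≤ c.n) then c.adj (c.ord p) (c.ord q) else 0

variable {c}

theorem Valid.ord_spec (hc : c.Valid) {p : ℕ} (h1 : 1 ≤ p) (h2 : p ≤ c.n) :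
    c.ord p < c.n ∧ c.pos (c.ord p) = p := by
  have h := hc.exists_pos h1 h2
  unfold ord
  rw [dif_pos h]
  exact h.choose_spec

theorem Valid.ord_pos (hc : c.Valid) {x : ℕ} (hx : x < c.n) : c.ord (c.pos x) = x := by
  obtain ⟨h1, h2⟩ := hc.pos_bounds hx
  obtain ⟨h3, h4⟩ := hc.ord_spec h1 h2
  exact hc.pos_injOn h3 hx h4

theorem Valid.mat_pos (hc : c.Valid) {x y : ℕ} (hx : x < c.n) (hy : y < c.n) :
    c.mat (c.pos x) (c.pos y) = c.adj x y := by
  unfold mat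
  rw [if_pos ⟨hc.pos_bounds hx, hc.pos_bounds hy⟩, hc.ord_pos hx, hc.ord_pos hy]

variable (c)

theorem mat_comm (p q : ℕ) : c.mat p q = c.mat q p := by
  unfold mat
  rw [c.adj_comm]
  simp only [and_comm]

theorem mat_le_one (p q : ℕ) : c.mat p q ≤ 1 := by
  unfold mat
  split_ifs
  · exact c.adj_le_one _ _
  · omega

end Script

end MergeWidth

namespace MergeWidth

namespace Script

/-! ### Corners of the adjacency matrix -/

variable (c : Script)

/-- The row boundary before position `a` separates two parts after `t` instructions. -/
def Separates (t a : ℕ) : Prop :=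
  ¬ (2 ≤ a ∧ a ≤ c.n ∧ c.rep t (c.ord (a - 1)) = c.rep t (c.ord a))

/-- Equal or resolved after `t` instructions. -/
def Near (t x y : ℕ) : Prop := y = x ∨ c.Cov t x y

open scoped Classical in
/-- The representatives of the parts near the vertex `x`. -/
noncomputable def ball (t x : ℕ) : Finset ℕ :=
  (Finset.range c.n).filter fun ℓ => ∃ y < c.n, c.rep t y = ℓ ∧ c.Near t x y

open scoped Classical in
/-- The last stage at which the boundary `a` separates two parts. -/
noncomputable def sepTime (a : ℕ) : ℕ := Nat.findGreatest (fun t => c.Separates t a) c.m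

/-- A corner of the matrix `M`. -/
def IsMatrixCorner (M : ℕ → ℕ → ℕ) (a b : ℕ) : Prop :=
  M a b + M (a - 1) (b - 1) ≠ M (a - 1) b + M a (b - 1)

/-- The column boundary `b` is close to the row boundary `a`. -/
def CloseBoundary (t a b : ℕ) : Prop :=
  c.Separates t b ∧ ∃ δ ≤ 1, ∃ ε ≤ 1, (1 ≤ a - δ ∧ a - δ ≤ c.n) ∧ (1 ≤ b - ε ∧ b - ε ≤ c.n) ∧
    c.Near t (c.ord (a - δ)) (c.ord (b - ε))

variable {c}

theorem Separates.anti {s t a : ℕ} (hst : s ≤ t) (h : c.Separates t a) : c.Separates s a :=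
  fun ⟨h1, h2, h3⟩ => h ⟨h1, h2, c.rep_congr hst h3⟩

theorem Valid.separates_zero (hc : c.Valid) (a : ℕ) : c.Separates 0 a := by
  rintro ⟨h1, h2, h3⟩
  have h4 := (hc.ord_spec (p := a - 1) (by omega) (by omega)).2
  have h5 := (hc.ord_spec (p := a) (by omega) (by omega)).2
  have : c.ord (a - 1) = c.ord a := h3
  rw [this] at h4
  omega

theorem sepTime_le (a : ℕ) : c.sepTime a ≤ c.m := by
  classical exact Nat.findGreatest_le _

theorem Valid.separates_sepTime (hc : c.Valid) (a : ℕ) : c.Separates (c.sepTime a) a := by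
  classical
  exact Nat.findGreatest_spec (P := fun t => c.Separates t a) (Nat.zero_le _) (hc.separates_zero a)

theorem not_separates_succ {a : ℕ} (h : c.sepTime a < c.m) :
    ¬ c.Separates (c.sepTime a + 1) a := by
  classical
  exact Nat.findGreatest_is_greatest (P := fun t => c.Separates t a) (Nat.lt_succ_self _) h

/-- Otherwise the four entries of the window are decided only after the boundary `a` has vanished.
From then on the vertices on its two sides are indistinguishable, so the rows `a - 1` and `a` agree
on the window. -/
theorem Valid.closeBoundary_of_isCorner (hc : c.Valid) {a b : ℕ} 
    (h : IsMatrixCorner c.mat a b) (hab : c.sepTime a ≤ c.sepTime b) :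
    c.CloseBoundary (c.sepTime a) a b := by
  refine ⟨(hc.separates_sepTime b).anti hab, ?_⟩
  by_contra hno
  push Not at hno
  set t := c.sepTime a with ht
  have htm : t ≤ c.m := sepTime_le a
  have hcell : ∀ δ ≤ 1, ∀ ε ≤ 1, (1 ≤ a - δ ∧ a - δ ≤ c.n) → (1 ≤ b - ε ∧ b - ε ≤ c.n) →
      c.mat (a - δ) (b - ε) = c.fut (c.m - t) (c.ord (a - δ)) (c.ord (b - ε)) := by
    intro δ hδ ε hε h1 h2
    rw [mat, if_pos ⟨h1, h2⟩]
    exact c.adj_of_not_cov htm fun h => hno δ hδ ε hε h1 h2 (Or.inr h)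
  rcases Nat.lt_or_ge t c.m with hlt | hge
  · have hsep := not_separates_succ (c := c) (a := a) hlt
    rw [← ht] at hsep
    have hsep' := hc.separates_sepTime a
    rw [← ht] at hsep'
    unfold Separates at hsep hsep'
    rw [not_not] at hsep
    obtain ⟨h1, h2, h3⟩ := hsep
    -- Only a merge can erase a boundary. A merge resolves nothing, so instruction `t` may be
    -- skipped in `fut`, and the two vertices are compared at stage `t + 1`.
    have hop : c.op t = 0 := by
      by_contra hop
      rw [c.rep_succ_of_ne hop, c.rep_succ_of_ne hop] at h3
      exact hsep' ⟨h1, h2, h3⟩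
    have hrow : ∀ ε ≤ 1, c.mat (a - 1) (b - ε) = c.mat a (b - ε) := by
      intro ε hε
      by_cases hq : 1 ≤ b - ε ∧ b - ε ≤ c.n
      · have e1 := hcell 1 le_rfl ε hε ⟨by omega, by omega⟩ hq
        have e0 := hcell 0 (by omega) ε hε ⟨by omega, by omega⟩ hq
        rw [c.fut_of_not_covers hlt (by tauto)] at e0 e1
        rw [Nat.sub_zero] at e0
        rw [e0, e1]
        refine c.fut_congr (by omega) ?_
        rwa [show c.m - (c.m - (t + 1)) = t + 1 by omega]
      · rw [mat, mat, if_neg (by tauto), if_neg (by tauto)]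
    have e1 := hrow 0 (by omega)
    have e2 := hrow 1 le_rfl
    rw [Nat.sub_zero] at e1
    unfold IsMatrixCorner at h
    omega
  -- The boundary survives to the last stage: no instruction is left to decide an unresolved pair,
  -- so all four entries are the default `0`.
  · have hz : ∀ δ ≤ 1, ∀ ε ≤ 1, c.mat (a - δ) (b - ε) = 0 := by
      intro δ hδ ε hε
      by_cases hp : 1 ≤ a - δ ∧ a - δ ≤ c.n
      · by_cases hq : 1 ≤ b - ε ∧ b - ε ≤ c.n
        · rw [hcell δ hδ ε hε hp hq, show c.m - t = 0 by omega]
          rfl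
        · rw [mat, if_neg (by tauto)]
      · rw [mat, if_neg (by tauto)]
    have e1 := hz 0 (by omega) 0 (by omega)
    have e2 := hz 0 (by omega) 1 (by omega)
    have e3 := hz 1 (by omega) 0 (by omega)
    have e4 := hz 1 (by omega) 1 (by omega)
    rw [Nat.sub_zero] at e1 e2 e3
    rw [Nat.sub_zero] at e1
    unfold IsMatrixCorner at h
    omega

-- There are four choices of a window cell `(a - δ, b - ε)`. For each of them, `b` is determined by
-- the part of the vertex at `b - ε`, since parts are intervals and `b` is an end of this one; that
-- part lies in a ball with at most `d` parts.
open scoped Classical in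
theorem Valid.card_closeBoundary (hc : c.Valid) {d t a : ℕ} (ht : t ≤ c.m)
    (hd : ∀ x < c.n, (c.ball t x).card ≤ d) :
    ((Finset.Icc 1 (c.n + 1)).filter fun b => c.CloseBoundary t a b).card ≤ 4 * d := by
  let B : ℕ → ℕ → Finset ℕ := fun δ ε => (Finset.Icc 1 (c.n + 1)).filter fun b =>
    c.Separates t b ∧ (1 ≤ a - δ ∧ a - δ ≤ c.n) ∧ (1 ≤ b - ε ∧ b - ε ≤ c.n) ∧
      c.Near t (c.ord (a - δ)) (c.ord (b - ε))
  have hB : ∀ δ ε, ε ≤ 1 → (B δ ε).card ≤ d := by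
    intro δ ε hε
    by_cases ha : 1 ≤ a - δ ∧ a - δ ≤ c.n
    · refine le_trans ?_ (hd (c.ord (a - δ)) (hc.ord_spec ha.1 ha.2).1)
      refine Finset.card_le_card_of_injOn (fun b => c.rep t (c.ord (b - ε))) ?_ ?_
      · intro b hb
        obtain ⟨_, _, _, hb1, hb2⟩ := Finset.mem_filter.1 hb
        have := (hc.ord_spec hb1.1 hb1.2).1
        exact Finset.mem_filter.2 ⟨Finset.mem_range.2 (hc.rep_lt ht this), _, this, rfl, hb2⟩
      · have key : ∀ b ∈ B δ ε, ∀ b' ∈ B δ ε, b < b' →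
            c.rep t (c.ord (b - ε)) = c.rep t (c.ord (b' - ε)) → False := by
          intro b hb b' hb' hlt heq
          obtain ⟨_, hs, _, hb1, _⟩ := Finset.mem_filter.1 hb
          obtain ⟨_, hs', _, hb1', _⟩ := Finset.mem_filter.1 hb'
          obtain ⟨o1, o2⟩ := hc.ord_spec hb1.1 hb1.2
          obtain ⟨o1', o2'⟩ := hc.ord_spec hb1'.1 hb1'.2
          -- A part that contains the positions `b - ε` and `b' - ε` contains all positions between
          -- them. For `ε = 0` this contradicts that `b'` separates two parts, for `ε = 1` that `b`
          -- does.
          rcases Nat.le_one_iff_eq_zero_or_eq_one.1 hε with rfl | rfl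
          · obtain ⟨o3, o4⟩ := hc.ord_spec (p := b' - 1) (by omega) (by omega)
            have := hc.convex ht o1 o3 heq (by rw [o2, o4]; omega) (by rw [o2', o4]; omega)
            refine hs' ⟨by omega, by omega, ?_⟩
            rw [this, heq, Nat.sub_zero]
          · obtain ⟨o3, o4⟩ := hc.ord_spec (p := b) (by omega) (by omega)
            have := hc.convex ht o1 o3 heq (by rw [o2, o4]; omega) (by rw [o2', o4]; omega)
            exact hs ⟨by omega, by omega, this.symm⟩
        intro b hb b' hb' heq
        rcases Nat.lt_trichotomy b b' with h | h | h
        · exact (key b hb b' hb' h heq).elim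
        · exact h
        · exact (key b' hb' b hb h heq.symm).elim
    · have : B δ ε = ∅ := Finset.filter_eq_empty_iff.2 fun b _ h => ha h.2.1
      simp [this]
  have hsub : ((Finset.Icc 1 (c.n + 1)).filter fun b => c.CloseBoundary t a b) ⊆
      (B 0 0 ∪ B 0 1) ∪ (B 1 0 ∪ B 1 1) := by
    intro b hb
    obtain ⟨hb0, hs, δ, hδ, ε, hε, h⟩ := Finset.mem_filter.1 hb
    have : b ∈ B δ ε := Finset.mem_filter.2 ⟨hb0, hs, h⟩
    rcases Nat.le_one_iff_eq_zero_or_eq_one.1 hδ with rfl | rfl <;>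
    rcases Nat.le_one_iff_eq_zero_or_eq_one.1 hε with rfl | rfl <;> simp [this]
  refine (Finset.card_le_card hsub).trans ?_
  have h1 := Finset.card_union_le (B 0 0 ∪ B 0 1) (B 1 0 ∪ B 1 1)
  have h2 := Finset.card_union_le (B 0 0) (B 0 1)
  have h3 := Finset.card_union_le (B 1 0) (B 1 1)
  have := hB 0 0 (by omega)
  have := hB 0 1 (by omega)
  have := hB 1 0 (by omega)
  have := hB 1 1 (by omega)
  omega

theorem isCorner_comm {a b : ℕ} : IsMatrixCorner c.mat a b ↔ IsMatrixCorner c.mat b a := by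
  unfold IsMatrixCorner
  rw [c.mat_comm a b, c.mat_comm (a - 1) (b - 1), c.mat_comm (a - 1) b, c.mat_comm a (b - 1),
    add_comm (c.mat b (a - 1))]

open scoped Classical in
/-- The corners of a matrix of size `n`. -/
noncomputable def corners (M : ℕ → ℕ → ℕ) (n : ℕ) : Finset (ℕ × ℕ) :=
  (Finset.Icc 1 (n + 1) ×ˢ Finset.Icc 1 (n + 1)).filter fun x => IsMatrixCorner M x.1 x.2

open scoped Classical in
/-- The ordered adjacency matrix has few corners. -/
theorem Valid.card_corners (hc : c.Valid) {d : ℕ}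
    (hd : ∀ t ≤ c.m, ∀ x < c.n, (c.ball t x).card ≤ d) :
    (corners c.mat c.n).card ≤ 8 * d * (c.n + 1) := by
  let I := Finset.Icc 1 (c.n + 1)
  let X := I.sigma fun a => I.filter fun b => c.CloseBoundary (c.sepTime a) a b
  have hX : X.card ≤ (c.n + 1) * (4 * d) := by
    rw [Finset.card_sigma]
    refine (Finset.sum_le_card_nsmul _ _ (4 * d) fun a _ =>
      hc.card_closeBoundary (sepTime_le a) (hd _ (sepTime_le a))).trans ?_
    simp [I]
  have hsub : corners c.mat c.n ⊆ X.image (fun x => (x.1, x.2)) ∪ X.image fun x => (x.2, x.1) := by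
    rintro ⟨a, b⟩ h
    obtain ⟨h1, h2⟩ := Finset.mem_filter.1 h
    obtain ⟨ha, hb⟩ := Finset.mem_product.1 h1
    -- As the matrix is symmetric, a corner can be charged to the one of its two boundaries that
    -- vanishes first.
    rcases le_total (c.sepTime a) (c.sepTime b) with hab | hab
    · refine Finset.mem_union_left _ (Finset.mem_image.2 ⟨⟨a, b⟩, ?_, rfl⟩)
      exact Finset.mem_sigma.2 ⟨ha, Finset.mem_filter.2
        ⟨hb, hc.closeBoundary_of_isCorner h2 hab⟩⟩
    · refine Finset.mem_union_right _ (Finset.mem_image.2 ⟨⟨b, a⟩, ?_, rfl⟩)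
      exact Finset.mem_sigma.2 ⟨hb, Finset.mem_filter.2
        ⟨ha, hc.closeBoundary_of_isCorner (isCorner_comm.1 h2) hab⟩⟩
  refine (Finset.card_le_card hsub).trans ((Finset.card_union_le _ _).trans ?_)
  have h1 := Finset.card_image_le (s := X) (f := fun x => (x.1, x.2))
  have h2 := Finset.card_image_le (s := X) (f := fun x => (x.2, x.1))
  nlinarith

end Script

/-! ### Runs of ones -/

open Script

/-- The maximal run of ones in the row `f` that starts at `l` is `[l, r)`. -/
structure IsRun (f : ℕ → ℕ) (l r : ℕ) : Prop where
  left : f (l - 1) = 0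
  lt : l < r
  one : ∀ b, l ≤ b → b < r → f b ≠ 0
  right : f r = 0

theorem IsRun.unique {f : ℕ → ℕ} {l r r' : ℕ} (h : IsRun f l r) (h' : IsRun f l r') : r = r' := by
  rcases Nat.lt_trichotomy r r' with hlt | rfl | hlt
  · exact (h'.one r h.lt.le hlt h.right).elim
  · rfl
  · exact (h.one r' h'.lt.le hlt h'.right).elim

theorem IsRun.one_le {f : ℕ → ℕ} {l r : ℕ} (h : IsRun f l r) : 1 ≤ l := by
  by_contra hl
  obtain rfl : l = 0 := by omega
  exact h.one 0 le_rfl h.lt h.left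

/-- A zero lies between two maximal runs, so even the closed intervals `[l, r]` are disjoint. This
matters because a corner may sit at the end `r` itself. -/
theorem IsRun.disjoint {f : ℕ → ℕ} {l r l' r' : ℕ} (h : IsRun f l r) (h' : IsRun f l' r')
    (hll : l < l') : r < l' := by
  by_contra hr
  rcases Nat.lt_or_ge l' r with h1 | h1
  · exact h.one (l' - 1) (by omega) (by omega) h'.left
  · exact h'.one r (by omega) (by have := h'.lt; omega) h.right

/-- Without a corner the difference of the two rows is constant on `[l - 1, r]`. At `l` the row `f`
rises from `0`, and `g` can follow only if it is `0` at `l - 1`. Hence the constant is zero, the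
rows agree there, and `g` has the same run. -/
theorem IsRun.exists_corner {f g : ℕ → ℕ} (hg : ∀ b, g b ≤ 1) {l r : ℕ}
    (h : IsRun f l r) (hno : ¬ IsRun g l r) :
    ∃ b, l ≤ b ∧ b ≤ r ∧ f b + g (b - 1) ≠ g b + f (b - 1) := by
  by_contra hcon
  push Not at hcon
  have hl := h.one_le
  have key : ∀ j, l - 1 + j ≤ r → f (l - 1 + j) + g (l - 1) = g (l - 1 + j) := by
    intro j
    induction j with
    | zero => intro _; simp [h.left]
    | succ j ih =>
      intro hj
      have h1 := ih (by omega)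
      have h2 := hcon (l - 1 + (j + 1)) (by omega) hj
      rw [show l - 1 + (j + 1) - 1 = l - 1 + j by omega] at h2
      omega
  have h0 : g (l - 1) = 0 := by
    have h1 := key 1 (by have := h.lt; omega)
    have h2 := h.one (l - 1 + 1) (by omega) (by have := h.lt; omega)
    have h3 := hg (l - 1 + 1)
    omega
  have heq : ∀ b, l - 1 ≤ b → b ≤ r → f b = g b := by
    intro b h1 h2
    have h3 := key (b - (l - 1)) (by omega)
    rw [show l - 1 + (b - (l - 1)) = b by omega, h0] at h3
    exact h3
  have hlt := h.lt
  refine hno ⟨h0, hlt, fun b h1 h2 => ?_, ?_⟩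
  · rw [← heq b (by omega) h2.le]; exact h.one b h1 h2
  · rw [← heq r (by omega) le_rfl]; exact h.right

/-- `R a l` is the end of the run of row `a` that starts at `l`, or `0` if there is none. -/
structure IsRunTable (M R : ℕ → ℕ → ℕ) : Prop where
  sound : ∀ a l, R a l ≠ 0 → IsRun (M a) l (R a l)
  complete : ∀ a l r, IsRun (M a) l r → R a l = r

/-- Changes between consecutive rows of the table of runs. -/
def changes (R : ℕ → ℕ → ℕ) (n : ℕ) : Finset (ℕ × ℕ) :=
  (Finset.Icc 1 (n + 1) ×ˢ Finset.Icc 1 n).filter fun x => R x.1 x.2 ≠ R (x.1 - 1) x.2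

/-- The intervals that occur as runs. -/
def runIntervals (R : ℕ → ℕ → ℕ) (n : ℕ) : Finset (ℕ × ℕ) :=
  ((Finset.Icc 1 n ×ˢ Finset.Icc 1 n).filter fun x => R x.1 x.2 ≠ 0).image
    fun x => (x.2, R x.1 x.2)

section Runs

variable {M R : ℕ → ℕ → ℕ} {n : ℕ}

theorem IsRunTable.bounds (hR : IsRunTable M R) (h0 : ∀ a b, M a b ≠ 0 → (1 ≤ a ∧ a ≤ n) ∧
    (1 ≤ b ∧ b ≤ n)) {a l : ℕ} (h : R a l ≠ 0) :
    (1 ≤ a ∧ a ≤ n) ∧ (1 ≤ l ∧ l ≤ n) ∧ l < R a l ∧ R a l ≤ n + 1 := by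
  have hr := hR.sound a l h
  have h1 := h0 a l (hr.one l le_rfl hr.lt)
  have h2 := h0 a (R a l - 1) (hr.one _ (by have := hr.lt; omega) (by have := hr.lt; omega))
  have := hr.lt
  omega

/-- A change comes from a run of one of the rows `a` and `a - 1` that the other row lacks; `δ` says
which row has it. The run is charged to a corner at `a` within its closed extent. As the closed
extents of runs of one row are disjoint, the charging is injective for each `δ`. -/
theorem IsRunTable.card_changes (hR : IsRunTable M R) (hM : ∀ a b, M a b ≤ 1)
    (h0 : ∀ a b, M a b ≠ 0 → (1 ≤ a ∧ a ≤ n) ∧ (1 ≤ b ∧ b ≤ n)) :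
    (changes R n).card ≤ 2 * (corners M n).card := by
  classical
  have key : ∀ δ : ℕ, δ ≤ 1 → ((changes R n).filter fun x =>
      R (x.1 - δ) x.2 ≠ 0 ∧ R (x.1 - (1 - δ)) x.2 ≠ R (x.1 - δ) x.2).card ≤
        (corners M n).card := by
    intro δ hδ
    have hex : ∀ x ∈ (changes R n).filter fun x =>
        R (x.1 - δ) x.2 ≠ 0 ∧ R (x.1 - (1 - δ)) x.2 ≠ R (x.1 - δ) x.2,
        ∃ b, x.2 ≤ b ∧ b ≤ R (x.1 - δ) x.2 ∧ (x.1, b) ∈ corners M n := by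
      rintro ⟨a, l⟩ hx
      obtain ⟨hx1, hx2, hx3⟩ := Finset.mem_filter.1 hx
      obtain ⟨hx4, hx5⟩ := Finset.mem_filter.1 hx1
      obtain ⟨hx6, hx7⟩ := Finset.mem_product.1 hx4
      have hb := hR.bounds h0 hx2
      obtain ⟨b, hb1, hb2, hb3⟩ := (hR.sound _ _ hx2).exists_corner
        (hM (a - (1 - δ))) fun h => hx3 (hR.complete _ _ _ h)
      refine ⟨b, hb1, hb2, Finset.mem_filter.2 ⟨Finset.mem_product.2 ⟨hx6, ?_⟩, ?_⟩⟩
      · simp only [Finset.mem_Icc] at hx7 ⊢; dsimp only at hb hb1 hb2; omega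
      · unfold IsMatrixCorner
        dsimp only at hb3 ⊢
        rcases Nat.le_one_iff_eq_zero_or_eq_one.1 hδ with rfl | rfl
        · simpa using hb3
        · simp only [Nat.sub_self, Nat.sub_zero] at hb3; omega
    choose! g hg using hex
    refine Finset.card_le_card_of_injOn (fun x => (x.1, g x)) (fun x hx => (hg x hx).2.2) ?_
    rintro ⟨a, l⟩ hx ⟨a', l'⟩ hx' heq
    simp only [Prod.mk.injEq] at heq
    obtain ⟨rfl, heq⟩ := heq
    have e1 := hg _ hx
    have e2 := hg _ hx'
    have s1 := hR.sound _ _ (Finset.mem_filter.1 hx).2.1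
    have s2 := hR.sound _ _ (Finset.mem_filter.1 hx').2.1
    dsimp only at e1 e2 s1 s2
    rcases Nat.lt_trichotomy l l' with h | h | h
    · have := s1.disjoint s2 h; omega
    · rw [h]
    · have := s2.disjoint s1 h; omega
  have hsub : changes R n ⊆
      ((changes R n).filter fun x =>
        R (x.1 - 0) x.2 ≠ 0 ∧ R (x.1 - (1 - 0)) x.2 ≠ R (x.1 - 0) x.2) ∪
      ((changes R n).filter fun x =>
        R (x.1 - 1) x.2 ≠ 0 ∧ R (x.1 - (1 - 1)) x.2 ≠ R (x.1 - 1) x.2) := by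
    intro x hx
    have hx2 := (Finset.mem_filter.1 hx).2
    rw [Finset.mem_union, Finset.mem_filter, Finset.mem_filter]
    simp only [Nat.sub_zero, Nat.sub_self]
    by_cases h : R x.1 x.2 = 0
    · right
      exact ⟨hx, by omega, hx2⟩
    · left
      exact ⟨hx, h, hx2.symm⟩
  have h1 := Finset.card_le_card hsub
  have h2 := Finset.card_union_le ((changes R n).filter fun x =>
        R (x.1 - 0) x.2 ≠ 0 ∧ R (x.1 - (1 - 0)) x.2 ≠ R (x.1 - 0) x.2)
      ((changes R n).filter fun x =>
        R (x.1 - 1) x.2 ≠ 0 ∧ R (x.1 - (1 - 1)) x.2 ≠ R (x.1 - 1) x.2)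
  have h3 := key 0 (by omega)
  have h4 := key 1 (by omega)
  omega

theorem exists_change {P : ℕ → Prop} {x y : ℕ} (hxy : x ≤ y) (h : ¬ (P x ↔ P y)) :
    ∃ a, x < a ∧ a ≤ y ∧ ¬ (P (a - 1) ↔ P a) := by
  induction y, hxy using Nat.le_induction with
  | base => exact absurd Iff.rfl h
  | succ y hy ih =>
    by_cases h1 : P x ↔ P y
    · exact ⟨y + 1, by omega, le_rfl, by rw [Nat.add_sub_cancel]; tauto⟩
    · obtain ⟨a, h2, h3, h4⟩ := ih h1
      exact ⟨a, h2, by omega, h4⟩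

theorem IsRunTable.mem_changes (hR : IsRunTable M R)
    (h0 : ∀ a b, M a b ≠ 0 → (1 ≤ a ∧ a ≤ n) ∧ (1 ≤ b ∧ b ≤ n)) {a l : ℕ} (ha : 1 ≤ a)
    (h : R a l ≠ R (a - 1) l) : (a, l) ∈ changes R n := by
  refine Finset.mem_filter.2 ⟨?_, h⟩
  simp only [Finset.mem_product, Finset.mem_Icc]
  by_cases h1 : R a l = 0
  · have := hR.bounds h0 (a := a - 1) (l := l) (by omega)
    omega
  · have := hR.bounds h0 h1
    omega

/-- An interval is charged to the first row in which it is a run. Row `0` has no runs, so there the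
table changes. -/
theorem IsRunTable.card_runIntervals (hR : IsRunTable M R)
    (h0 : ∀ a b, M a b ≠ 0 → (1 ≤ a ∧ a ≤ n) ∧ (1 ≤ b ∧ b ≤ n)) :
    (runIntervals R n).card ≤ (changes R n).card := by
  have hsub : runIntervals R n ⊆ (changes R n).image fun x => (x.2, R x.1 x.2) := by
    intro x hx
    obtain ⟨⟨a, l⟩, hy, rfl⟩ := Finset.mem_image.1 hx
    have hne := (Finset.mem_filter.1 hy).2
    dsimp only at hne ⊢
    have hz : R 0 l = 0 := by
      by_contra h
      have := hR.bounds h0 h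
      omega
    have hfind : ∃ a', R a' l = R a l := ⟨a, rfl⟩
    classical
    have hs := Nat.find_spec hfind
    have hpos : 1 ≤ Nat.find hfind := by
      by_contra h
      have : Nat.find hfind = 0 := by omega
      rw [this, hz] at hs
      exact hne hs.symm
    have hmin := Nat.find_min hfind (m := Nat.find hfind - 1) (by omega)
    refine Finset.mem_image.2 ⟨(Nat.find hfind, l), hR.mem_changes h0 hpos ?_, ?_⟩
    · rw [hs]; exact fun h => hmin h.symm
    · simp [hs]
  exact (Finset.card_le_card hsub).trans Finset.card_image_le

/-! ### Common runs of dyadic blocks of rows -/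

variable (R) in
/-- `block k i l` is the common value of `R a l` for all rows `a` with `a / 2 ^ k = i`, or `0` if
they differ. -/
def block : ℕ → ℕ → ℕ → ℕ
  | 0, i, l => R i l
  | k + 1, i, l => if block k (2 * i) l = block k (2 * i + 1) l then block k (2 * i) l else 0

variable (R) in
/-- The runs that are common to a block but not to the block above it. -/
def IsEntry (k i l : ℕ) : Prop := block R k i l ≠ 0 ∧ block R (k + 1) (i / 2) l = 0

theorem block_eq {k i l : ℕ} (h : block R k i l ≠ 0) {a : ℕ} (ha : a / 2 ^ k = i) :
    R a l = block R k i l := by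
  induction k generalizing i with
  | zero => simp only [pow_zero, Nat.div_one] at ha; subst ha; rfl
  | succ k ih =>
    unfold block at h ⊢
    split_ifs at h ⊢ with h1
    swap
    · exact absurd rfl h
    have ha' : a / 2 ^ k / 2 = i := by rw [Nat.div_div_eq_div_mul, ← pow_succ]; exact ha
    rcases Nat.mod_two_eq_zero_or_one (a / 2 ^ k) with h2 | h2
    · exact ih h (by omega)
    · rw [h1] at h ⊢
      exact ih h (by omega)

theorem block_of_forall {k i l r : ℕ} (h : ∀ a, a / 2 ^ k = i → R a l = r) :
    block R k i l = r := by
  induction k generalizing i with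
  | zero => exact h i (by simp)
  | succ k ih =>
    have h1 : ∀ a, a / 2 ^ (k + 1) = a / 2 ^ k / 2 := by
      intro a; rw [Nat.div_div_eq_div_mul, ← pow_succ]
    have e1 := ih (i := 2 * i) fun a ha => h a (by rw [h1]; omega)
    have e2 := ih (i := 2 * i + 1) fun a ha => h a (by rw [h1]; omega)
    unfold block
    rw [e1, e2, if_pos rfl]

open scoped Classical in
variable (R) in
/-- The entries of level `k`. -/
noncomputable def entries (n k : ℕ) : Finset (ℕ × ℕ) :=
  (Finset.range (2 * n + 6) ×ˢ Finset.range (n + 1)).filter fun x => IsEntry R k x.1 x.2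

/-- The block above an entry contains a row that lacks the run, hence also two consecutive rows
between which the table changes at `l`. The change determines the upper block, and the parity of `i`
selects one of its two halves. -/
theorem IsRunTable.card_entries (hR : IsRunTable M R)
    (h0 : ∀ a b, M a b ≠ 0 → (1 ≤ a ∧ a ≤ n) ∧ (1 ≤ b ∧ b ≤ n)) (k : ℕ) :
    (entries R n k).card ≤ 2 * (changes R n).card := by
  classical
  have hsub : entries R n k ⊆ (changes R n ×ˢ Finset.range 2).image
      fun x => (2 * (x.1.1 / 2 ^ (k + 1)) + x.2, x.1.2) := by
    rintro ⟨i, l⟩ hx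
    obtain ⟨h1, h2⟩ : IsEntry R k i l := (Finset.mem_filter.1 hx).2
    have hdiv : ∀ a, a / 2 ^ (k + 1) = a / 2 ^ k / 2 := by
      intro a; rw [Nat.div_div_eq_div_mul, ← pow_succ]
    have hy : ∃ y, y / 2 ^ (k + 1) = i / 2 ∧ R y l ≠ block R k i l := by
      by_contra hcon
      push Not at hcon
      exact h1 ((block_of_forall hcon).symm.trans h2)
    obtain ⟨y, hy1, hy2⟩ := hy
    have hx1 : (2 ^ k * i) / 2 ^ k = i := Nat.mul_div_cancel_left _ (by positivity)
    have hx2 := block_eq h1 hx1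
    have hx3 : (2 ^ k * i) / 2 ^ (k + 1) = i / 2 := by rw [hdiv, hx1]
    set x := 2 ^ k * i
    have : ∃ a, a / 2 ^ (k + 1) = i / 2 ∧ 1 ≤ a ∧ R a l ≠ R (a - 1) l := by
      rcases le_total x y with hxy | hxy
      · obtain ⟨a, ha1, ha2, ha3⟩ := exists_change (P := fun z => R z l = block R k i l) hxy
          (by simp [hx2, hy2])
        refine ⟨a, ?_, by omega, fun h => ha3 (by rw [h])⟩
        have e1 := Nat.div_le_div_right (c := 2 ^ (k + 1)) ha1.le
        have e2 := Nat.div_le_div_right (c := 2 ^ (k + 1)) ha2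
        omega
      · obtain ⟨a, ha1, ha2, ha3⟩ := exists_change (P := fun z => R z l = block R k i l) hxy
          (by simp [hx2, hy2])
        refine ⟨a, ?_, by omega, fun h => ha3 (by rw [h])⟩
        have e1 := Nat.div_le_div_right (c := 2 ^ (k + 1)) ha1.le
        have e2 := Nat.div_le_div_right (c := 2 ^ (k + 1)) ha2
        omega
    obtain ⟨a, ha1, ha2, ha3⟩ := this
    refine Finset.mem_image.2 ⟨((a, l), i % 2), ?_, ?_⟩
    · exact Finset.mem_product.2 ⟨hR.mem_changes h0 ha2 ha3,
        Finset.mem_range.2 (Nat.mod_lt _ (by norm_num))⟩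
    · simp only [ha1, Prod.mk.injEq, and_true]; omega
  refine (Finset.card_le_card hsub).trans (Finset.card_image_le.trans ?_)
  rw [Finset.card_product, Finset.card_range, mul_comm]

/-- Every run of a row is an entry of one of the blocks that contain the row. -/
theorem exists_entry {a l L : ℕ} (hL : block R L (a / 2 ^ L) l = 0) (h : R a l ≠ 0) :
    ∃ k < L, IsEntry R k (a / 2 ^ k) l ∧ block R k (a / 2 ^ k) l = R a l := by
  induction L with
  | zero => simp only [pow_zero, Nat.div_one, block] at hL; exact absurd hL h
  | succ L ih =>
    by_cases h1 : block R L (a / 2 ^ L) l = 0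
    · obtain ⟨k, hk, h2⟩ := ih h1
      exact ⟨k, by omega, h2⟩
    · refine ⟨L, by omega, ⟨h1, ?_⟩, (block_eq h1 rfl).symm⟩
      rwa [Nat.div_div_eq_div_mul, ← pow_succ]

end Runs

end MergeWidth

namespace WordRAM

open MergeWidth

/-! ## The algorithm -/

abbrev AExp.ld1 (x : Arr) (j : AExp) : AExp := .ld x 0 0 j
abbrev AExp.ld2 (x : Arr) (i j : AExp) : AExp := .ld x 0 i j
abbrev Cmd.st1 (x : Arr) (j e : AExp) : Cmd := .st x 0 0 j e
abbrev Cmd.st2 (x : Arr) (i j e : AExp) : Cmd := .st x 0 i j e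

/-- Sequential composition of commands. -/
infixr:30 " ;; " => Cmd.seq

/-- Replace the label `b` by the label `a`. -/
def relabelCmd : Cmd :=
  .loop .x .n (.ite (.op .eq (.ld1 .comp (.r .x)) (.r .b)) (.st1 .comp (.r .x) (.r .a)) .skip)

def initCmd : Cmd := .loop .x .n (.st1 .comp (.r .x) (.r .x) ;; .st1 .size (.r .x) 1)

/-- Run through the instructions, maintain the labels and the sizes of parts, and replace the
vertices in the instructions by the labels of their parts. -/
def forwardCmd : Cmd :=
  .loop .t .m
    (.set .a (.ld1 .comp (.ld1 .inp (3 * .r .t + 3))) ;;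
     .set .b (.ld1 .comp (.ld1 .inp (3 * .r .t + 4))) ;;
     .st1 .inp (3 * .r .t + 3) (.r .a) ;;
     .st1 .inp (3 * .r .t + 4) (.r .b) ;;
     .ite (.op .eq (.ld1 .inp (3 * .r .t + 2)) 0)
      (relabelCmd ;; .st1 .size (.r .a) (.ld1 .size (.r .a) + .ld1 .size (.r .b)))
      .skip)

/-- Assign disjoint intervals of positions to the final parts. -/
def startCmd : Cmd :=
  .set .e 1 ;;
  .loop .x .n
    (.ite (.op .eq (.ld1 .comp (.r .x)) (.r .x))
      (.st1 .start (.r .x) (.r .e) ;; .set .e (.r .e + .ld1 .size (.r .x))) .skip)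

def copyRowCmd : Cmd :=
  .loop .x .n (.st2 .val (.r .b) (.r .x) (.ld2 .val (.r .a) (.r .x)))

def copyColCmd : Cmd :=
  .loop .x .n (.st2 .val (.r .x) (.r .b) (.ld2 .val (.r .x) (.r .a)))

/-- Run through the instructions backwards, undo the merges, and maintain the adjacency of the
pairs of parts and the positions of the parts. -/
def backwardCmd : Cmd :=
  .loop .t .m
    (.set .j (.m - (.r .t + 1)) ;;
     .set .a (.ld1 .inp (3 * .r .j + 3)) ;;
     .set .b (.ld1 .inp (3 * .r .j + 4)) ;;
     .ite (.op .eq (.ld1 .inp (3 * .r .j + 2)) 0)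
      (copyRowCmd ;; copyColCmd ;;
       .st1 .size (.r .a) (.ld1 .size (.r .a) - .ld1 .size (.r .b)) ;;
       .st1 .start (.r .b) (.ld1 .start (.r .a) + .ld1 .size (.r .a)))
      (.set .e (.op .eq (.ld1 .inp (3 * .r .j + 2)) 1) ;;
       .st2 .val (.r .a) (.r .b) (.r .e) ;;
       .st2 .val (.r .b) (.r .a) (.r .e)))

/-- Conditions on the parameters that exclude overflows. -/
structure Env.Good (V : Env) : Prop where
  -- The input has `3 * m + 2` words, and block indices go up to `2 * n + 5`.
  E_ge : 3 * V.m + 2 * V.n + 10 ≤ V.E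
  L_le : V.L + 2 ≤ V.E
  pow : V.n + 1 < 2 ^ V.L
  W_gt : 17 * V.E * V.E * V.E < V.W

theorem Env.Good.W_ge {V : Env} (h : V.Good) : 1000 * V.E ≤ V.W := by
  have h1 := h.E_ge
  have h2 := h.W_gt
  have h3 : 10 ≤ V.E := by omega
  have h4 : 100 ≤ V.E * V.E := by nlinarith
  nlinarith

theorem Env.Good.fits {V : Env} (h : V.Good) : V.Fits := by
  have h1 := h.E_ge
  have h2 := h.W_ge
  have h3 := h.L_le
  exact ⟨by omega, by omega, by omega, by omega, h.W_gt⟩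

/-! ### Labels, sizes, positions and adjacency of the parts -/

section Phases

variable {V : Env} {S : AState}

theorem relabel_runs (hV : V.Good) :
    Runs V relabelCmd S fun S' t =>
      (∀ x < V.n, S'.arr .comp 0 0 x =
        if S.arr .comp 0 0 x = S.regs .b then S.regs .a else S.arr .comp 0 0 x) ∧
      t ≤ 4 * V.n + 2 := by
  have hE := hV.E_ge
  have hW := hV.W_ge
  refine runs_loop (N := V.n) (fun i S' c => (∀ x, S'.arr .comp 0 0 x =
        if x < i ∧ S.arr .comp 0 0 x = S.regs .b then S.regs .a else S.arr .comp 0 0 x) ∧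
      c ≤ 4 * i + 1) (by omega) ?_ ?_ ?_ ?_
  · simp
  · simp
  · rintro i S' c hi ⟨h1, h2⟩ hr hF
    have hb : S'.regs .b = S.regs .b := hF.1 .b (by decide)
    have ha : S'.regs .a = S.regs .a := hF.1 .a (by decide)
    simp [hr, hb, ha, h1]
    refine ⟨by omega, fun h => ⟨by omega, fun x => ?_, by omega⟩, fun h => ⟨fun x => ?_, by omega⟩⟩
    · grind
    · grind
  · rintro S' c ⟨h1, h2⟩ hr hF
    refine ⟨fun x hx => ?_, by omega⟩
    rw [h1]; simp [hx]

theorem init_runs (hV : V.Good) :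
    Runs V initCmd S fun S' t =>
      (∀ x < V.n, S'.arr .comp 0 0 x = x ∧ S'.arr .size 0 0 x = 1) ∧ t ≤ 4 * V.n + 2 := by
  have hE := hV.E_ge
  have hW := hV.W_ge
  refine runs_loop (N := V.n) (fun i S' c =>
    (∀ x < i, S'.arr .comp 0 0 x = x ∧ S'.arr .size 0 0 x = 1) ∧ c ≤ 4 * i + 1)
    (by omega) ?_ ?_ ?_ ?_
  · simp
  · simp
  · rintro i S' c hi ⟨h1, h2⟩ hr hF
    simp [hr]
    refine ⟨by omega, by omega, fun x hx => ?_, by omega⟩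
    grind
  · rintro S' c ⟨h1, h2⟩ hr hF
    exact ⟨h1, by omega⟩

/-- The number of merges among the first `t` instructions. -/
def _root_.MergeWidth.Script.merges (c : Script) (t : ℕ) : ℕ :=
  ((Finset.range t).filter fun i => c.op i = 0).card

theorem _root_.MergeWidth.Script.merges_succ (c : Script) (t : ℕ) :
    c.merges (t + 1) = c.merges t + if c.op t = 0 then 1 else 0 := by
  unfold Script.merges
  rw [Finset.range_add_one, Finset.filter_insert]
  split_ifs
  · rw [Finset.card_insert_of_notMem (by simp)]
  · rfl

variable {c : Script}

/-- Time is charged per instruction and, in addition, linearly per merge. The vertices in the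
instructions already processed have been replaced by labels, so the backward pass need not
reconstruct the partition. -/
theorem forward_runs (hV : V.Good) (hc : c.Valid) (hn : V.n = c.n) (hm : V.m = c.m)
    (h0 : ∀ x < c.n, S.arr .comp 0 0 x = x ∧ S.arr .size 0 0 x = 1)
    (hin : ∀ t < c.m, S.arr .inp 0 0 (3 * t + 2) = c.op t ∧ S.arr .inp 0 0 (3 * t + 3) = c.a t ∧
      S.arr .inp 0 0 (3 * t + 4) = c.b t) :
    Runs V forwardCmd S fun S' t =>
      (∀ x < c.n, S'.arr .comp 0 0 x = c.rep c.m x ∧ S'.arr .size 0 0 x = c.size c.m x) ∧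
      (∀ t < c.m, S'.arr .inp 0 0 (3 * t + 2) = c.op t ∧ S'.arr .inp 0 0 (3 * t + 3) = c.ra t ∧
        S'.arr .inp 0 0 (3 * t + 4) = c.rb t) ∧
      t ≤ 10 * c.m + (4 * c.n + 10) * c.n + 2 := by
  have hE := hV.E_ge
  have hW := hV.W_ge
  refine runs_loop (N := V.m) (fun i S' T =>
    (∀ x < c.n, S'.arr .comp 0 0 x = c.rep i x ∧ S'.arr .size 0 0 x = c.size i x) ∧
    (∀ t < c.m, S'.arr .inp 0 0 (3 * t + 2) = c.op t ∧
      S'.arr .inp 0 0 (3 * t + 3) = (if t < i then c.ra t else c.a t) ∧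
      S'.arr .inp 0 0 (3 * t + 4) = (if t < i then c.rb t else c.b t)) ∧
    T ≤ 10 * i + (4 * c.n + 10) * c.merges i + 1) (by omega) ?_ ?_ ?_ ?_
  · refine ⟨?_, ?_, by omega⟩
    · simpa [Script.rep, Script.size] using h0
    · simpa using hin
  · simp
  · rintro i S' T hi ⟨h1, h2, h3⟩ hr hF
    have hi' : i < c.m := by omega
    obtain ⟨e1, e2, e3⟩ := h2 i hi'
    simp only [lt_irrefl, if_false] at e2 e3
    have hal := hc.a_lt i hi'
    have hbl := hc.b_lt i hi'
    have hra := hc.ra_lt hi'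
    have hrb := hc.rb_lt hi'
    have f1 : S'.arr .comp 0 0 (c.a i) = c.ra i := (h1 _ hal).1
    have f2 : S'.arr .comp 0 0 (c.b i) = c.rb i := (h1 _ hbl).1
    have hms := c.merges_succ i
    simp [hr, e1, e2, e3, f1, f2]
    refine ⟨by omega, by omega, by omega, by omega, by omega, fun hop => ?_, fun hop => ?_⟩
    · refine ((relabel_runs hV).frame).mono ?_
      rintro S2 t2 ⟨⟨g1, g2⟩, gF⟩
      have ga : S2.regs .a = c.ra i := by rw [gF.1 .a (by decide)]; simp
      have gb : S2.regs .b = c.rb i := by rw [gF.1 .b (by decide)]; simp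
      have gt : S2.regs .t = i := by rw [gF.1 .t (by decide)]; simp [hr]
      have gs : ∀ x, S2.arr .size 0 0 x = S'.arr .size 0 0 x := by
        intro x; rw [gF.2 .size (by decide)]; simp
      have gi : ∀ x, S2.arr .inp 0 0 x = if x = 3 * i + 4 then c.rb i else
          if x = 3 * i + 3 then c.ra i else S'.arr .inp 0 0 x := by
        intro x; rw [gF.2 .inp (by decide)]; simp
      have hsz := hc.size_add_size_le hi' hop
      have hne := hc.ne i hi' hop
      simp at g1
      rw [if_pos hop] at hms
      simp [ga, gb, gt, gs, (h1 _ hra).2, (h1 _ hrb).2]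
      refine ⟨⟨by omega, by omega⟩, fun x hx => ⟨?_, ?_⟩, fun t ht => ⟨?_, ?_, ?_⟩, ?_⟩
      · rw [g1 x (by omega), (h1 x hx).1, c.rep_succ]
        simp [hop]
      · simp only [Script.size, hop, true_and, (h1 x hx).2]
      · rw [gi, if_neg (by omega), if_neg (by omega)]
        exact (h2 t ht).1
      · rw [gi, if_neg (by omega), (h2 t ht).2.1]
        grind
      · rw [gi, (h2 t ht).2.2]
        grind
      · rw [hms, mul_add_one (4 * c.n + 10)]; omega
    · rw [if_neg hop] at hms
      refine ⟨fun x hx => ⟨?_, ?_⟩, fun t ht => ⟨?_, ?_, ?_⟩, ?_⟩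
      · rw [(h1 x hx).1, c.rep_succ_of_ne hop]
      · simp [Script.size, hop, (h1 x hx).2]
      · rw [if_neg (by omega), if_neg (by omega)]
        exact (h2 t ht).1
      · rw [if_neg (by omega), (h2 t ht).2.1]
        grind
      · rw [(h2 t ht).2.2]
        grind
      · rw [hms, add_zero]; omega
  · rintro S' T ⟨h1, h2, h3⟩ hr hF
    rw [hm] at h1 h3
    refine ⟨h1, fun t ht => ?_, ?_⟩
    · have := h2 t ht
      rw [if_pos (by omega), if_pos (by omega)] at this
      exact this
    · have := Nat.mul_le_mul_left (4 * c.n + 10) (hc.card_merge_le le_rfl)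
      unfold Script.merges at h3
      omega

theorem start_runs (hV : V.Good) (hc : c.Valid) (hn : V.n = c.n)
    (h0 : ∀ x < c.n, S.arr .comp 0 0 x = c.rep c.m x ∧ S.arr .size 0 0 x = c.size c.m x) :
    Runs V startCmd S fun S' t =>
      (∀ x ∈ c.live c.m, S'.arr .start 0 0 x = c.start c.m x) ∧ t ≤ 6 * c.n + 3 := by
  have hE := hV.E_ge
  have hW := hV.W_ge
  have hsum : ∀ i ≤ c.n, ∑ y ∈ (Finset.range i).filter (fun y => c.rep c.m y = y), c.size c.m y ≤
      c.n := by
    intro i hi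
    rw [← hc.sum_size le_rfl]
    refine Finset.sum_le_sum_of_subset (Finset.filter_subset_filter _ ?_)
    simpa using hi
  unfold startCmd
  simp only [runs_seq, runs_set]
  refine ⟨by simp; omega, ?_⟩
  refine runs_loop (N := V.n) (fun i S' T =>
    (∀ x ∈ c.live c.m, x < i → S'.arr .start 0 0 x = c.start c.m x) ∧
    S'.regs .e = 1 + ∑ y ∈ (Finset.range i).filter (fun y => c.rep c.m y = y), c.size c.m y ∧
    T ≤ 6 * i + 1) (by omega) ?_ ?_ ?_ ?_
  · simp
  · simp
  · rintro i S' T hi ⟨h1, h2, h3⟩ hr hF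
    have g1 : S'.arr .comp = S.arr .comp := hF.2 .comp (by decide)
    have g2 : S'.arr .size = S.arr .size := hF.2 .size (by decide)
    have e1 := h0 i (by omega)
    have e2 := hsum i (by omega)
    have e3 := hsum (i + 1) (by omega)
    rw [Finset.range_add_one, Finset.filter_insert] at e3
    simp [hr, g1, g2, e1, h2]
    rw [Finset.range_add_one, Finset.filter_insert]
    refine ⟨by omega, fun h => ⟨by omega, ⟨by omega, ?_⟩, fun x hx hxi => ?_, ?_, by omega⟩,
      fun h => ⟨fun x hx hxi => ?_, ?_, by omega⟩⟩
    · rw [if_pos h, Finset.sum_insert (by simp)] at e3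
      omega
    · split_ifs with h4
      · subst h4; simp [Script.start, Script.startBack]
      · exact h1 x hx (by omega)
    · rw [if_pos h, Finset.sum_insert (by simp)]; ring
    · refine h1 x hx ?_
      have : x ≠ i := fun h4 => h (h4 ▸ (Script.mem_live.1 hx).2)
      omega
    · rw [if_neg h]
  · rintro S' T ⟨h1, h2, h3⟩ hr hF
    exact ⟨fun x hx => h1 x hx (by have := (Script.mem_live.1 hx).1; omega), by omega⟩

theorem copyRow_runs (hV : V.Good) (ha : S.regs .a < V.n) (hb : S.regs .b < V.n) :
    Runs V copyRowCmd S fun S' t =>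
      (∀ y z, S'.arr .val 0 y z =
        if y = S.regs .b ∧ z < V.n then S.arr .val 0 (S.regs .a) z else S.arr .val 0 y z) ∧
      t ≤ 3 * V.n + 2 := by
  have hE := hV.E_ge
  have hW := hV.W_ge
  refine runs_loop (N := V.n) (fun i S' T => (∀ y z, S'.arr .val 0 y z =
        if y = S.regs .b ∧ z < i then S.arr .val 0 (S.regs .a) z else S.arr .val 0 y z) ∧
      T ≤ 3 * i + 1) (by omega) ?_ ?_ ?_ ?_
  · simp
  · simp
  · rintro i S' T hi ⟨h1, h2⟩ hr hF
    have gb : S'.regs .b = S.regs .b := hF.1 .b (by decide)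
    have ga : S'.regs .a = S.regs .a := hF.1 .a (by decide)
    simp [hr, ga, gb, h1]
    refine ⟨⟨by omega, by omega⟩, fun y z => ?_, by omega⟩
    grind
  · rintro S' T ⟨h1, h2⟩ hr hF
    exact ⟨h1, by omega⟩

theorem copyCol_runs (hV : V.Good) (ha : S.regs .a < V.n) (hb : S.regs .b < V.n) :
    Runs V copyColCmd S fun S' t =>
      (∀ y z, S'.arr .val 0 y z =
        if z = S.regs .b ∧ y < V.n then S.arr .val 0 y (S.regs .a) else S.arr .val 0 y z) ∧
      t ≤ 3 * V.n + 2 := by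
  have hE := hV.E_ge
  have hW := hV.W_ge
  refine runs_loop (N := V.n) (fun i S' T => (∀ y z, S'.arr .val 0 y z =
        if z = S.regs .b ∧ y < i then S.arr .val 0 y (S.regs .a) else S.arr .val 0 y z) ∧
      T ≤ 3 * i + 1) (by omega) ?_ ?_ ?_ ?_
  · simp
  · simp
  · rintro i S' T hi ⟨h1, h2⟩ hr hF
    have gb : S'.regs .b = S.regs .b := hF.1 .b (by decide)
    have ga : S'.regs .a = S.regs .a := hF.1 .a (by decide)
    simp [hr, ga, gb, h1]
    refine ⟨⟨by omega, by omega⟩, fun y z => ?_, by omega⟩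
    grind
  · rintro S' T ⟨h1, h2⟩ hr hF
    exact ⟨h1, by omega⟩

/-- After `i` instructions are undone, the cell of two live labels holds the value `fut i` of their
parts. Undoing a merge gives the label of `b` a copy of the row and column of `a`; a resolve
overwrites one symmetric pair of cells. Going backwards, the last write stems from the earliest
covering instruction, which is the one that decides. -/
theorem backward_runs (hV : V.Good) (hc : c.Valid) (hn : V.n = c.n) (hm : V.m = c.m)
    (h0 : ∀ x < c.n, S.arr .size 0 0 x = c.size c.m x)
    (hs : ∀ x ∈ c.live c.m, S.arr .start 0 0 x = c.start c.m x)
    (hin : ∀ t < c.m, S.arr .inp 0 0 (3 * t + 2) = c.op t ∧ S.arr .inp 0 0 (3 * t + 3) = c.ra t ∧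
      S.arr .inp 0 0 (3 * t + 4) = c.rb t)
    (hval : ∀ x y, S.arr .val 0 x y = 0) :
    Runs V backwardCmd S fun S' t =>
      (∀ x < c.n, ∀ y < c.n, S'.arr .val 0 x y = c.adj x y) ∧
      (∀ x < c.n, S'.arr .start 0 0 x = c.pos x) ∧
      t ≤ 10 * c.m + (6 * c.n + 10) * c.n + 2 := by
  have hE := hV.E_ge
  have hW := hV.W_ge
  have hmm : ∀ j ≤ c.m, c.merges (c.m - j) ≤ c.merges c.m := fun j _ =>
    Finset.card_le_card (Finset.filter_subset_filter _ (by simp))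
  refine runs_loop (N := V.m) (fun i S' T =>
    (∀ x < c.n, S'.arr .size 0 0 x = c.size (c.m - i) x) ∧
    (∀ x ∈ c.live (c.m - i), S'.arr .start 0 0 x = c.start (c.m - i) x) ∧
    (∀ x < c.n, ∀ y < c.n, S'.arr .val 0 (c.rep (c.m - i) x) (c.rep (c.m - i) y) = c.fut i x y) ∧
    -- The merges undone so far number `merges m - merges (m - i)`; the inequality is arranged to
    -- avoid the subtraction.
    T + (6 * c.n + 10) * c.merges (c.m - i) ≤ 10 * i + (6 * c.n + 10) * c.merges c.m + 1)
    (by omega) ?_ ?_ ?_ ?_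
  · refine ⟨by simpa using h0, by simpa using hs, fun x _ y _ => by simpa [Script.fut] using hval _ _, by simp; omega⟩
  · simp
  · rintro i S' T hi ⟨h1, h2, h3, h4⟩ hr hF
    obtain ⟨τ, hτ⟩ : ∃ τ, τ = c.m - (i + 1) := ⟨_, rfl⟩
    have hτ1 : c.m - i = τ + 1 := by omega
    have hτm : τ < c.m := by omega
    have gi : S'.arr .inp = S.arr .inp := hF.2 .inp (by decide)
    obtain ⟨e1, e2, e3⟩ := hin τ hτm
    have hra := hc.ra_lt hτm
    have hrb := hc.rb_lt hτm
    have hal := hc.ra_mem_live hτm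
    have hbl := hc.rb_mem_live hτm
    have hms := c.merges_succ τ
    have hfut : ∀ x y, c.fut (i + 1) x y = c.fut (c.m - τ) x y := fun x y => by
      rw [show c.m - τ = i + 1 by omega]
    have hfut' : ∀ x y, c.fut i x y = c.fut (c.m - (τ + 1)) x y := fun x y => by
      rw [show c.m - (τ + 1) = i by omega]
    have hj : V.m - (i + 1) = τ := by omega
    rw [hτ1] at h1 h2 h3 h4
    simp only [hfut'] at h3
    simp [hr, gi, hj, e1, e2, e3]
    simp only [← hτ, hfut]
    have ha1 := hc.rep_rep hτm.le (c.a τ)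
    refine ⟨by omega, by omega, by omega, by omega, fun hop => ?_, fun hop => ?_⟩
    · have hne := hc.ne τ hτm hop
      rw [if_pos hop] at hms
      refine ((copyRow_runs hV (by simp; omega) (by simp; omega)).frame).mono ?_
      rintro S2 t2 ⟨⟨g1, g2⟩, gF⟩
      have ga : S2.regs .a = c.ra τ := by rw [gF.1 .a (by decide)]; simp
      have gb : S2.regs .b = c.rb τ := by rw [gF.1 .b (by decide)]; simp
      refine ((copyCol_runs hV (by rw [ga]; omega) (by rw [gb]; omega)).frame).mono ?_
      rintro S3 t3 ⟨⟨k1, k2⟩, kF⟩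
      have ka : S3.regs .a = c.ra τ := by rw [kF.1 .a (by decide), ga]
      have kb : S3.regs .b = c.rb τ := by rw [kF.1 .b (by decide), gb]
      have kt : S3.regs .t = i := by rw [kF.1 .t (by decide), gF.1 .t (by decide)]; simp [hr]
      have ks : ∀ x, S3.arr .size 0 0 x = S'.arr .size 0 0 x := by
        intro x; rw [kF.2 .size (by decide), gF.2 .size (by decide)]; simp
      have kst : ∀ x, S3.arr .start 0 0 x = S'.arr .start 0 0 x := by
        intro x; rw [kF.2 .start (by decide), gF.2 .start (by decide)]; simp
      simp at g1
      simp only [ga, gb, g1] at k1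
      have hsz := hc.size_add_size_le hτm hop
      have hsa : c.size (τ + 1) (c.ra τ) = c.size τ (c.ra τ) + c.size τ (c.rb τ) := by
        simp [Script.size, hop]
      -- The forward pass leaves the size of the absorbed label untouched, so a subtraction recovers
      -- the size of the surviving label before the merge.
      have hsb : c.size (τ + 1) (c.rb τ) = c.size τ (c.rb τ) := by
        simp [Script.size, hne.symm]
      have hal' : c.ra τ ∈ c.live (τ + 1) := by
        rw [hc.live_succ hτm hop]; exact Finset.mem_erase.2 ⟨hne, hal⟩
      have hst : c.start (τ + 1) (c.ra τ) ≤ c.n + 1 := by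
        have := (hc.start_disjoint (t := τ + 1) (by omega)).1 _ hal'
        omega
      simp [ka, kb, kt, ks, kst, h1 _ hra, h1 _ hrb, h2 _ hal', hsa, hsb]
      refine ⟨⟨by omega, by omega⟩, ⟨⟨by omega, by omega⟩, by omega⟩, fun x hx => ?_,
        fun x hx => ?_, fun x hx y hy => ?_, ?_⟩
      · split_ifs with h5
        · rw [h5]
        · rw [h1 x hx]; simp [Script.size, h5]
      · rw [c.start_step hτm]
        simp only [hop, true_and]
        split_ifs with h5
        · rfl
        · refine h2 x ?_
          rw [hc.live_succ hτm hop]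
          exact Finset.mem_erase.2 ⟨h5, hx⟩
      · have hx' := hc.rep_lt hτm.le hx
        have hy' := hc.rep_lt hτm.le hy
        rw [c.fut_of_not_covers hτm (by tauto), ← h3 x hx y hy, c.rep_succ, c.rep_succ, k1]
        simp only [hop, true_and]
        grind
      · rw [hms, mul_add_one (6 * c.n + 10)] at h4; omega
    · rw [if_neg hop, add_zero] at hms
      rw [hms] at h4
      have hrs : ∀ x, c.rep (τ + 1) x = c.rep τ x := c.rep_succ_of_ne hop
      simp only [hrs] at h3
      rw [Script.live_succ_of_ne hop] at h2
      refine ⟨by omega, by omega, by omega, fun x hx => ?_, fun x hx => ?_, fun x hx y hy => ?_,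
        by omega⟩
      · rw [h1 x hx]; simp [Script.size, hop]
      · rw [h2 x hx, c.start_step hτm, if_neg (by tauto)]
      · classical
        rw [c.fut_step hτm]
        have := h3 x hx y hy
        unfold Script.Covers
        grind
  · rintro S' T ⟨h1, h2, h3, h4⟩ hr hF
    simp only [hm, Nat.sub_self] at h1 h2 h3 h4
    refine ⟨h3, fun x hx => h2 x (Script.mem_live.2 ⟨hx, rfl⟩), ?_⟩
    have := Nat.mul_le_mul_left (6 * c.n + 10) (hc.card_merge_le le_rfl)
    change _ * c.merges c.m ≤ _ at this
    omega

end Phases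

end WordRAM

/-! ### The ordered matrix, its runs and the dyadic lists of entries -/

namespace WordRAM

open MergeWidth

def matRowCmd : Cmd :=
  .loop .y .n (.st2 .mat (.ld1 .start (.r .x)) (.ld1 .start (.r .y)) (.ld2 .val (.r .x) (.r .y)))

/-- Order the rows and columns of the adjacency matrix by position. -/
def matCmd : Cmd :=
  -- The search uses parent `0` for a missing parent; this cell translates it to `n` in the output.
  .st1 .ord 0 .n ;;
  .loop .x .n (.st1 .ord (.ld1 .start (.r .x)) (.r .x) ;; matRowCmd)

def runsRowCmd : Cmd :=
  .loop .y (.n + 1)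
    (.set .l (.n - .r .y) ;;
     .ite (.op .eq (.ld2 .mat (.r .a) (.r .l)) 0) (.set .e (.r .l))
      (.ite (.op .eq (.ld2 .mat (.r .a) (.r .l - 1)) 0)
        (.st2 .run (.r .a) (.r .l) (.r .e)) .skip))

/-- Compute the table of runs. -/
def runsCmd : Cmd := .loop .a (.n + 1) (.set .e (.n + 1) ;; runsRowCmd)

/-- Append the entry `l` to the list of the block `e` of level `k`. -/
def pushCmd (e : AExp) : Cmd :=
  .st .lst (.r .k) e (.ld2 .cnt (.r .k) e) (.r .l) ;;
  .st2 .cnt (.r .k) e (.ld2 .cnt (.r .k) e + 1)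

def levelCellCmd : Cmd :=
  .set .x (.ld .run (.r .k) (2 * .r .i) (.r .l)) ;;
  .set .y (.ld .run (.r .k) (2 * .r .i + 1) (.r .l)) ;;
  .ite (.op .eq (.r .x) (.r .y)) (.st .run (.r .k + 1) (.r .i) (.r .l) (.r .x))
    (.ite (.r .x) (pushCmd (2 * .r .i)) .skip ;;
     .ite (.r .y) (pushCmd (2 * .r .i + 1)) .skip)

/-- Compute the common runs of dyadic blocks of rows, and the lists of entries. -/
def levelsCmd : Cmd := .loop .k .L (.loop .i (.n + 3) (.loop .l (.n + 1) levelCellCmd))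

section Phases

variable {V : Env} {S : AState} {c : Script}

theorem matRow_runs (hV : V.Good) (hc : c.Valid) (hn : V.n = c.n) (hx : S.regs .x < c.n)
    (h1 : ∀ x < c.n, S.arr .start 0 0 x = c.pos x)
    (h2 : ∀ x < c.n, ∀ y < c.n, S.arr .val 0 x y = c.adj x y) :
    Runs V matRowCmd S fun S' t =>
      (∀ p q, S'.arr .mat 0 p q = if p = c.pos (S.regs .x) ∧ (1 ≤ q ∧ q ≤ c.n) then c.mat p q
        else S.arr .mat 0 p q) ∧ t ≤ 3 * c.n + 2 := by
  have hE := hV.E_ge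
  have hW := hV.W_ge
  refine runs_loop (N := V.n) (fun i S' T =>
      (∀ p q, S'.arr .mat 0 p q = if p = c.pos (S.regs .x) ∧ (1 ≤ q ∧ q ≤ c.n) ∧ c.ord q < i
        then c.mat p q else S.arr .mat 0 p q) ∧ T ≤ 3 * i + 1) (by omega) ?_ ?_ ?_ ?_
  · simp
  · simp
  · rintro i S' T hi ⟨h3, h4⟩ hr hF
    have gx : S'.regs .x = S.regs .x := hF.1 .x (by decide)
    have gs : S'.arr .start = S.arr .start := hF.2 .start (by decide)
    have gv : S'.arr .val = S.arr .val := hF.2 .val (by decide)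
    have b1 := hc.pos_bounds hx
    have b2 := hc.pos_bounds (x := i) (by omega)
    have e1 := h2 _ hx i (by omega)
    have e2 := hc.mat_pos hx (y := i) (by omega)
    have e3 := hc.ord_pos (x := i) (by omega)
    simp [hr, gx, gs, gv, h1 _ hx, h1 i (by omega), e1, h3]
    refine ⟨by omega, fun p q => ?_, by omega⟩
    by_cases hp : p = c.pos (S.regs .x)
    · by_cases hq : q = c.pos i
      · subst hp hq
        simp [b2, e3, e2]
      · simp only [hp, hq, and_false, if_false, true_and]
        have : (1 ≤ q ∧ q ≤ c.n) → c.ord q ≠ i := fun h h' => hq (by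
          rw [← h', (hc.ord_spec h.1 h.2).2])
        grind
    · simp [hp]
  · rintro S' T ⟨h3, h4⟩ hr hF
    refine ⟨fun p q => ?_, by omega⟩
    rw [h3]
    have : (1 ≤ q ∧ q ≤ c.n) → c.ord q < c.n := fun h => (hc.ord_spec h.1 h.2).1
    grind

theorem mat_runs (hV : V.Good) (hc : c.Valid) (hn : V.n = c.n)
    (h1 : ∀ x < c.n, S.arr .start 0 0 x = c.pos x)
    (h2 : ∀ x < c.n, ∀ y < c.n, S.arr .val 0 x y = c.adj x y)
    (h3 : ∀ x y, S.arr .mat 0 x y = 0) :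
    Runs V matCmd S fun S' t =>
      (∀ p q, S'.arr .mat 0 p q = c.mat p q) ∧ S'.arr .ord 0 0 0 = c.n ∧
      (∀ p, 1 ≤ p → p ≤ c.n → S'.arr .ord 0 0 p = c.ord p) ∧
      t ≤ (3 * c.n + 5) * c.n + 3 := by
  have hE := hV.E_ge
  have hW := hV.W_ge
  unfold matCmd
  simp only [runs_seq, runs_st]
  refine ⟨by simp; omega, ?_⟩
  refine runs_loop (N := V.n) (fun i S' T =>
      (∀ p q, S'.arr .mat 0 p q = if (1 ≤ p ∧ p ≤ c.n) ∧ c.ord p < i then c.mat p q else 0) ∧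
      S'.arr .ord 0 0 0 = c.n ∧
      (∀ p, 1 ≤ p → p ≤ c.n → c.ord p < i → S'.arr .ord 0 0 p = c.ord p) ∧
      T ≤ (3 * c.n + 5) * i + 1) (by omega) ?_ ?_ ?_ ?_
  · simp [h3, hn]
  · simp
  · rintro i S' T hi ⟨h4, h5, h6, h7⟩ hr hF
    have gs : S'.arr .start = S.arr .start := hF.2 .start (by decide)
    have gv : S'.arr .val = S.arr .val := hF.2 .val (by decide)
    have b2 := hc.pos_bounds (x := i) (by omega)
    have e3 := hc.ord_pos (x := i) (by omega)
    simp [hr, gs, h1 i (by omega)]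
    refine ⟨by omega, ((matRow_runs hV hc hn (by simp [hr]; omega)
      (by simpa [gs] using h1) (by simpa [gv] using h2)).frame).mono ?_⟩
    rintro S2 t2 ⟨⟨g1, g2⟩, gF⟩
    have kx : S2.regs .x = i := by rw [gF.1 .x (by decide)]; simp [hr]
    have ko : ∀ p, S2.arr .ord 0 0 p = if p = c.pos i then i else S'.arr .ord 0 0 p := by
      intro p; rw [gF.2 .ord (by decide)]; simp
    simp [hr, h4] at g1
    refine ⟨kx, fun p q => ?_, ?_, fun p hp1 hp2 hp3 => ?_, by rw [mul_add_one]; omega⟩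
    · rw [g1]
      by_cases hp : 1 ≤ p ∧ p ≤ c.n
      · obtain ⟨o1, o2⟩ := hc.ord_spec hp.1 hp.2
        have : p = c.pos i ↔ c.ord p = i := ⟨fun h => by rw [h, e3], fun h => by rw [← h, o2]⟩
        by_cases hq : 1 ≤ q ∧ q ≤ c.n
        · grind
        · have hz : c.mat p q = 0 := by rw [Script.mat, if_neg (by tauto)]
          simp [hz]
      · have : p ≠ c.pos i := by omega
        simp [hp, this]
    · rw [ko, if_neg (by omega), h5]
    · rw [ko]
      split_ifs with h8
      · rw [h8, e3]
      · refine h6 p hp1 hp2 ?_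
        have : c.ord p ≠ i := fun h => h8 (by rw [← h, (hc.ord_spec hp1 hp2).2])
        omega
  · rintro S' T ⟨h4, h5, h6, h7⟩ hr hF
    refine ⟨fun p q => ?_, h5, fun p hp1 hp2 => h6 p hp1 hp2 ?_, ?_⟩
    · rw [h4]
      by_cases hp : 1 ≤ p ∧ p ≤ c.n
      · rw [if_pos ⟨hp, by have := (hc.ord_spec hp.1 hp.2).1; omega⟩]
      · rw [if_neg (by tauto), Script.mat, if_neg (by tauto)]
    · have := (hc.ord_spec hp1 hp2).1; omega
    · rw [hn] at h7; omega

variable {M R : ℕ → ℕ → ℕ}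

/-- The matrix has entries `0` and `1` and vanishes outside `1, …, n`. -/
structure IsMatrix (n : ℕ) (M : ℕ → ℕ → ℕ) : Prop where
  le_one : ∀ a b, M a b ≤ 1
  supp : ∀ a b, M a b ≠ 0 → (1 ≤ a ∧ a ≤ n) ∧ (1 ≤ b ∧ b ≤ n)

/-- Columns are scanned from right to left, and `e` is the first zero at or to the right of the
scanned columns, initially the border `n + 1`. A one with a zero on its left starts a run, and `e`
is the end of this run. -/
theorem runsRow_runs (hV : V.Good) (hM : IsMatrix V.n M) (hmat : ∀ p q, S.arr .mat 0 p q = M p q)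
    (ha : S.regs .a ≤ V.n) (he : S.regs .e = V.n + 1)
    (h0 : ∀ l, S.arr .run 0 (S.regs .a) l = 0) :
    Runs V runsRowCmd S fun S' t =>
      (∀ k a l, (k ≠ 0 ∨ a ≠ S.regs .a) → S'.arr .run k a l = S.arr .run k a l) ∧
      (∀ l, S'.arr .run 0 (S.regs .a) l ≠ 0 →
        IsRun (M (S.regs .a)) l (S'.arr .run 0 (S.regs .a) l)) ∧
      (∀ l r, IsRun (M (S.regs .a)) l r → S'.arr .run 0 (S.regs .a) l = r) ∧
      t ≤ 6 * V.n + 8 := by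
  have hE := hV.E_ge
  have hW := hV.W_ge
  set a := S.regs .a with haa
  have hz : ∀ b, V.n < b → M a b = 0 := by
    intro b hb
    by_contra h
    have := hM.supp _ _ h
    omega
  refine runs_loop (N := V.n + 1) (fun i S' T =>
      (∀ k a' l, (k ≠ 0 ∨ a' ≠ a) → S'.arr .run k a' l = S.arr .run k a' l) ∧
      (V.n + 1 ≤ S'.regs .e + i ∧ S'.regs .e ≤ V.n + 1 ∧ M a (S'.regs .e) = 0 ∧
        ∀ b, V.n + 1 ≤ b + i → b < S'.regs .e → M a b ≠ 0) ∧
      (∀ l, S'.arr .run 0 a l ≠ 0 → IsRun (M a) l (S'.arr .run 0 a l)) ∧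
      (∀ l r, V.n + 1 ≤ l + i → IsRun (M a) l r → S'.arr .run 0 a l = r) ∧
      T ≤ 6 * i + 1) (by omega) ?_ ?_ ?_ ?_
  · refine ⟨by simp, ⟨by simp [he], by simp [he], by simpa [he] using hz _ (by omega), ?_⟩,
      by simp [h0], ?_, by omega⟩
    · simp [he]; intros; omega
    · intro l r hl hr
      exact absurd (hz l (by omega)) (hr.one l le_rfl hr.lt)
  · simp; omega
  · rintro i S' T hi ⟨h1, ⟨e1, e2, e3, e4⟩, h3, h4, h5⟩ hr hF
    have ga : S'.regs .a = a := hF.1 .a (by decide)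
    have gm : ∀ p q, S'.arr .mat 0 p q = M p q := by
      intro p q; rw [hF.2 .mat (by decide), hmat]
    simp [hr, ga, gm]
    obtain ⟨l, hl⟩ : ∃ l, l = V.n - i := ⟨_, rfl⟩
    rw [← hl]
    have hli : l + i = V.n := by omega
    refine ⟨by omega, fun h => ?_,
      fun h => ⟨by omega, fun h' => ?_, fun h' => ?_⟩⟩
    · refine ⟨h1, ⟨by omega, by omega, h, fun b hb hb' => by omega⟩, h3, fun l' r' hl' hrun => ?_,
        by omega⟩
      by_cases hll : l' = l
      · subst hll
        exact absurd h (hrun.one _ le_rfl hrun.lt)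
      · exact h4 l' r' (by omega) hrun
    · have hel : l < S'.regs .e := by
        by_contra h6
        have : S'.regs .e = l ∨ S'.regs .e < l := by omega
        omega
      have hrun0 : IsRun (M a) l (S'.regs .e) := ⟨h', hel, fun b hb hb' => by
        by_cases hbl : b = l
        · rw [hbl]; exact h
        · exact e4 b (by omega) hb', e3⟩
      refine ⟨by omega, fun k a' l' hk => ?_, ⟨by omega, by omega, e3, fun b hb hb' => ?_⟩,
        fun l' => ?_, fun l' r' hl' hrun => ?_, by omega⟩
      · rw [if_neg (by tauto)]; exact h1 k a' l' hk
      · by_cases hbl : b = l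
        · rw [hbl]; exact h
        · exact e4 b (by omega) hb'
      · split_ifs with h7
        · intro _; rw [h7]; exact hrun0
        · exact h3 l'
      · split_ifs with h7
        · rw [h7] at hrun; exact hrun0.unique hrun
        · exact h4 l' r' (by omega) hrun
    · refine ⟨h1, ⟨by omega, by omega, e3, fun b hb hb' => ?_⟩, h3, fun l' r' hl' hrun => ?_,
        by omega⟩
      · by_cases hbl : b = l
        · rw [hbl]; exact h
        · exact e4 b (by omega) hb'
      · by_cases hll : l' = l
        · subst hll; exact absurd hrun.left h'
        · exact h4 l' r' (by omega) hrun
  · rintro S' T ⟨h1, h2, h3, h4, h5⟩ hr hF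
    exact ⟨h1, h3, fun l r hrun => h4 l r (by omega) hrun, by omega⟩

theorem runs_runs (hV : V.Good) (hM : IsMatrix V.n M) (hmat : ∀ p q, S.arr .mat 0 p q = M p q)
    (h0 : ∀ k a l, S.arr .run k a l = 0) :
    Runs V runsCmd S fun S' t =>
      IsRunTable M (S'.arr .run 0) ∧ (∀ k a l, k ≠ 0 → S'.arr .run k a l = 0) ∧
      t ≤ (6 * V.n + 11) * (V.n + 1) + 2 := by
  have hE := hV.E_ge
  have hW := hV.W_ge
  refine runs_loop (N := V.n + 1) (fun i S' T =>
      (∀ k a l, (k ≠ 0 ∨ i ≤ a) → S'.arr .run k a l = 0) ∧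
      (∀ a l, S'.arr .run 0 a l ≠ 0 → IsRun (M a) l (S'.arr .run 0 a l)) ∧
      (∀ a l r, a < i → IsRun (M a) l r → S'.arr .run 0 a l = r) ∧
      T ≤ (6 * V.n + 11) * i + 1) (by omega) ?_ ?_ ?_ ?_
  · simp [h0]
  · simp; omega
  · rintro i S' T hi ⟨h1, h2, h3, h4⟩ hr hF
    have gm : ∀ p q, S'.arr .mat 0 p q = M p q := by
      intro p q; rw [hF.2 .mat (by decide), hmat]
    simp
    refine ⟨⟨by omega, by omega⟩, ((runsRow_runs hV hM (by simpa using gm) (by simp [hr]; omega)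
      (by simp) (by simp [hr, h1])).frame).mono ?_⟩
    rintro S2 t2 ⟨⟨g1, g2, g3, g4⟩, gF⟩
    have ka : S2.regs .a = i := by rw [gF.1 .a (by decide)]; simp [hr]
    simp [hr] at g1 g2 g3
    refine ⟨ka, fun k a l hk => ?_, fun a l => ?_, fun a l r ha hrun => ?_,
      by rw [mul_add_one]; omega⟩
    · rw [g1 k a l (by omega)]
      exact h1 k a l (by omega)
    · by_cases hai : a = i
      · subst hai; exact g2 l
      · rw [g1 0 a l (Or.inr hai)]; exact h2 a l
    · by_cases hai : a = i
      · subst hai; exact g3 l r hrun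
      · rw [g1 0 a l (Or.inr hai)]; exact h3 a l r (by omega) hrun
  · rintro S' T ⟨h1, h2, h3, h4⟩ hr hF
    refine ⟨⟨h2, fun a l r hrun => ?_⟩, fun k a l hk => h1 k a l (Or.inl hk), by omega⟩
    by_cases ha : a < V.n + 1
    · exact h3 a l r ha hrun
    · have := hM.supp _ _ (hrun.one l le_rfl hrun.lt)
      omega

/-- `f 0, …, f (cnt - 1)` lists the entries `l < b` of the block `i` of level `k`. -/
structure ListUpTo (R : ℕ → ℕ → ℕ) (k i b cnt : ℕ) (f : ℕ → ℕ) : Prop where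
  complete : ∀ l < b, IsEntry R k i l → ∃ j < cnt, f j = l
  sound : ∀ j < cnt, f j < b ∧ IsEntry R k i (f j)
  -- The list has no repetitions, so that its length can be charged to the set `entries`.
  card : ∃ s ⊆ Finset.range b, (∀ l ∈ s, IsEntry R k i l) ∧ s.card = cnt

theorem ListUpTo.zero (R : ℕ → ℕ → ℕ) (k i : ℕ) (f : ℕ → ℕ) : ListUpTo R k i 0 0 f :=
  ⟨by simp, by simp, ∅, by simp, by simp, rfl⟩

theorem ListUpTo.cnt_le {k i b cnt : ℕ} {f : ℕ → ℕ} (h : ListUpTo R k i b cnt f) : cnt ≤ b := by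
  obtain ⟨s, h1, _, h3⟩ := h.card
  have := Finset.card_le_card h1
  rw [Finset.card_range] at this
  omega

theorem ListUpTo.skip {k i b b' cnt : ℕ} {f : ℕ → ℕ} (h : ListUpTo R k i b cnt f) (hb : b ≤ b')
    (hno : ∀ l, b ≤ l → l < b' → ¬ IsEntry R k i l) : ListUpTo R k i b' cnt f := by
  obtain ⟨s, h1, h2, h3⟩ := h.card
  refine ⟨fun l hl hl' => ?_, fun j hj => ⟨lt_of_lt_of_le (h.sound j hj).1 hb, (h.sound j hj).2⟩,
    s, h1.trans (by simpa using hb), h2, h3⟩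
  by_cases hlb : l < b
  · exact h.complete l hlb hl'
  · exact absurd hl' (hno l (by omega) hl)

theorem ListUpTo.push {k i b cnt cnt' : ℕ} {f f' : ℕ → ℕ} (h : ListUpTo R k i b cnt f)
    (he : IsEntry R k i b) (hc : cnt' = cnt + 1) (h1 : f' cnt = b) (h2 : ∀ j < cnt, f' j = f j) :
    ListUpTo R k i (b + 1) cnt' f' := by
  obtain ⟨s, hs1, hs2, hs3⟩ := h.card
  subst hc
  refine ⟨fun l hl hl' => ?_, fun j hj => ?_, insert b s, ?_, ?_, ?_⟩
  · by_cases hlb : l = b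
    · exact ⟨cnt, by omega, by rw [h1, hlb]⟩
    · obtain ⟨j, hj, hj'⟩ := h.complete l (by omega) hl'
      exact ⟨j, by omega, by rw [h2 j hj, hj']⟩
  · by_cases hjc : j = cnt
    · subst hjc; rw [h1]; exact ⟨by omega, he⟩
    · rw [h2 j (by omega)]
      have := h.sound j (by omega)
      exact ⟨by omega, this.2⟩
  · intro l hl
    rcases Finset.mem_insert.1 hl with rfl | hl
    · simp
    · have := Finset.mem_range.1 (hs1 hl)
      simp; omega
  · intro l hl
    rcases Finset.mem_insert.1 hl with rfl | hl
    · exact he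
    · exact hs2 l hl
  · rw [Finset.card_insert_of_notMem, hs3]
    intro hb
    simpa using hs1 hb

/-- The state while the level `k + 1` is computed. -/
structure LevelInv (R : ℕ → ℕ → ℕ) (n k i l : ℕ) (S : AState) : Prop where
  run_le : ∀ k' ≤ k, ∀ i' l', S.arr .run k' i' l' = block R k' i' l'
  run_succ : ∀ i' l', S.arr .run (k + 1) i' l' =
    if i' < i ∨ (i' = i ∧ l' < l) then block R (k + 1) i' l' else 0
  run_gt : ∀ k', k + 1 < k' → ∀ i' l', S.arr .run k' i' l' = 0
  list_lt : ∀ k' < k, ∀ i', ListUpTo R k' i' (n + 1) (S.arr .cnt 0 k' i') (S.arr .lst k' i')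
  list_eq : ∀ i', ListUpTo R k i' (if i' / 2 < i then n + 1 else if i' / 2 = i then l else 0)
    (S.arr .cnt 0 k i') (S.arr .lst k i')
  cnt_gt : ∀ k', k < k' → ∀ i', S.arr .cnt 0 k' i' = 0

theorem LevelInv.congr {n k i l : ℕ} {S S' : AState} (h : LevelInv R n k i l S)
    (h1 : S'.arr .run = S.arr .run) (h2 : S'.arr .cnt = S.arr .cnt)
    (h3 : S'.arr .lst = S.arr .lst) : LevelInv R n k i l S' := by
  constructor
  · rw [h1]; exact h.run_le
  · rw [h1]; exact h.run_succ
  · rw [h1]; exact h.run_gt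
  · rw [h2, h3]; exact h.list_lt
  · rw [h2, h3]; exact h.list_eq
  · rw [h2]; exact h.cnt_gt

/-- The table of runs vanishes outside `1, …, n`. -/
def RunsVanish (n : ℕ) (R : ℕ → ℕ → ℕ) : Prop := ∀ a l, R a l ≠ 0 → a ≤ n ∧ l ≤ n ∧ R a l ≤ n + 1

theorem RunsVanish.block_eq_zero {n : ℕ} (hR : RunsVanish n R) {k i l : ℕ} (h : n < i ∨ n < l) :
    block R k i l = 0 := by
  by_contra h'
  have h1 := block_eq h' (a := 2 ^ k * i) (Nat.mul_div_cancel_left _ (by positivity))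
  rw [← h1] at h'
  have h2 := hR _ _ h'
  have h3 : i ≤ 2 ^ k * i := Nat.le_mul_of_pos_left _ (by positivity)
  omega

theorem RunsVanish.not_isEntry {n : ℕ} (hR : RunsVanish n R) {k i l : ℕ} (h : n < i ∨ n < l) :
    ¬ IsEntry R k i l := fun h' => h'.1 (hR.block_eq_zero h)

theorem LevelInv.next_row {n k i : ℕ} (hR : RunsVanish n R) (h : LevelInv R n k i (n + 1) S) :
    LevelInv R n k (i + 1) 0 S := by
  refine ⟨h.run_le, fun i' l' => ?_, h.run_gt, h.list_lt, fun i' => ?_, h.cnt_gt⟩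
  · rw [h.run_succ]
    by_cases hl : n < l'
    · simp [hR.block_eq_zero (Or.inr hl)]
    · refine if_congr ?_ rfl rfl; omega
  · have := h.list_eq i'
    have e : (if i' / 2 < i then n + 1 else if i' / 2 = i then n + 1 else 0) =
      (if i' / 2 < i + 1 then n + 1 else if i' / 2 = i + 1 then 0 else 0) := by
      split_ifs <;> omega
    rwa [e] at this

theorem LevelInv.next_level {n k : ℕ} (hR : RunsVanish n R) (h : LevelInv R n k (n + 3) 0 S) :
    LevelInv R n (k + 1) 0 0 S := by
  refine ⟨fun k' hk' i' l' => ?_, fun i' l' => ?_, fun k' hk' => h.run_gt k' (by omega),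
    fun k' hk' i' => ?_, fun i' => ?_, fun k' hk' => h.cnt_gt k' (by omega)⟩
  · by_cases hk : k' = k + 1
    · subst hk
      rw [h.run_succ]
      split_ifs
      · rfl
      · rw [hR.block_eq_zero (by omega)]
    · exact h.run_le k' (by omega) i' l'
  · rw [h.run_gt _ (by omega)]; simp
  · by_cases hk : k' = k
    · subst hk
      have := h.list_eq i'
      split_ifs at this
      · exact this
      · exact this.skip (by omega) fun l _ _ => hR.not_isEntry (by omega)
      · exact this.skip (by omega) fun l _ _ => hR.not_isEntry (by omega)
    · exact h.list_lt k' (by omega) i'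
  · rw [h.cnt_gt _ (by omega)]
    simpa using ListUpTo.zero R (k + 1) i' _

/-- The two halves of a block decide everything: if they agree, the common value moves up and
neither half has an entry; if they differ, the upper value is `0` and every nonzero half has an
entry. -/
theorem levelCell_runs (hV : V.Good) {k i l : ℕ} (hk : k < V.L)
    (hi : i < V.n + 3) (hl : l < V.n + 1) (rk : S.regs .k = k) (ri : S.regs .i = i)
    (rl : S.regs .l = l) (h : LevelInv R V.n k i l S) :
    Runs V levelCellCmd S fun S' t => LevelInv R V.n k i (l + 1) S' ∧ t ≤ 9 := by
  have hE := hV.E_ge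
  have hW := hV.W_ge
  have hL := hV.L_le
  have hx := h.run_le k le_rfl (2 * i) l
  have hy := h.run_le k le_rfl (2 * i + 1) l
  have hb : block R (k + 1) i l = if block R k (2 * i) l = block R k (2 * i + 1) l
    then block R k (2 * i) l else 0 := rfl
  set x := block R k (2 * i) l with hxx
  set y := block R k (2 * i + 1) l with hyy
  have d1 : 2 * i / 2 = i := by omega
  have d2 : (2 * i + 1) / 2 = i := by omega
  have hent : ∀ e i', i' / 2 = i → block R k i' l = e → (IsEntry R k i' l ↔ e ≠ 0 ∧ x ≠ y) := by
    intro e i' hi' he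
    have : i' = 2 * i ∨ i' = 2 * i + 1 := by omega
    unfold IsEntry
    rw [hi', he, hb]
    grind
  have hent1 := hent x (2 * i) d1 rfl
  have hent2 := hent y (2 * i + 1) d2 rfl
  have hl1 := h.list_eq (2 * i)
  have hl2 := h.list_eq (2 * i + 1)
  rw [d1, if_neg (by omega), if_pos rfl] at hl1
  rw [d2, if_neg (by omega), if_pos rfl] at hl2
  have hc1 := hl1.cnt_le
  have hc2 := hl2.cnt_le
  have hrun : x ≠ y → ∀ i' l', S.arr .run (k + 1) i' l' =
      if i' < i ∨ (i' = i ∧ l' < l + 1) then block R (k + 1) i' l' else 0 := by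
    intro hxy i' l'
    rw [h.run_succ]
    by_cases hil : i' = i ∧ l' = l
    · obtain ⟨rfl, rfl⟩ := hil
      rw [hb, if_neg hxy]; simp
    · refine if_congr ?_ rfl rfl; omega
  have hother : ∀ (f : ℕ → ℕ → ℕ) (g : ℕ → ℕ), (∀ i', i' ≠ 2 * i → i' ≠ 2 * i + 1 →
      f i' = S.arr .lst k i') → (∀ i', i' ≠ 2 * i → i' ≠ 2 * i + 1 →
      g i' = S.arr .cnt 0 k i') → ListUpTo R k (2 * i) (l + 1) (g (2 * i)) (f (2 * i)) →
      ListUpTo R k (2 * i + 1) (l + 1) (g (2 * i + 1)) (f (2 * i + 1)) →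
      ∀ i', ListUpTo R k i' (if i' / 2 < i then V.n + 1 else if i' / 2 = i then l + 1 else 0)
        (g i') (f i') := by
    intro f g hf hg e1 e2 i'
    by_cases h1 : i' = 2 * i
    · subst h1; rw [d1, if_neg (by omega), if_pos rfl]; exact e1
    · by_cases h2 : i' = 2 * i + 1
      · subst h2; rw [d2, if_neg (by omega), if_pos rfl]; exact e2
      · have := h.list_eq i'
        rw [hf i' h1 h2, hg i' h1 h2]
        have h3 : ¬ i' / 2 = i := by omega
        simpa [h3] using this
  have skip1 : ¬ (x ≠ 0 ∧ x ≠ y) → ListUpTo R k (2 * i) (l + 1) (S.arr .cnt 0 k (2 * i))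
      (S.arr .lst k (2 * i)) := fun h0 => hl1.skip (by omega) fun l' h1 h2 h3 => h0 (by
        obtain rfl : l' = l := by omega
        exact hent1.1 h3)
  have skip2 : ¬ (y ≠ 0 ∧ x ≠ y) → ListUpTo R k (2 * i + 1) (l + 1) (S.arr .cnt 0 k (2 * i + 1))
      (S.arr .lst k (2 * i + 1)) := fun h0 => hl2.skip (by omega) fun l' h1 h2 h3 => h0 (by
        obtain rfl : l' = l := by omega
        exact hent2.1 h3)
  simp [levelCellCmd, pushCmd, rk, ri, rl, hx, hy]
  refine ⟨by omega, by omega, fun hxy => ⟨by omega, ⟨?_, ?_, ?_, ?_, ?_, ?_⟩⟩,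
    fun hxy => ⟨fun hx0 => ⟨by omega, by omega, fun hy0 => ⟨by omega, by omega, ?_⟩,
      fun hy0 => ?_⟩, fun hx0 => ⟨fun hy0 => ⟨by omega, by omega, ?_⟩, fun hy0 => ?_⟩⟩⟩
  · intro k' hk' i' l'
    simp; rw [if_neg (by omega)]; exact h.run_le k' hk' i' l'
  · intro i' l'
    simp; rw [h.run_succ]
    by_cases hil : i' = i ∧ l' = l
    · obtain ⟨rfl, rfl⟩ := hil
      simp [hb, hxy]
    · rw [if_neg hil]; refine if_congr ?_ rfl rfl; omega
  · intro k' hk' i' l'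
    simp; rw [if_neg (by omega)]; exact h.run_gt k' hk' i' l'
  · exact h.list_lt
  · exact hother _ _ (fun _ _ _ => rfl) (fun _ _ _ => rfl) (skip1 (by tauto)) (skip2 (by tauto))
  · exact h.cnt_gt
  -- The two halves differ: the upper cell keeps its initial `0`, and a list grows exactly when its
  -- half is nonzero.
  all_goals
    constructor
    · exact h.run_le
    · intro i' l'; simpa using hrun hxy i' l'
    · intro k' hk' i' l'; simpa using h.run_gt k' hk' i' l'
    · intro k' hk' i'
      have := h.list_lt k' hk' i'
      have e0 : k' ≠ k := by omega
      simpa [setArr_arr, e0, AState.setArr] using this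
    · apply hother
      · intro i' h1 h2; funext j; simp [h1, h2]
      · intro i' h1 h2; simp [h1, h2]
      · first
          | exact hl1.push (hent1.2 ⟨hx0, hxy⟩) (by simp) (by simp) (fun j hj => by simp; omega)
          | simpa [AState.setArr] using skip1 (by tauto)
      · first
          | exact hl2.push (hent2.2 ⟨hy0, hxy⟩) (by simp) (by simp) (fun j hj => by simp; omega)
          | simpa [AState.setArr] using skip2 (by tauto)
    · intro k' hk' i'
      have e0 : k' ≠ k := by omega
      simpa [e0] using h.cnt_gt k' hk' i'

theorem levels_runs (hV : V.Good) (hR : RunsVanish V.n R)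
    (h0 : ∀ k i l, S.arr .run k i l = if k = 0 then R i l else 0)
    (hcnt : ∀ k i, S.arr .cnt 0 k i = 0) :
    Runs V levelsCmd S fun S' t =>
      (∀ k ≤ V.L, ∀ i l, S'.arr .run k i l = block R k i l) ∧
      (∀ k < V.L, ∀ i, ListUpTo R k i (V.n + 1) (S'.arr .cnt 0 k i) (S'.arr .lst k i)) ∧
      t ≤ ((11 * (V.n + 1) + 4) * (V.n + 3) + 4) * V.L + 2 := by
  have hE := hV.E_ge
  have hW := hV.W_ge
  have hL := hV.L_le
  refine runs_loop (N := V.L) (fun k S' T => LevelInv R V.n k 0 0 S' ∧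
    T ≤ ((11 * (V.n + 1) + 4) * (V.n + 3) + 4) * k + 1) (by omega) ?_ ?_ ?_ ?_
  · refine ⟨⟨?_, ?_, ?_, ?_, ?_, ?_⟩, by omega⟩
    · intro k' hk' i' l'
      obtain rfl : k' = 0 := by omega
      simp [h0, block]
    · simp [h0]
    · intro k' hk' i' l'
      simp [h0]; omega
    · intro k' hk'; omega
    · intro i'
      simpa [hcnt] using ListUpTo.zero R 0 i' (S.arr .lst 0 i')
    · simp [hcnt]
  · simp
  · rintro k S1 T1 hk ⟨h1, hT1⟩ rk hF1
    have hmid : Runs V (.loop .i (.n + 3) (.loop .l (.n + 1) levelCellCmd)) S1 fun S' t =>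
        (S'.regs .k = k ∧ LevelInv R V.n k (V.n + 3) 0 S') ∧
          t ≤ (11 * (V.n + 1) + 4) * (V.n + 3) + 2 := by
      refine runs_loop (N := V.n + 3) (fun i S' T => LevelInv R V.n k i 0 S' ∧
        T ≤ (11 * (V.n + 1) + 4) * i + 1) (by omega) ?_ ?_ ?_ ?_
      · exact ⟨h1.congr rfl rfl rfl, by omega⟩
      · simp; omega
      · rintro i S2 T2 hi ⟨h2, hT2⟩ ri hF2
        have rk2 : S2.regs .k = k := by rw [hF2.1 .k (by decide), rk]
        have hin : Runs V (.loop .l (.n + 1) levelCellCmd) S2 fun S' t =>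
            (S'.regs .i = i ∧ LevelInv R V.n k i (V.n + 1) S') ∧
              t ≤ 11 * (V.n + 1) + 2 := by
          refine runs_loop (N := V.n + 1) (fun l S' T => LevelInv R V.n k i l S' ∧
            T ≤ 11 * l + 1) (by omega) ?_ ?_ ?_ ?_
          · exact ⟨h2.congr rfl rfl rfl, by omega⟩
          · simp; omega
          · rintro l S3 T3 hl ⟨h3, hT3⟩ rl hF3
            have rk3 : S3.regs .k = k := by rw [hF3.1 .k (by decide), rk2]
            have ri3 : S3.regs .i = i := by rw [hF3.1 .i (by decide), ri]
            refine ((levelCell_runs hV hk hi hl rk3 ri3 rl h3).frame).mono ?_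
            rintro S4 t4 ⟨⟨h4, ht4⟩, hF4⟩
            refine ⟨by rw [hF4.1 .l (by decide), rl], h4.congr rfl rfl rfl, by omega⟩
          · rintro S3 T3 ⟨h3, hT3⟩ rl hF3
            exact ⟨⟨by rw [hF3.1 .i (by decide), ri], h3⟩, by omega⟩
        refine hin.mono ?_
        rintro S3 t3 ⟨⟨ri3, h3⟩, ht3⟩
        exact ⟨ri3, (h3.next_row hR).congr rfl rfl rfl, by rw [mul_add_one]; omega⟩
      · rintro S2 T2 ⟨h2, hT2⟩ ri hF2
        exact ⟨⟨by rw [hF2.1 .k (by decide), rk], h2⟩, by omega⟩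
    refine hmid.mono ?_
    rintro S3 t3 ⟨⟨ri3, h3⟩, ht3⟩
    exact ⟨ri3, (h3.next_level hR).congr rfl rfl rfl, by
      rw [mul_add_one (_ * _ + 4)]; omega⟩
  · rintro S' T ⟨h1, h2⟩ hr hF
    exact ⟨h1.run_le, h1.list_lt, by omega⟩

end Phases

end WordRAM

namespace WordRAM

open MergeWidth

/-! ## Breadth-first search -/

/-- Replace the position `p` by the first unvisited position that is at least `p`. -/
def findCmd : Cmd :=
  .set .f 0 ;;
  .whl (.op .eq (.ld2 .full (.r .f) (.r .p)) (.r .s))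
    (.set .p ((.r .p + 1) / 2) ;; .set .f (.r .f + 1)) ;;
  .whl (.r .f)
    (.set .f (.r .f - 1) ;; .set .p (2 * .r .p) ;;
     .ite (.op .eq (.ld2 .full (.r .f) (.r .p)) (.r .s)) (.set .p (.r .p + 1)) .skip)

/-- Mark the position `p` as visited. -/
def markCmd : Cmd :=
  .set .i (.r .p) ;;
  .st2 .full 0 (.r .p) (.r .s) ;;
  .loop .f .L
    (.set .i (.r .i / 2) ;;
     .ite (.op .eq (.ld2 .full (.r .f) (2 * .r .i)) (.r .s))
      (.ite (.op .eq (.ld2 .full (.r .f) (2 * .r .i + 1)) (.r .s))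
        (.st2 .full (.r .f + 1) (.r .i) (.r .s)) .skip) .skip)

def visitCmd : Cmd :=
  .st2 .dist (.r .s) (.r .p) (.r .e) ;;
  .st2 .par (.r .s) (.r .p) (.r .u) ;;
  .st1 .q (.r .tl) (.r .p) ;;
  .set .tl (.r .tl + 1) ;;
  markCmd

/-- Visit all unvisited positions in `[l, rr)`. -/
def fillCmd : Cmd :=
  .set .p (.r .l) ;;
  findCmd ;;
  .whl (.op .lt (.r .p) (.r .rr)) (visitCmd ;; .set .p (.r .p + 1) ;; findCmd)

/-- Visit the entries of the block `j` of level `k`. -/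
def nodeCmd : Cmd :=
  .ite (.op .eq (.ld2 .done (.r .k) (.r .j)) (.r .s)) .skip
    (.st2 .done (.r .k) (.r .j) (.r .s) ;;
     .loop .c (.ld2 .cnt (.r .k) (.r .j))
      (.set .l (.ld .lst (.r .k) (.r .j) (.r .c)) ;;
       .set .rr (.ld .run (.r .k) (.r .j) (.r .l)) ;;
       .ite (.op .eq (.ld2 .idone (.r .l) (.r .rr)) (.r .s)) .skip
        (.st2 .idone (.r .l) (.r .rr) (.r .s) ;; fillCmd)))

/-- Process the position at the head of the queue. -/
def popCmd : Cmd :=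
  .set .u (.ld1 .q (.r .h)) ;;
  .set .e (.ld2 .dist (.r .s) (.r .u) + 1) ;;
  .set .j (.r .u) ;;
  .loop .k .L (nodeCmd ;; .set .j (.r .j / 2)) ;;
  .set .h (.r .h + 1)

def clearCmd : Cmd := .loop .x .n (.st2 .dist (.r .s) (.r .x + 1) .n)

/-- Breadth-first search from the position `s`. -/
def searchCmd : Cmd :=
  clearCmd ;;
  .set .p (.r .s) ;; .set .e 0 ;; .set .u 0 ;; .set .tl 0 ;;
  visitCmd ;;
  .set .h 0 ;;
  .whl (.op .lt (.r .h) (.r .tl)) popCmd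

def bfsCmd : Cmd := .loop .t .n (.set .s (.r .t + 1) ;; searchCmd)

/-! ### The tree of visited positions -/

/-- A block is marked if and only if all its positions are visited. -/
def FullRel (L s : ℕ) (vis : Finset ℕ) (S : AState) : Prop :=
  ∀ k ≤ L, ∀ j, S.arr .full 0 k j = s ↔ ∀ p, p / 2 ^ k = j → p ∈ vis

theorem div_two_pow_succ (a k : ℕ) : a / 2 ^ (k + 1) = a / 2 ^ k / 2 := by
  rw [Nat.div_div_eq_div_mul, ← pow_succ]

theorem div_two_pow_eq_iff {q k j : ℕ} : q / 2 ^ k = j ↔ j * 2 ^ k ≤ q ∧ q < (j + 1) * 2 ^ k := by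
  rw [Nat.div_eq_iff (by positivity)]
  have : 0 < 2 ^ k := by positivity
  rw [add_mul, one_mul]
  omega

section BFS

variable {V : Env} {S : AState} {vis : Finset ℕ} {s : ℕ}

/-- The block `p` of level `f` starts at `p * 2 ^ f`, and all positions from `l` up to this start
are visited. The position `n + 1` is a sentinel that is never visited; the root block contains it,
so the climb stops at level `L` or earlier and never passes `n + 1`. -/
theorem find_up_runs (hV : V.Good) (hF : FullRel V.L s vis S) (hvis : V.n + 1 ∉ vis)
    (hs : S.regs .s = s) {l : ℕ} (hl : l ≤ V.n + 1) (hp : S.regs .p = l) (hf : S.regs .f = 0) :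
    Runs V (.whl (.op .eq (.ld2 .full (.r .f) (.r .p)) (.r .s))
      (.set .p ((.r .p + 1) / 2) ;; .set .f (.r .f + 1))) S fun S' t =>
      (S'.regs .f ≤ V.L ∧ l ≤ S'.regs .p * 2 ^ S'.regs .f ∧
        S'.regs .p * 2 ^ S'.regs .f ≤ V.n + 1 ∧
        (∀ q, l ≤ q → q < S'.regs .p * 2 ^ S'.regs .f → q ∈ vis) ∧
        S.arr .full 0 (S'.regs .f) (S'.regs .p) ≠ s) ∧ t ≤ 3 * V.L + 1 := by
  have hE := hV.E_ge
  have hW := hV.W_ge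
  have hL := hV.L_le
  refine runs_whl (fun S' c => (S'.regs .f ≤ V.L ∧ l ≤ S'.regs .p * 2 ^ S'.regs .f ∧
        S'.regs .p * 2 ^ S'.regs .f ≤ V.n + 1 ∧
        (∀ q, l ≤ q → q < S'.regs .p * 2 ^ S'.regs .f → q ∈ vis)) ∧ c = 3 * S'.regs .f)
        (3 * V.L) ?_ ?_ ?_ ?_ ?_
  · simp [hf, hp, hl]; intros; omega
  · rintro S' c ⟨⟨h1, h2, h3, h4⟩, h5⟩ hFr
    have : S'.regs .p ≤ S'.regs .p * 2 ^ S'.regs .f := Nat.le_mul_of_pos_right _ (by positivity)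
    simp; omega
  · rintro S' c ⟨⟨h1, h2, h3, h4⟩, h5⟩
    omega
  · rintro S' c ⟨⟨h1, h2, h3, h4⟩, h5⟩ hFr hne
    have gs : S'.regs .s = s := by rw [hFr.1 .s (by decide), hs]
    have gf : S'.arr .full = S.arr .full := hFr.2 .full (by decide)
    simp [gs, gf] at hne
    have hpp : S'.regs .p ≤ S'.regs .p * 2 ^ S'.regs .f :=
      Nat.le_mul_of_pos_right _ (by positivity)
    set p := S'.regs .p
    set f := S'.regs .f
    have hblock := (hF f h1 p).1 hne
    have hfL : f < V.L := by
      by_contra hcon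
      have hfe : f = V.L := by omega
      have hp2 : p * 2 ^ f < 2 ^ f := by rw [hfe] at h3 ⊢; have := hV.pow; omega
      have hp0 : p = 0 := by
        by_contra h0
        have : 2 ^ f ≤ p * 2 ^ f := Nat.le_mul_of_pos_left _ (by omega)
        omega
      refine hvis (hblock _ ?_)
      rw [hp0, hfe]
      exact Nat.div_eq_of_lt hV.pow
    have hnb : (p + 1) * 2 ^ f ≤ V.n + 1 := by
      by_contra hcon
      exact hvis (hblock _ (div_two_pow_eq_iff.2 ⟨h3, by omega⟩))
    have hin : ∀ q, l ≤ q → q < (p + 1) * 2 ^ f → q ∈ vis := by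
      intro q hq hq'
      by_cases hqp : q < p * 2 ^ f
      · exact h4 q hq hqp
      · exact hblock q (div_two_pow_eq_iff.2 ⟨by omega, hq'⟩)
    -- For even `p` the new block is the parent of `p`, with the same start; for odd `p` it is the
    -- parent of `p + 1`, which starts where the full block `p` ends.
    have hnew : (p + 1) / 2 * 2 ^ (f + 1) = p * 2 ^ f ∨
        (p + 1) / 2 * 2 ^ (f + 1) = (p + 1) * 2 ^ f := by
      rcases Nat.even_or_odd' p with ⟨r, hr | hr⟩
      · left; rw [show (p + 1) / 2 = r by omega, hr]; ring
      · right; rw [show (p + 1) / 2 = r + 1 by omega, hr]; ring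
    have hle : p * 2 ^ f ≤ (p + 1) * 2 ^ f := Nat.mul_le_mul_right _ (by omega)
    simp
    refine ⟨by omega, by omega, ⟨by omega, ?_, ?_, ?_⟩, by omega⟩
    · rcases hnew with h | h <;> rw [h] <;> omega
    · rcases hnew with h | h <;> rw [h] <;> omega
    · intro q hq hq'
      refine hin q hq ?_
      rcases hnew with h | h <;> rw [h] at hq' <;> omega
  · rintro S' c ⟨⟨h1, h2, h3, h4⟩, h5⟩ hFr hz
    have gs : S'.regs .s = s := by rw [hFr.1 .s (by decide), hs]
    have gf : S'.arr .full = S.arr .full := hFr.2 .full (by decide)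
    simp [gs, gf] at hz
    exact ⟨⟨h1, h2, h3, h4, hz⟩, by omega⟩

/-- The descent stays in a block that is not full and moves to its left half unless that half is
full. The leaf reached is unvisited, and everything skipped is visited. -/
theorem find_down_runs (hV : V.Good) (hF : FullRel V.L s vis S) (hvis : V.n + 1 ∉ vis)
    (hs : S.regs .s = s) {l : ℕ} (hf : S.regs .f ≤ V.L) (hl : l ≤ S.regs .p * 2 ^ S.regs .f)
    (hp : S.regs .p * 2 ^ S.regs .f ≤ V.n + 1)
    (hin : ∀ q, l ≤ q → q < S.regs .p * 2 ^ S.regs .f → q ∈ vis)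
    (hne : S.arr .full 0 (S.regs .f) (S.regs .p) ≠ s) :
    Runs V (.whl (.r .f)
    (.set .f (.r .f - 1) ;; .set .p (2 * .r .p) ;;
     .ite (.op .eq (.ld2 .full (.r .f) (.r .p)) (.r .s)) (.set .p (.r .p + 1)) .skip)) S
      fun S' t => (l ≤ S'.regs .p ∧ S'.regs .p ≤ V.n + 1 ∧ S'.regs .p ∉ vis ∧
        ∀ q, l ≤ q → q < S'.regs .p → q ∈ vis) ∧ t ≤ 5 * V.L + 1 := by
  have hE := hV.E_ge
  have hW := hV.W_ge
  have hL := hV.L_le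
  refine runs_whl (fun S' c => (S'.regs .f ≤ V.L ∧ l ≤ S'.regs .p * 2 ^ S'.regs .f ∧
        S'.regs .p * 2 ^ S'.regs .f ≤ V.n + 1 ∧
        (∀ q, l ≤ q → q < S'.regs .p * 2 ^ S'.regs .f → q ∈ vis) ∧
        S.arr .full 0 (S'.regs .f) (S'.regs .p) ≠ s) ∧ c + 5 * S'.regs .f ≤ 5 * V.L)
        (5 * V.L) ?_ ?_ ?_ ?_ ?_
  · exact ⟨⟨hf, hl, hp, hin, hne⟩, by omega⟩
  · simp
  · rintro S' c ⟨_, h5⟩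
    omega
  · rintro S' c ⟨⟨h1, h2, h3, h4, h5⟩, h6⟩ hFr hf0
    have gs : S'.regs .s = s := by rw [hFr.1 .s (by decide), hs]
    have gf : S'.arr .full = S.arr .full := hFr.2 .full (by decide)
    simp at hf0
    obtain ⟨f, hff⟩ : ∃ f, S'.regs .f = f + 1 := ⟨S'.regs .f - 1, by omega⟩
    obtain ⟨p, hpr⟩ : ∃ p, S'.regs .p = p := ⟨_, rfl⟩
    rw [hff] at h1 h2 h3 h4 h5 h6
    rw [hpr] at h2 h3 h4 h5
    have hpow : p * 2 ^ (f + 1) = 2 * p * 2 ^ f := by ring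
    have hpp : 2 * p ≤ 2 * p * 2 ^ f := Nat.le_mul_of_pos_right _ (by positivity)
    rw [hpow] at h2 h3 h4
    have hsplit : S.arr .full 0 f (2 * p) = s → S.arr .full 0 f (2 * p + 1) ≠ s := by
      intro e1 e2
      refine h5 ((hF _ h1 p).2 fun q hq => ?_)
      rw [div_two_pow_succ] at hq
      rcases Nat.mod_two_eq_zero_or_one (q / 2 ^ f) with h | h
      · exact (hF f (by omega) _).1 e1 q (by omega)
      · exact (hF f (by omega) _).1 e2 q (by omega)
    simp [hff, gf, gs, hpr]
    refine ⟨by omega, by omega, by omega, fun hfull => ⟨by omega, ⟨by omega, ?_, ?_, ?_, hsplit hfull⟩,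
      by omega⟩, fun hfull => ⟨⟨by omega, h2, h3, h4, hfull⟩, by omega⟩⟩
    · rw [add_mul]; omega
    · by_contra hcon
      exact hvis ((hF f (by omega) _).1 hfull _ (div_two_pow_eq_iff.2 ⟨h3, by omega⟩))
    · intro q hq hq'
      by_cases hqp : q < 2 * p * 2 ^ f
      · exact h4 q hq hqp
      · exact (hF f (by omega) _).1 hfull q (div_two_pow_eq_iff.2 ⟨by omega, hq'⟩)
  · rintro S' c ⟨⟨h1, h2, h3, h4, h5⟩, h6⟩ hFr hz
    simp at hz
    rw [hz] at h2 h3 h4 h5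
    simp only [pow_zero, mul_one] at h2 h3 h4
    refine ⟨⟨h2, h3, fun hv => h5 ((hF 0 (by omega) _).2 fun q hq => ?_), h4⟩, by omega⟩
    simp only [pow_zero, Nat.div_one] at hq
    rwa [hq]

theorem find_runs (hV : V.Good) (hF : FullRel V.L s vis S) (hvis : V.n + 1 ∉ vis)
    (hs : S.regs .s = s) {l : ℕ} (hl : l ≤ V.n + 1) (hp : S.regs .p = l) :
    Runs V findCmd S fun S' t => (l ≤ S'.regs .p ∧ S'.regs .p ≤ V.n + 1 ∧ S'.regs .p ∉ vis ∧
        ∀ q, l ≤ q → q < S'.regs .p → q ∈ vis) ∧ t ≤ 8 * V.L + 3 := by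
  have hE := hV.E_ge
  have hW := hV.W_ge
  unfold findCmd
  rw [runs_seq, runs_set]
  refine ⟨by simp; omega, ?_⟩
  rw [runs_seq]
  refine ((find_up_runs hV (S := S.setReg .f _) hF hvis (by simpa using hs) hl (by simpa using hp)
    (by simp)).frame).mono ?_
  rintro S1 t1 ⟨⟨⟨h1, h2, h3, h4, h5⟩, ht1⟩, hF1⟩
  have gf : S1.arr .full = S.arr .full := hF1.2 .full (by decide)
  refine (find_down_runs hV (S := S1) (vis := vis) (s := s) (by rw [FullRel, gf]; exact hF) hvis
    (by rw [hF1.1 .s (by decide)]; simpa using hs) h1 h2 h3 h4 (by rw [gf]; exact h5)).mono ?_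
  rintro S2 t2 ⟨h, ht2⟩
  exact ⟨h, by omega⟩

/-- Levels up to `f` already take `p` into account, the higher ones still describe the old set. At
level `f + 1` only the ancestor of `p` can change, and it is full if and only if both of its halves
are. -/
theorem mark_runs (hV : V.Good) (hF : FullRel V.L s vis S) (hs : S.regs .s = s)
    (hp : S.regs .p ≤ V.n) :
    Runs V markCmd S fun S' t => FullRel V.L s (insert (S.regs .p) vis) S' ∧ t ≤ 6 * V.L + 4 := by
  have hE := hV.E_ge
  have hW := hV.W_ge
  have hL := hV.L_le
  unfold markCmd
  simp only [runs_seq, runs_set, runs_st]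
  refine ⟨by simp, by simp; omega, ?_⟩
  set p := S.regs .p with hpp
  refine runs_loop (N := V.L) (fun f S' T => S'.regs .i = p / 2 ^ f ∧
    (∀ k ≤ V.L, ∀ j, S'.arr .full 0 k j = s ↔
      ∀ q, q / 2 ^ k = j → (k ≤ f ∧ q = p) ∨ q ∈ vis) ∧ T ≤ 6 * f + 1) (by omega) ?_ ?_ ?_ ?_
  · refine ⟨by simp [hpp], fun k hk j => ?_, by omega⟩
    simp [hs, ← hpp]
    by_cases hk0 : k = 0
    · subst hk0
      by_cases hj : j = p
      · subst hj; simp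
      · simp [hj, hF 0 (by omega) j]
    · simp [hk0, hF k hk j]
  · simp
  · rintro f S' T hf ⟨h1, h2, h3⟩ hr hFr
    have gs : S'.regs .s = s := by rw [hFr.1 .s (by decide)]; simpa using hs
    have hi : p / 2 ^ f / 2 = p / 2 ^ (f + 1) := (div_two_pow_succ p f).symm
    have hle : p / 2 ^ (f + 1) ≤ p := Nat.div_le_self _ _
    simp [hr, gs, h1, hi]
    set i := p / 2 ^ (f + 1) with hii
    have aux : ∀ k ≤ V.L, ∀ j, (k ≠ f + 1 ∨ j ≠ i) →
        (S'.arr .full 0 k j = s ↔ ∀ q, q / 2 ^ k = j → (k ≤ f + 1 ∧ q = p) ∨ q ∈ vis) := by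
      intro k hk j hkj
      rw [h2 k hk]
      refine forall₂_congr fun q hq => ?_
      by_cases hqp : q = p
      · subst hqp
        by_cases hk1 : k = f + 1
        · subst hk1; exact absurd hq.symm (by tauto)
        · simp only [show k ≤ f + 1 ↔ k ≤ f by omega]
      · simp [hqp]
    have aux2 : (∀ q, q / 2 ^ (f + 1) = i → (f + 1 ≤ f + 1 ∧ q = p) ∨ q ∈ vis) ↔
        S'.arr .full 0 f (2 * i) = s ∧ S'.arr .full 0 f (2 * i + 1) = s := by
      rw [h2 f (by omega), h2 f (by omega)]
      constructor
      · intro h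
        refine ⟨fun q hq => ?_, fun q hq => ?_⟩
        · have := h q (by rw [div_two_pow_succ]; omega)
          tauto
        · have := h q (by rw [div_two_pow_succ]; omega)
          tauto
      · rintro ⟨e1, e2⟩ q hq
        rw [div_two_pow_succ] at hq
        rcases Nat.mod_two_eq_zero_or_one (q / 2 ^ f) with h | h
        · have := e1 q (by omega)
          tauto
        · have := e2 q (by omega)
          tauto
    have aux3 : S'.arr .full 0 (f + 1) i = s →
        (S'.arr .full 0 f (2 * i) = s ∧ S'.arr .full 0 f (2 * i + 1) = s) := by
      intro h
      rw [← aux2]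
      intro q hq
      have := (h2 (f + 1) (by omega) i).1 h q hq
      tauto
    have keep : ¬ (S'.arr .full 0 f (2 * i) = s ∧ S'.arr .full 0 f (2 * i + 1) = s) →
        ∀ k ≤ V.L, ∀ j, (S'.arr .full 0 k j = s ↔
          ∀ q, q / 2 ^ k = j → (k ≤ f + 1 ∧ q = p) ∨ q ∈ vis) := by
      intro hno k hk j
      by_cases hkj : k = f + 1 ∧ j = i
      · obtain ⟨rfl, rfl⟩ := hkj
        rw [aux2]
        exact ⟨aux3, fun h => absurd h hno⟩
      · exact aux k hk j (by tauto)
    refine ⟨by omega, by omega, fun e1 => ⟨by omega, fun e2 => ⟨by omega, fun k hk j => ?_, by omega⟩,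
      fun e2 => ⟨keep (by tauto), by omega⟩⟩, fun e1 => ⟨keep (by tauto), by omega⟩⟩
    by_cases hkj : k = f + 1 ∧ j = i
    · obtain ⟨rfl, rfl⟩ := hkj
      exact iff_of_true (fun h => absurd rfl (h rfl)) (aux2.2 ⟨e1, e2⟩)
    · rw [← aux k hk j (by tauto)]
      exact ⟨fun h => h fun h1 h2 => hkj ⟨h1, h2⟩, fun h _ => h⟩
  · rintro S' T ⟨h1, h2, h3⟩ hr hFr
    refine ⟨fun k hk j => ?_, by omega⟩
    rw [h2 k hk]
    simp [hk]

/-- The state of the search from the source `s` with visited positions `vis`. -/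
structure Search (n L s : ℕ) (M : ℕ → ℕ → ℕ) (vis : Finset ℕ) (S : AState) : Prop where
  reg_s : S.regs .s = s
  range : ∀ p ∈ vis, 1 ≤ p ∧ p ≤ n
  tail : S.regs .tl = vis.card
  q_mem : ∀ i < vis.card, S.arr .q 0 0 i ∈ vis
  q_surj : ∀ p ∈ vis, ∃ i < vis.card, S.arr .q 0 0 i = p
  mono : ∀ i j, i ≤ j → j < vis.card →
    S.arr .dist 0 s (S.arr .q 0 0 i) ≤ S.arr .dist 0 s (S.arr .q 0 0 j)
  dist_le : ∀ p ∈ vis, S.arr .dist 0 s p < vis.card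
  unvis : ∀ p, 1 ≤ p → p ≤ n → p ∉ vis → S.arr .dist 0 s p = n ∧ S.arr .par 0 s p = 0
  parent : ∀ p ∈ vis, (p = s ∧ S.arr .dist 0 s p = 0 ∧ S.arr .par 0 s p = 0) ∨
    (p ≠ s ∧ S.arr .par 0 s p ∈ vis ∧ M (S.arr .par 0 s p) p ≠ 0 ∧
      S.arr .dist 0 s p = S.arr .dist 0 s (S.arr .par 0 s p) + 1)
  full : FullRel L s vis S
  src : s ∈ vis

variable {M : ℕ → ℕ → ℕ} {n L : ℕ}

theorem Search.congr {S' : AState} (h : Search n L s M vis S) (h1 : S'.regs .s = S.regs .s)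
    (h2 : S'.regs .tl = S.regs .tl) (h3 : S'.arr .q = S.arr .q) (h4 : S'.arr .dist = S.arr .dist)
    (h5 : S'.arr .par = S.arr .par) (h6 : S'.arr .full = S.arr .full) :
    Search n L s M vis S' := by
  constructor
  · rw [h1]; exact h.reg_s
  · exact h.range
  · rw [h2]; exact h.tail
  · rw [h3]; exact h.q_mem
  · rw [h3]; exact h.q_surj
  · rw [h3, h4]; exact h.mono
  · rw [h4]; exact h.dist_le
  · rw [h4, h5]; exact h.unvis
  · rw [h4, h5]; exact h.parent
  · rw [FullRel, h6]; exact h.full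
  · exact h.src

theorem Search.card_le (h : Search n L s M vis S) : vis.card ≤ n := by
  have : vis ⊆ Finset.Icc 1 n := fun p hp => Finset.mem_Icc.2 (h.range p hp)
  simpa using Finset.card_le_card this

/-- The search in the state `S'` continues the search in the state `S`. -/
structure Continues (s : ℕ) (vis vis' : Finset ℕ) (S S' : AState) : Prop where
  subset : vis ⊆ vis'
  dist : ∀ p ∈ vis, S'.arr .dist 0 s p = S.arr .dist 0 s p
  q : ∀ i < vis.card, S'.arr .q 0 0 i = S.arr .q 0 0 i

theorem Continues.refl (s : ℕ) (vis : Finset ℕ) (S : AState) : Continues s vis vis S S :=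
  ⟨subset_rfl, fun _ _ => rfl, fun _ _ => rfl⟩

theorem Continues.trans {vis' vis'' : Finset ℕ} {S' S'' : AState}
    (h : Continues s vis vis' S S') (h' : Continues s vis' vis'' S' S'') :
    Continues s vis vis'' S S'' :=
  ⟨h.subset.trans h'.subset, fun p hp => (h'.dist p (h.subset hp)).trans (h.dist p hp),
    fun i hi => (h'.q i (lt_of_lt_of_le hi (Finset.card_le_card h.subset))).trans (h.q i hi)⟩

theorem Continues.congr {vis' : Finset ℕ} {S' S'' : AState}
    (h : Continues s vis vis' S S') (h1 : S''.arr .dist = S'.arr .dist)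
    (h2 : S''.arr .q = S'.arr .q) : Continues s vis vis' S S'' :=
  ⟨h.subset, by rw [h1]; exact h.dist, by rw [h2]; exact h.q⟩

/-- All distances in the queue are at most `e`. -/
def DistLe (s : ℕ) (vis : Finset ℕ) (e : ℕ) (S : AState) : Prop :=
  ∀ p ∈ vis, S.arr .dist 0 s p ≤ e

/-- All distances in the queue are at most `e`, so appending a position of distance `e` keeps the
queue sorted. Distances stay below the number of visited positions, which excludes overflow. -/
theorem visit_runs (hV : V.Good) (h : Search V.n V.L s M vis S) {u e p : ℕ}
    (hp : S.regs .p = p) (hpv : p ∉ vis) (hp1 : 1 ≤ p) (hpn : p ≤ V.n) (hsn : s ≤ V.n)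
    (hu : S.regs .u = u) (huv : u ∈ vis) (he : S.regs .e = e)
    (heu : e = S.arr .dist 0 s u + 1) (hM : M u p ≠ 0) (hd : DistLe s vis e S) :
    Runs V visitCmd S fun S' t => (Search V.n V.L s M (insert p vis) S' ∧
      Continues s vis (insert p vis) S S' ∧ DistLe s (insert p vis) e S') ∧
      t ≤ 6 * V.L + 8 := by
  have hE := hV.E_ge
  have hW := hV.W_ge
  have hcard : vis.card + 1 ≤ V.n := by
    have : insert p vis ⊆ Finset.Icc 1 V.n := by
      intro z hz
      rcases Finset.mem_insert.1 hz with rfl | hz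
      · exact Finset.mem_Icc.2 ⟨hp1, hpn⟩
      · exact Finset.mem_Icc.2 (h.range z hz)
    have := Finset.card_le_card this
    rw [Finset.card_insert_of_notMem hpv] at this
    simpa using this
  have hdu := h.dist_le u huv
  unfold visitCmd
  simp only [runs_seq, runs_set, runs_st]
  simp [h.reg_s, hp, hu, he, h.tail]
  refine ⟨by omega, by omega, by omega, ?_⟩
  have hm := (mark_runs hV (s := s) (vis := vis)
    (S := (((S.setArr .dist 0 s p e).setArr .par 0 s p u).setArr .q 0 0 vis.card p).setReg .tl
      (vis.card + 1)) ?_ (by simpa using h.reg_s) (by simpa [hp] using hpn)).frame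
  swap
  · intro k hk j; simpa using h.full k hk j
  refine hm.mono ?_
  rintro S' t ⟨⟨g1, g2⟩, gF⟩
  simp [hp] at g1
  have gs : S'.regs .s = s := by rw [gF.1 .s (by decide)]; simp [h.reg_s]
  have gt : S'.regs .tl = vis.card + 1 := by rw [gF.1 .tl (by decide)]; simp
  have gd : ∀ z, S'.arr .dist 0 s z = if z = p then e else S.arr .dist 0 s z := by
    intro z; rw [gF.2 .dist (by decide)]; simp
  have gp : ∀ z, S'.arr .par 0 s z = if z = p then u else S.arr .par 0 s z := by
    intro z; rw [gF.2 .par (by decide)]; simp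
  have gq : ∀ z, S'.arr .q 0 0 z = if z = vis.card then p else S.arr .q 0 0 z := by
    intro z; rw [gF.2 .q (by decide)]; simp
  have hnp : ∀ z ∈ vis, z ≠ p := fun z hz h => hpv (h ▸ hz)
  have gdv : ∀ z ∈ vis, S'.arr .dist 0 s z = S.arr .dist 0 s z := fun z hz => by
    rw [gd, if_neg (hnp z hz)]
  have gqv : ∀ i < vis.card, S'.arr .q 0 0 i = S.arr .q 0 0 i := fun i hi => by
    rw [gq, if_neg (by omega)]
  have gdp : S'.arr .dist 0 s p = e := by rw [gd, if_pos rfl]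
  have gqc : S'.arr .q 0 0 vis.card = p := by rw [gq, if_pos rfl]
  have hins := Finset.card_insert_of_notMem hpv
  have hdist : DistLe s (insert p vis) e S' := by
    intro z hz
    rcases Finset.mem_insert.1 hz with rfl | hz
    · exact gdp.le
    · rw [gdv z hz]; exact hd z hz
  refine ⟨⟨⟨gs, ?_, by rw [gt, hins], ?_, ?_, ?_, ?_, ?_, ?_, g1,
    Finset.mem_insert_of_mem h.src⟩, ⟨Finset.subset_insert _ _, gdv, gqv⟩, hdist⟩, by omega⟩
  · intro z hz
    rcases Finset.mem_insert.1 hz with rfl | hz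
    · exact ⟨hp1, hpn⟩
    · exact h.range z hz
  · intro i hi
    rw [hins] at hi
    by_cases hic : i = vis.card
    · rw [hic, gqc]; exact Finset.mem_insert_self _ _
    · rw [gqv i (by omega)]; exact Finset.mem_insert_of_mem (h.q_mem i (by omega))
  · intro z hz
    rcases Finset.mem_insert.1 hz with rfl | hz
    · exact ⟨vis.card, by omega, gqc⟩
    · obtain ⟨i, hi, hi'⟩ := h.q_surj z hz
      exact ⟨i, by omega, by rw [gqv i hi, hi']⟩
  · intro i j hij hj
    rw [hins] at hj
    by_cases hjc : j = vis.card
    · rw [hjc, gqc, gdp]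
      refine hdist _ ?_
      by_cases hic : i = vis.card
      · rw [hic, gqc]; exact Finset.mem_insert_self _ _
      · rw [gqv i (by omega)]; exact Finset.mem_insert_of_mem (h.q_mem i (by omega))
    · rw [gqv i (by omega), gqv j (by omega), gdv _ (h.q_mem i (by omega)),
        gdv _ (h.q_mem j (by omega))]
      exact h.mono i j hij (by omega)
  · intro z hz
    rcases Finset.mem_insert.1 hz with rfl | hz
    · rw [gdp, hins]; omega
    · rw [gdv z hz, hins]
      have := h.dist_le z hz
      omega
  · intro z hz1 hz2 hz
    rw [Finset.mem_insert, not_or] at hz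
    rw [gd, gp, if_neg hz.1, if_neg hz.1]
    exact h.unvis z hz1 hz2 hz.2
  · intro z hz
    rcases Finset.mem_insert.1 hz with rfl | hz
    · right
      rw [gp, if_pos rfl, gdp, gdv u huv]
      exact ⟨fun h' => hpv (h' ▸ h.src), Finset.mem_insert_of_mem huv, hM, heu⟩
    · rw [gp, if_neg (hnp z hz), gdv z hz]
      rcases h.parent z hz with h1 | ⟨h1, h2, h3, h4⟩
      · exact Or.inl h1
      · right
        rw [gdv _ h2]
        exact ⟨h1, Finset.mem_insert_of_mem h2, h3, h4⟩

/-- Each new position costs at most `14 * L + 13`: a visit, a step to the right, a search for the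
next unvisited position and a test. The remaining `8 * L + 5` steps are spent even if nothing is
new, so they must be paid for by the interval. -/
theorem fill_runs (hV : V.Good) (h : Search V.n V.L s M vis S) {u e l r : ℕ} (hsn : s ≤ V.n)
    (hl : S.regs .l = l) (hr : S.regs .rr = r) (hl1 : 1 ≤ l) (hln : l ≤ V.n + 1)
    (hrn : r ≤ V.n + 1)
    (hu : S.regs .u = u) (huv : u ∈ vis) (he : S.regs .e = e)
    (heu : e = S.arr .dist 0 s u + 1) (hM : ∀ p, l ≤ p → p < r → M u p ≠ 0)
    (hd : DistLe s vis e S) :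
    Runs V fillCmd S fun S' t => ∃ vis', (Search V.n V.L s M vis' S' ∧
      Continues s vis vis' S S' ∧ DistLe s vis' e S' ∧ ∀ p, l ≤ p → p < r → p ∈ vis') ∧
      t + (14 * V.L + 13) * vis.card ≤ (14 * V.L + 13) * vis'.card + (8 * V.L + 5) := by
  have hE := hV.E_ge
  have hW := hV.W_ge
  have hnot : ∀ {vis' S'}, Search V.n V.L s M vis' S' → V.n + 1 ∉ vis' := fun h' hm => by
    have := h'.range _ hm; omega
  unfold fillCmd
  rw [runs_seq, runs_set]
  refine ⟨by simp, ?_⟩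
  rw [runs_seq]
  refine ((find_runs hV (S := S.setReg .p _) (vis := vis) (s := s) (l := l) h.full (hnot h)
    (by simp [h.reg_s]) hln (by simp [hl])).frame).mono ?_
  rintro S1 t1 ⟨⟨⟨f1, f2, f3, f4⟩, ft⟩, hF1⟩
  have h1 : Search V.n V.L s M vis S1 := h.congr (by rw [hF1.1 .s (by decide)]; simp)
    (by rw [hF1.1 .tl (by decide)]; simp) (hF1.2 .q (by decide)) (hF1.2 .dist (by decide))
    (hF1.2 .par (by decide)) (hF1.2 .full (by decide))
  have hc1 : Continues s vis vis S S1 :=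
    (Continues.refl _ _ _).congr (hF1.2 .dist (by decide)) (hF1.2 .q (by decide))
  have r1 : ∀ x, x ≠ Reg.p → x ∉ findCmd.regsMod → S1.regs x = S.regs x := fun x hx hx' => by
    rw [hF1.1 x hx']; simp [hx]
  set a := 14 * V.L + 13 with ha
  refine runs_whl (fun S' c => ∃ vis', (Search V.n V.L s M vis' S' ∧
      Continues s vis vis' S S' ∧ DistLe s vis' e S' ∧ l ≤ S'.regs .p ∧ S'.regs .p ≤ V.n + 1 ∧
      S'.regs .p ∉ vis' ∧ ∀ p, l ≤ p → p < S'.regs .p → p ∈ vis') ∧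
      c + a * vis.card ≤ a * vis'.card) (a * V.n) ?_ ?_ ?_ ?_ ?_
  · refine ⟨vis, ⟨h1, hc1, ?_, f1, f2, f3, f4⟩, by omega⟩
    rw [DistLe, hF1.2 .dist (by decide)]; exact hd
  · simp
  · rintro S' c ⟨vis', ⟨k1, _⟩, k2⟩
    have := Nat.mul_le_mul_left a k1.card_le
    omega
  · rintro S' c ⟨vis', ⟨k1, k2, k3, k4, k5, k6, k7⟩, k8⟩ hFr hne
    have gr : S'.regs .rr = r := by
      rw [hFr.1 .rr (by decide), r1 .rr (by decide) (by decide), hr]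
    have gu : S'.regs .u = u := by
      rw [hFr.1 .u (by decide), r1 .u (by decide) (by decide), hu]
    have ge : S'.regs .e = e := by
      rw [hFr.1 .e (by decide), r1 .e (by decide) (by decide), he]
    simp [gr] at hne
    rw [runs_seq]
    refine ((visit_runs hV k1 rfl k6 (by omega) (by omega) hsn gu (k2.subset huv) ge
      (by rw [k2.dist u huv, heu]) (hM _ k4 hne) k3).frame).mono ?_
    rintro S2 t2 ⟨⟨⟨m1, m2, m3⟩, m4⟩, hF2⟩
    rw [runs_seq, runs_set]
    have gp2 : S2.regs .p = S'.regs .p := hF2.1 .p (by decide)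
    refine ⟨by simp; omega, ?_⟩
    refine ((find_runs hV (S := S2.setReg .p _) (vis := insert (S'.regs .p) vis') (s := s)
      (l := S'.regs .p + 1) m1.full (hnot m1)
      (by simp [m1.reg_s]) (by omega) (by simp [gp2])).frame).mono ?_
    rintro S3 t3 ⟨⟨⟨f1', f2', f3', f4'⟩, ft'⟩, hF3⟩
    refine ⟨insert (S'.regs .p) vis', ⟨m1.congr (by rw [hF3.1 .s (by decide)]; simp)
      (by rw [hF3.1 .tl (by decide)]; simp) (hF3.2 .q (by decide)) (hF3.2 .dist (by decide))
      (hF3.2 .par (by decide)) (hF3.2 .full (by decide)),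
      (k2.trans m2).congr (hF3.2 .dist (by decide)) (hF3.2 .q (by decide)), ?_, by omega, f2', f3',
      fun p hp hp' => ?_⟩, ?_⟩
    · rw [DistLe, hF3.2 .dist (by decide)]; exact m3
    · by_cases hpp : p < S'.regs .p
      · exact Finset.mem_insert_of_mem (k7 p hp hpp)
      · by_cases hpe : p = S'.regs .p
        · rw [hpe]; exact Finset.mem_insert_self _ _
        · exact f4' p (by omega) hp'
    · rw [Finset.card_insert_of_notMem k6, mul_add_one]
      omega
  · rintro S' c ⟨vis', ⟨k1, k2, k3, k4, k5, k6, k7⟩, k8⟩ hFr hz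
    have gr : S'.regs .rr = r := by
      rw [hFr.1 .rr (by decide), r1 .rr (by decide) (by decide), hr]
    simp [gr] at hz
    exact ⟨vis', ⟨k1, k2, k3, fun p hp hp' => k7 p hp (by omega)⟩, by omega⟩

end BFS

end WordRAM

/-! ### Amortized scanning of blocks and intervals -/

namespace WordRAM

open MergeWidth

/-- The arrays that describe the runs of the matrix. -/
structure Tables (n L : ℕ) (R : ℕ → ℕ → ℕ) (S : AState) : Prop where
  run : ∀ k ≤ L, ∀ i l, S.arr .run k i l = block R k i l
  list : ∀ k < L, ∀ i, ListUpTo R k i (n + 1) (S.arr .cnt 0 k i) (S.arr .lst k i)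

theorem Tables.congr {n L : ℕ} {R : ℕ → ℕ → ℕ} {S S' : AState} (h : Tables n L R S)
    (h1 : S'.arr .run = S.arr .run) (h2 : S'.arr .cnt = S.arr .cnt)
    (h3 : S'.arr .lst = S.arr .lst) : Tables n L R S' :=
  ⟨by rw [h1]; exact h.run, by rw [h2, h3]; exact h.list⟩

/-- Everything that is marked as done has been visited. -/
structure Marks (n L s : ℕ) (R : ℕ → ℕ → ℕ) (vis : Finset ℕ) (S : AState) : Prop where
  idone : ∀ l r, (l, r) ∈ runIntervals R n → S.arr .idone 0 l r = s → ∀ p, l ≤ p → p < r → p ∈ vis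
  done : ∀ k < L, ∀ j, S.arr .done 0 k j = s → ∀ l, IsEntry R k j l →
    ∀ p, l ≤ p → p < block R k j l → p ∈ vis

theorem Marks.congr {n L s : ℕ} {R : ℕ → ℕ → ℕ} {vis : Finset ℕ} {S S' : AState}
    (h : Marks n L s R vis S) (h1 : S'.arr .idone = S.arr .idone)
    (h2 : S'.arr .done = S.arr .done) : Marks n L s R vis S' :=
  ⟨by rw [h1]; exact h.idone, by rw [h2]; exact h.done⟩

/-- The number of processed intervals. -/
def intervalCount (n s : ℕ) (R : ℕ → ℕ → ℕ) (S : AState) : ℕ :=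
  ∑ x ∈ runIntervals R n, if S.arr .idone 0 x.1 x.2 = s then 1 else 0

/-- The number of entries of the processed blocks. -/
def entryCount (n L s : ℕ) (S : AState) : ℕ :=
  ∑ x ∈ Finset.range L ×ˢ Finset.range (n + 1),
    if S.arr .done 0 x.1 x.2 = s then S.arr .cnt 0 x.1 x.2 else 0

/-- Serves to show that a single new mark raises `intervalCount` or `entryCount` by just the summand
of that mark. -/
theorem _root_.Finset.sum_add_eq_sum_add_of_eq_off {ι : Type*} {s : Finset ι} {f g : ι → ℕ} {i : ι}
    (hi : i ∈ s) (h : ∀ j ∈ s, j ≠ i → f j = g j) :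
    ∑ j ∈ s, f j + g i = ∑ j ∈ s, g j + f i := by
  classical
  rw [← Finset.add_sum_erase s f hi, ← Finset.add_sum_erase s g hi,
    Finset.sum_congr rfl fun j hj => h j (Finset.mem_of_mem_erase hj) (Finset.ne_of_mem_erase hj)]
  ring

section BFS

variable {V : Env} {S : AState} {vis : Finset ℕ} {s : ℕ} {M R : ℕ → ℕ → ℕ} {n L : ℕ}

theorem intervalCount_congr {S' : AState} (h : S'.arr .idone = S.arr .idone) :
    intervalCount n s R S' = intervalCount n s R S := by rw [intervalCount, h]; rfl

theorem entryCount_congr {S' : AState} (h : S'.arr .done = S.arr .done)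
    (h' : S'.arr .cnt = S.arr .cnt) : entryCount n L s S' = entryCount n L s S := by
  rw [entryCount, h, h']; rfl

theorem mem_runIntervals (hM : IsMatrix n M) (hR : IsRunTable M R) {a l : ℕ} (h : R a l ≠ 0) :
    (l, R a l) ∈ runIntervals R n := by
  have := hR.bounds hM.supp h
  exact Finset.mem_image.2 ⟨(a, l), Finset.mem_filter.2 ⟨by simp; omega, h⟩, rfl⟩

/-- The situation before and after the processing of blocks of a row. -/
structure Progress (V : Env) (s u e : ℕ) (M R : ℕ → ℕ → ℕ) (vis : Finset ℕ) (S : AState) :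
    Prop where
  search : Search V.n V.L s M vis S
  tables : Tables V.n V.L R S
  marks : Marks V.n V.L s R vis S
  reg_u : S.regs .u = u
  reg_e : S.regs .e = e
  mem : u ∈ vis
  e_eq : e = S.arr .dist 0 s u + 1
  dist : DistLe s vis e S

/-- A bound on the time spent so far. -/
def potential (V : Env) (s : ℕ) (R : ℕ → ℕ → ℕ) (vis : Finset ℕ) (S : AState) : ℕ :=
  (14 * V.L + 13) * (intervalCount V.n s R S + vis.card) + 6 * entryCount V.n V.L s S

/-- The entries of a block that contains row `u` are runs of row `u`, so only neighbours of `u` are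
visited. Marked blocks and intervals may be skipped since their positions are visited. Handling a
list entry costs `6`, paid by `entryCount`; the overhead of a fill is paid by the newly marked
interval, and visits are paid by the growth of `vis`. The surplus `4` covers the test, the mark and
the start and end of the loop. -/
theorem node_runs (hV : V.Good) (hM : IsMatrix V.n M) (hR : IsRunTable M R) (hsn : s ≤ V.n)
    {u e k : ℕ} (h : Progress V s u e M R vis S) (hk : k < V.L) (hkr : S.regs .k = k)
    (hj : S.regs .j = u / 2 ^ k) :
    Runs V nodeCmd S fun S' t => ∃ vis', (Progress V s u e M R vis' S' ∧
      Continues s vis vis' S S' ∧ S'.arr .done 0 k (u / 2 ^ k) = s ∧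
      ∀ k j, S.arr .done 0 k j = s → S'.arr .done 0 k j = s) ∧
      t + potential V s R vis S ≤ potential V s R vis' S' + 4 := by
  have hE := hV.E_ge
  have hW := hV.W_ge
  have hL := hV.L_le
  have hun := h.search.range u h.mem
  have hju : u / 2 ^ k ≤ u := Nat.div_le_self _ _
  have hs := h.search.reg_s
  have hsound : ∀ {l}, block R k (u / 2 ^ k) l ≠ 0 → block R k (u / 2 ^ k) l = R u l := fun hb =>
    (block_eq hb rfl).symm
  obtain ⟨j, hjj⟩ : ∃ j, u / 2 ^ k = j := ⟨_, rfl⟩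
  rw [hjj] at hju hsound hj ⊢
  unfold nodeCmd
  rw [runs_ite]
  refine ⟨by simp [hkr, hj]; omega, fun h1 => ⟨1, S, .skip S, ?_⟩, fun h1 => ?_⟩
  · simp [hkr, hj, hs] at h1
    exact ⟨vis, ⟨h, .refl _ _ _, h1, fun _ _ h => h⟩, by omega⟩
  simp [hkr, hj, hs] at h1
  simp only [runs_seq, runs_st]
  refine ⟨by simp [hkr, hj]; omega, ?_⟩
  have hlist := h.tables.list k hk j
  have hcnt := hlist.cnt_le
  obtain ⟨N, hN⟩ : ∃ N, S.arr .cnt 0 k j = N := ⟨_, rfl⟩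
  rw [hN] at hlist hcnt
  simp only [hkr, hj, hs, aeval_ofNat, aeval_r]
  set S0 := S.setArr .done 0 k j s with hS0
  -- Marking the block raises the potential at once by the cost of its whole list.
  have hpot0 : potential V s R vis S0 = potential V s R vis S + 6 * N := by
    have e1 : entryCount V.n V.L s S0 = entryCount V.n V.L s S + N := by
      have := Finset.sum_add_eq_sum_add_of_eq_off (s := Finset.range V.L ×ˢ Finset.range (V.n + 1))
        (f := fun x => if S0.arr .done 0 x.1 x.2 = s then S0.arr .cnt 0 x.1 x.2 else 0)
        (g := fun x => if S.arr .done 0 x.1 x.2 = s then S.arr .cnt 0 x.1 x.2 else 0)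
        (i := (k, j)) (by simp; omega) (by
          rintro ⟨k', j'⟩ _ hne
          have : ¬ (k' = k ∧ j' = j) := by simpa using hne
          simp [hS0, this])
      dsimp only at this
      rwa [if_neg h1, if_pos (show S0.arr .done 0 k j = s by simp [hS0]),
        show S0.arr .cnt 0 k j = N by simpa [hS0] using hN, add_zero] at this
    have e2 : intervalCount V.n s R S0 = intervalCount V.n s R S :=
      intervalCount_congr (by funext a b c; simp [hS0])
    rw [potential, potential, e1, e2]; ring
  refine runs_loop (N := N) (fun c S' T => ∃ vis', (Search V.n V.L s M vis' S' ∧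
      Continues s vis vis' S S' ∧ DistLe s vis' e S' ∧
      (∀ l r, (l, r) ∈ runIntervals R V.n → S'.arr .idone 0 l r = s →
        ∀ p, l ≤ p → p < r → p ∈ vis') ∧
      ∀ c' < c, ∀ p, S.arr .lst k j c' ≤ p → p < block R k j (S.arr .lst k j c') → p ∈ vis') ∧
      T + (14 * V.L + 13) * (intervalCount V.n s R S0 + vis.card) ≤
        (14 * V.L + 13) * (intervalCount V.n s R S' + vis'.card) + 6 * c + 1)
    (by omega) ?_ ?_ ?_ ?_
  · refine ⟨vis, ⟨h.search.congr ?_ ?_ ?_ ?_ ?_ ?_, (Continues.refl _ _ _).congr ?_ ?_, ?_, ?_, ?_⟩,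
      ?_⟩
    · simp [hS0]
    · simp [hS0]
    · funext a b c; simp [hS0]
    · funext a b c; simp [hS0]
    · funext a b c; simp [hS0]
    · funext a b c; simp [hS0]
    · funext a b c; simp [hS0]
    · funext a b c; simp [hS0]
    · intro p hp; simpa [hS0] using h.dist p hp
    · intro l r hlr; simpa [hS0] using h.marks.idone l r hlr
    · intro c' hc'; omega
    · rw [show intervalCount V.n s R (S0.setReg .c 0) = intervalCount V.n s R S0 from rfl]; omega
  · rintro c S' T hc _ hr hF
    have gk : S'.regs .k = k := by rw [hF.1 .k (by decide)]; simpa [hS0] using hkr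
    have gj : S'.regs .j = j := by rw [hF.1 .j (by decide)]; simpa [hS0] using hj
    have gc : S'.arr .cnt = S.arr .cnt := by
      rw [hF.2 .cnt (by decide)]; funext a b c; simp [hS0]
    simp [gk, gj, gc, hN]
    omega
  · rintro c S' T hc ⟨vis', ⟨k1, k2, k3, k4, k5⟩, hT⟩ hr hF
    have gk : S'.regs .k = k := by rw [hF.1 .k (by decide)]; simpa [hS0] using hkr
    have gj : S'.regs .j = j := by rw [hF.1 .j (by decide)]; simpa [hS0] using hj
    have gu : S'.regs .u = u := by rw [hF.1 .u (by decide)]; simpa [hS0] using h.reg_u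
    have ge : S'.regs .e = e := by rw [hF.1 .e (by decide)]; simpa [hS0] using h.reg_e
    have gl : S'.arr .lst = S.arr .lst := by
      rw [hF.2 .lst (by decide)]; funext a b c; simp [hS0]
    have gr : S'.arr .run = S.arr .run := by
      rw [hF.2 .run (by decide)]; funext a b c; simp [hS0]
    have gs := k1.reg_s
    obtain ⟨l, hl⟩ : ∃ l, S.arr .lst k j c = l := ⟨_, rfl⟩
    have hent := hlist.sound c hc
    rw [hl] at hent
    have hblk := hsound hent.2.1
    obtain ⟨r, hrr⟩ : ∃ r, block R k j l = r := ⟨_, rfl⟩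
    have hrun := h.tables.run k hk.le j l
    rw [hrr] at hblk hrun
    have hR0 : R u l ≠ 0 := by rw [← hblk, ← hrr]; exact hent.2.1
    have hb := hR.bounds hM.supp hR0
    have hint := mem_runIntervals hM hR hR0
    have hone := (hR.sound u l hR0).one
    rw [← hblk] at hb hint hone
    simp only [runs_seq, runs_set, runs_ite, runs_skip, runs_st]
    simp only [aeval_r, aeval_ld, aeval_eq, setReg_regs, setReg_arr, gk, gj, gl, gr, hr, gs, hl,
      hrun, reduceCtorEq, if_true, if_false, aeval_ofNat, ok_ld, ok_r, ok_ofNat, ok_eq]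
    refine ⟨by simp; omega, by simp; omega,
      by simp; omega, fun hd => ?_, fun hd => ?_⟩
    · have hd' : S'.arr .idone 0 l r = s := by simpa using hd
      refine ⟨by simp, vis', ⟨k1.congr ?_ ?_ ?_ ?_ ?_ ?_, k2.congr ?_ ?_, ?_, ?_, ?_⟩, ?_⟩
      any_goals rfl
      any_goals simp
      · intro p hp; simpa using k3 p hp
      · exact k4
      · intro c' hc' p hp hp'
        by_cases hcc : c' = c
        · subst hcc
          rw [hl] at hp hp'
          rw [hrr] at hp'
          exact k4 l r hint hd' p hp hp'
        · exact k5 c' (by omega) p hp hp'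
      · change _ ≤ (14 * V.L + 13) * (intervalCount V.n s R S' + vis'.card) + 6 * (c + 1) + 1
        omega
    · have hd' : S'.arr .idone 0 l r ≠ s := by simpa using hd
      refine ⟨by simp; omega, ?_⟩
      obtain ⟨S1, hS1⟩ : ∃ S1, S1 = ((S'.setReg .l l).setReg .rr r).setArr .idone 0 l r s :=
        ⟨_, rfl⟩
      have q1 : Search V.n V.L s M vis' S1 := by
        refine k1.congr ?_ ?_ ?_ ?_ ?_ ?_
        any_goals simp [hS1]
        all_goals (funext a b c; simp)
      have q2 : Continues s vis vis' S S1 := by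
        refine k2.congr ?_ ?_ <;> (funext a b c; simp [hS1])
      have hfill := (fill_runs hV q1 (u := u) (e := e) (l := l) (r := r) hsn (by simp [hS1])
        (by simp [hS1]) (by omega) (by omega) (by omega) (by simp [hS1, gu]) (k2.subset h.mem)
        (by simp [hS1, ge]) (by rw [h.e_eq, q2.dist u h.mem]) hone
        (fun p hp => by simpa [hS1] using k3 p hp)).frame
      rw [← hS1]
      refine hfill.mono ?_
      rintro S2 t2 ⟨⟨vis2, ⟨m1, m2, m3, m4⟩, m5⟩, hF2⟩
      have hI : intervalCount V.n s R S1 = intervalCount V.n s R S' + 1 := by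
        have := Finset.sum_add_eq_sum_add_of_eq_off (s := runIntervals R V.n)
          (f := fun x => if S1.arr .idone 0 x.1 x.2 = s then 1 else 0)
          (g := fun x => if S'.arr .idone 0 x.1 x.2 = s then 1 else 0)
          (i := (l, r)) hint (by
            rintro ⟨k', j'⟩ _ hne
            have : ¬ (k' = l ∧ j' = r) := by simpa using hne
            simp [hS1, this])
        dsimp only at this
        rwa [if_neg hd', if_pos (show S1.arr .idone 0 l r = s by simp [hS1]), add_zero] at this
      have hI2 : intervalCount V.n s R S2 = intervalCount V.n s R S1 :=
        intervalCount_congr (hF2.2 .idone (by decide))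
      refine ⟨by rw [hF2.1 .c (by decide)]; simp [hS1, hr], vis2,
        ⟨m1.congr rfl rfl rfl rfl rfl rfl, (q2.trans m2).congr rfl rfl, m3, ?_, ?_⟩, ?_⟩
      · intro l' r' hm hd2 p hp hp'
        rw [hF2.2 .idone (by decide)] at hd2
        by_cases hlr : l' = l ∧ r' = r
        · rw [hlr.1] at hp
          rw [hlr.2] at hp'
          exact m4 p hp hp'
        · simp [hS1, hlr] at hd2
          exact m2.subset (k4 l' r' hm hd2 p hp hp')
      · intro c' hc' p hp hp'
        by_cases hcc : c' = c
        · subst hcc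
          rw [hl] at hp hp'
          rw [hrr] at hp'
          exact m4 p hp hp'
        · exact m2.subset (k5 c' (by omega) p hp hp')
      · change _ ≤ (14 * V.L + 13) * (intervalCount V.n s R S2 + vis2.card) + 6 * (c + 1) + 1
        rw [hI2, hI]
        obtain ⟨A, hA⟩ : ∃ A, 14 * V.L + 13 = A := ⟨_, rfl⟩
        rw [hA] at hT m5 ⊢
        simp only [mul_add, mul_one] at hT m5 ⊢
        omega
  · rintro S' T ⟨vis', ⟨k1, k2, k3, k4, k5⟩, hT⟩ hr hF
    have gu : S'.regs .u = u := by rw [hF.1 .u (by decide)]; simpa [hS0] using h.reg_u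
    have ge : S'.regs .e = e := by rw [hF.1 .e (by decide)]; simpa [hS0] using h.reg_e
    have gl : S'.arr .lst = S.arr .lst := by
      rw [hF.2 .lst (by decide)]; funext a b c; simp [hS0]
    have gc : S'.arr .cnt = S.arr .cnt := by
      rw [hF.2 .cnt (by decide)]; funext a b c; simp [hS0]
    have gr : S'.arr .run = S.arr .run := by
      rw [hF.2 .run (by decide)]; funext a b c; simp [hS0]
    have gd : ∀ a b, S'.arr .done 0 a b = if a = k ∧ b = j then s else S.arr .done 0 a b := by
      intro a b
      rw [hF.2 .done (by decide)]; simp [hS0]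
    refine ⟨vis', ⟨⟨k1, h.tables.congr gr gc gl, ⟨k4, ?_⟩, gu, ge, k2.subset h.mem,
      by rw [h.e_eq, k2.dist u h.mem], k3⟩, k2, by simp [gd], fun a b hab => by simp [gd, hab]⟩, ?_⟩
    · intro a ha b hab l hl p hp hp'
      by_cases hab' : a = k ∧ b = j
      · obtain ⟨rfl, rfl⟩ := hab'
        have : l < V.n + 1 := by
          by_contra hcon
          refine hl.1 (RunsVanish.block_eq_zero (n := V.n) ?_ (Or.inr (by omega)))
          intro a' l' hal
          have := hR.bounds hM.supp hal
          omega
        obtain ⟨c', hc', rfl⟩ := hlist.complete l this hl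
        exact k5 c' hc' p hp hp'
      · rw [gd, if_neg hab'] at hab
        exact k2.subset (h.marks.done a ha b hab l hl p hp hp')
    · have e1 : entryCount V.n V.L s S' = entryCount V.n V.L s S0 := by
        refine entryCount_congr (hF.2 .done (by decide)) (hF.2 .cnt (by decide))
      have e3 : intervalCount V.n s R S0 = intervalCount V.n s R S :=
        intervalCount_congr (by funext a b c; simp [hS0])
      rw [e3] at hT
      unfold potential at hpot0 ⊢
      rw [e3] at hpot0
      rw [e1]
      omega

end BFS

end WordRAM

/-! ### Processing one queue element; effects of a search on the arrays -/

namespace WordRAM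

open MergeWidth

theorem _root_.MergeWidth.exists_isRun {f : ℕ → ℕ} {n v : ℕ} (h0 : f 0 = 0) (hn : ∀ b, n < b → f b = 0)
    (hv : f v ≠ 0) : ∃ l r, IsRun f l r ∧ l ≤ v ∧ v < r := by
  classical
  have hex : ∃ b, v ≤ b ∧ f b = 0 := ⟨max v (n + 1), by omega, hn _ (by omega)⟩
  have h1 := Nat.find_spec hex
  have h2 := fun b (h : b < Nat.find hex) => Nat.find_min hex h
  set r := Nat.find hex
  have h3 : f (Nat.findGreatest (fun b => f b = 0) v) = 0 :=
    Nat.findGreatest_spec (P := fun b => f b = 0) (Nat.zero_le _) h0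
  have h4 : ∀ b, Nat.findGreatest (fun b => f b = 0) v < b → b ≤ v → f b ≠ 0 := fun b hb hb' =>
    Nat.findGreatest_is_greatest (P := fun b => f b = 0) hb hb'
  have h5 := Nat.findGreatest_le (P := fun b => f b = 0) v
  set l := Nat.findGreatest (fun b => f b = 0) v
  have hvl : v ≠ l := fun h => hv (h ▸ h3)
  have hvr : v ≠ r := fun h => hv (h ▸ h1.2)
  refine ⟨l + 1, r, ⟨h3, by omega, fun b hb hb' => ?_, h1.2⟩, by omega, by omega⟩
  by_cases hbv : b ≤ v
  · exact h4 b (by omega) hbv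
  · exact fun h => h2 b hb' ⟨by omega, h⟩

/-- The commands that store in the array `x` have indices and values that satisfy `Φ`. -/
def Cmd.Stores (x : Arr) (Φ : AExp → AExp → Prop) : Cmd → Prop
  | .st x' _ i _ e => x' = x → Φ i e
  | .seq p q => p.Stores x Φ ∧ q.Stores x Φ
  | .ite _ p q => p.Stores x Φ ∧ q.Stores x Φ
  | .whl _ p => p.Stores x Φ
  | _ => True

/-- A syntactic argument: every store into `x` has an index and a value of the form `Φ`, and the
register `r` on which these depend never changes. So a cell is either untouched or satisfies `Q`,
whatever the control flow. -/
theorem AExec.stores {V : Env} {x : Arr} {Φ : AExp → AExp → Prop} {Q : ℕ → ℕ → Prop} {r : Reg}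
    {s : ℕ} (hΦ : ∀ S : AState, S.regs r = s → ∀ i e, Φ i e → Q (i.aeval V S) (e.aeval V S))
    {p : Cmd} {S S' : AState} {t : ℕ} (h : AExec V p S t S') (hr : r ∉ p.regsMod)
    (hs : S.regs r = s) (hp : p.Stores x Φ) (k i j : ℕ) :
    S'.arr x k i j = S.arr x k i j ∨ Q i (S'.arr x k i j) := by
  induction h with
  | skip | set | put => exact Or.inl rfl
  | @st S x' k' i' j' e' h =>
    rw [setArr_arr]
    split_ifs with hc
    · right
      rw [hc.2.2.1]
      exact hΦ S hs _ _ (hp hc.1.symm)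
    · exact Or.inl rfl
  | seq h1 h2 ih1 ih2 =>
    simp only [Cmd.regsMod, List.mem_append, not_or] at hr
    have e1 := ih1 hr.1 hs hp.1
    have e2 := ih2 hr.2 (by rw [h1.frame.1 r hr.1, hs]) hp.2
    rcases e2 with e2 | e2
    · rw [e2]; exact e1
    · exact Or.inr e2
  | ite_true _ _ _ ih =>
    simp only [Cmd.regsMod, List.mem_append, not_or] at hr
    exact ih hr.1 hs hp.1
  | ite_false _ _ _ ih =>
    simp only [Cmd.regsMod, List.mem_append, not_or] at hr
    exact ih hr.2 hs hp.2
  | whl_true _ _ h1 h2 ih1 ih2 =>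
    have e1 := ih1 hr hs hp
    have e2 := ih2 hr (by rw [h1.frame.1 r hr, hs]) hp
    rcases e2 with e2 | e2
    · rw [e2]; exact e1
    · exact Or.inr e2
  | whl_false => exact Or.inl rfl

/-- The cells that a search from `s` may change. -/
structure SearchFrame (s : ℕ) (S S' : AState) : Prop where
  full : ∀ k i j, S'.arr .full k i j = S.arr .full k i j ∨ S'.arr .full k i j = s
  done : ∀ k i j, S'.arr .done k i j = S.arr .done k i j ∨ S'.arr .done k i j = s
  idone : ∀ k i j, S'.arr .idone k i j = S.arr .idone k i j ∨ S'.arr .idone k i j = s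
  dist : ∀ k i j, S'.arr .dist k i j = S.arr .dist k i j ∨ i = s
  par : ∀ k i j, S'.arr .par k i j = S.arr .par k i j ∨ i = s

theorem AExec.searchFrame {V : Env} {S S' : AState} {t : ℕ} (h : AExec V searchCmd S t S') :
    SearchFrame (S.regs .s) S S' := by
  constructor
  iterate 3
    · exact h.stores (r := .s) (Φ := fun _ e => e = .r .s) (Q := fun _ v => v = S.regs .s)
        (fun S' hS' i e he => by rw [he, aeval_r, hS']) (by decide) rfl (by
          simp [Cmd.Stores, searchCmd, clearCmd, visitCmd, markCmd, popCmd, nodeCmd, fillCmd,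
            findCmd, Cmd.loop])
  iterate 2
    · exact h.stores (r := .s) (Φ := fun i _ => i = .r .s) (Q := fun i _ => i = S.regs .s)
        (fun S' hS' i e he => by rw [he, aeval_r, hS']) (by decide) rfl (by
          simp [Cmd.Stores, searchCmd, clearCmd, visitCmd, markCmd, popCmd, nodeCmd, fillCmd,
            findCmd, Cmd.loop])

section BFS

variable {V : Env} {S : AState} {vis : Finset ℕ} {s : ℕ} {M R : ℕ → ℕ → ℕ}

theorem Progress.congr {u e : ℕ} {S' : AState} (h : Progress V s u e M R vis S)
    (hr : ∀ r, r ≠ Reg.k → r ≠ Reg.j → S'.regs r = S.regs r) (ha : S'.arr = S.arr) :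
    Progress V s u e M R vis S' :=
  ⟨h.search.congr (hr _ (by decide) (by decide)) (hr _ (by decide) (by decide)) (by rw [ha])
      (by rw [ha]) (by rw [ha]) (by rw [ha]),
    h.tables.congr (by rw [ha]) (by rw [ha]) (by rw [ha]), h.marks.congr (by rw [ha]) (by rw [ha]),
    by rw [hr _ (by decide) (by decide), h.reg_u], by rw [hr _ (by decide) (by decide), h.reg_e],
    h.mem, by rw [ha, h.e_eq], by rw [DistLe, ha]; exact h.dist⟩

theorem potential_congr {S' : AState} (ha : S'.arr = S.arr) :
    potential V s R vis S' = potential V s R vis S := by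
  rw [potential, intervalCount_congr (S := S) (by rw [ha]),
    entryCount_congr (S := S) (by rw [ha]) (by rw [ha]), potential]

/-- After the loop all blocks of level below `L` that contain `u` are done. Each neighbour of `u`
lies in a run of row `u`, which is an entry of one of them: the block of level `L` contains the
empty row `0` and therefore has no common run. -/
theorem pop_runs (hV : V.Good) (hM : IsMatrix V.n M) (hR : IsRunTable M R) (hsn : s ≤ V.n)
    (h1 : Search V.n V.L s M vis S) (h2 : Tables V.n V.L R S) (h3 : Marks V.n V.L s R vis S)
    {h u : ℕ} (hh : S.regs .h = h) (hlt : h < vis.card) (hu : S.arr .q 0 0 h = u)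
    (hd : DistLe s vis (S.arr .dist 0 s u + 1) S) :
    Runs V popCmd S fun S' t => ∃ vis', (Search V.n V.L s M vis' S' ∧ Tables V.n V.L R S' ∧
      Marks V.n V.L s R vis' S' ∧ Continues s vis vis' S S' ∧ S'.regs .h = h + 1 ∧
      ∀ v, (v ∈ vis' → S'.arr .dist 0 s v ≤ S.arr .dist 0 s u + 1) ∧ (M u v ≠ 0 → v ∈ vis')) ∧
      t + potential V s R vis S ≤ potential V s R vis' S' + (7 * V.L + 6) := by
  have hE := hV.E_ge
  have hW := hV.W_ge
  have hL := hV.L_le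
  have hcn := h1.card_le
  have huv : u ∈ vis := by rw [← hu]; exact h1.q_mem h hlt
  have hun := h1.range u huv
  have hs := h1.reg_s
  have hdu := h1.dist_le u huv
  unfold popCmd
  simp only [runs_seq, runs_set]
  simp [hh, hu, hs]
  refine ⟨by omega, by omega, ?_⟩
  obtain ⟨S0, hS0⟩ : ∃ S0, S0 = ((S.setReg .u u).setReg .e (S.arr .dist 0 s u + 1)).setReg .j u :=
    ⟨_, rfl⟩
  rw [← hS0]
  have hP0 : Progress V s u (S.arr .dist 0 s u + 1) M R vis S0 := by
    subst hS0
    exact ⟨h1.congr (by simp) (by simp) rfl rfl rfl rfl, h2.congr rfl rfl rfl, h3.congr rfl rfl,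
      by simp, by simp, huv, rfl, hd⟩
  have hA0 : S0.arr = S.arr := by subst hS0; rfl
  refine runs_loop (N := V.L) (fun k S' T => ∃ vis', (Progress V s u (S.arr .dist 0 s u + 1) M R
      vis' S' ∧ Continues s vis vis' S S' ∧ S'.regs .j = u / 2 ^ k ∧
      ∀ k' < k, S'.arr .done 0 k' (u / 2 ^ k') = s) ∧
      T + potential V s R vis S ≤ potential V s R vis' S' + 7 * k + 1) (by omega) ?_ ?_ ?_ ?_
  · refine ⟨vis, ⟨hP0.congr (fun r hr _ => by simp [hr]) rfl,
      (Continues.refl _ _ _).congr (by rw [setReg_arr, hA0]) (by rw [setReg_arr, hA0]),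
      by simp [hS0], by simp⟩, ?_⟩
    rw [potential_congr (S' := S0.setReg .k 0) hA0]; omega
  · simp
  · rintro k S' T hk ⟨vis', ⟨k1, k2, k3, k4⟩, hT⟩ hr hF
    rw [runs_seq]
    refine ((node_runs hV hM hR hsn k1 hk hr k3).frame).mono ?_
    rintro S1 t1 ⟨⟨vis1, ⟨m1, m2, m3, m4⟩, m5⟩, hF1⟩
    have gj : S1.regs .j = u / 2 ^ k := by rw [hF1.1 .j (by decide), k3]
    have gk : S1.regs .k = k := by rw [hF1.1 .k (by decide), hr]
    simp only [runs_set]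
    simp [gj, gk]
    refine ⟨by omega, vis1, ⟨m1.congr (fun r hr hr' => by simp [hr, hr']) rfl,
      (k2.trans m2).congr rfl rfl, (div_two_pow_succ u k).symm, fun k' hk' => ?_⟩, ?_⟩
    · by_cases hkk : k' = k
      · subst hkk; exact m3
      · exact m4 _ _ (k4 k' (by omega))
    · rw [potential_congr (S := S1) (S' := (S1.setReg .j (u / 2 ^ k / 2)).setReg .k (k + 1)) rfl]
      omega
  · rintro S' T ⟨vis', ⟨k1, k2, k3, k4⟩, hT⟩ hr hF
    have gh : S'.regs .h = h := by
      rw [hF.1 .h (by decide), hS0]; simp [hh]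
    simp [gh]
    refine ⟨by omega, vis', ⟨k1.search.congr (by simp) (by simp) rfl rfl rfl rfl,
      k1.tables.congr rfl rfl rfl, k1.marks.congr rfl rfl, k2.congr rfl rfl, fun v => ⟨k1.dist v,
      fun hMv => ?_⟩⟩, ?_⟩
    · obtain ⟨l, r, hlr, hl, hr'⟩ := exists_isRun (n := V.n) (f := M u)
        (by by_contra h0; have := hM.supp _ _ h0; omega)
        (fun b hb => by by_contra h0; have := hM.supp _ _ h0; omega) hMv
      have hRl := hR.complete _ _ _ hlr
      have hR0 : R u l ≠ 0 := by rw [hRl]; omega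
      obtain ⟨k, hk, hent, hblk⟩ := exists_entry (R := R) (a := u) (l := l) (L := V.L) (by
        by_contra hb
        have hz := block_eq hb (a := 0) (by
          rw [Nat.zero_div, Nat.div_eq_of_lt (by have := hV.pow; omega)])
        rw [← hz] at hb
        have := hR.bounds hM.supp hb
        omega) hR0
      exact k1.marks.done k hk _ (k4 k hk) l hent v hl (by rw [hblk, hRl]; exact hr')
    · rw [potential_congr (S := S') (S' := S'.setReg .h (h + 1)) rfl]
      omega

end BFS

end WordRAM

/-! ### Complete searches from all sources -/

namespace WordRAM

open MergeWidth

/-- `D` and `P` are the distances and the parents of a breadth-first search from `s`. -/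
structure IsSearchTree (n s : ℕ) (M : ℕ → ℕ → ℕ) (vis : Finset ℕ) (D P : ℕ → ℕ) : Prop where
  src : s ∈ vis
  range : ∀ p ∈ vis, 1 ≤ p ∧ p ≤ n
  parent : ∀ p ∈ vis, (p = s ∧ D p = 0 ∧ P p = 0) ∨
    (p ≠ s ∧ P p ∈ vis ∧ M (P p) p ≠ 0 ∧ D p = D (P p) + 1)
  closed : ∀ p ∈ vis, ∀ v, M p v ≠ 0 → v ∈ vis ∧ D v ≤ D p + 1
  unvis : ∀ p, 1 ≤ p → p ≤ n → p ∉ vis → D p = n ∧ P p = 0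

/-- The arrays are ready for a search from `s`. -/
structure Fresh (s : ℕ) (S : AState) : Prop where
  full : ∀ k i j, S.arr .full k i j ≠ s
  done : ∀ k i j, S.arr .done k i j ≠ s
  idone : ∀ k i j, S.arr .idone k i j ≠ s
  par : ∀ j, S.arr .par 0 s j = 0

section BFS

variable {V : Env} {S : AState} {vis : Finset ℕ} {s : ℕ} {M R : ℕ → ℕ → ℕ} {n L : ℕ}

theorem clear_runs (hV : V.Good) (hs : S.regs .s = s) (hsn : s ≤ V.n) :
    Runs V clearCmd S fun S' t => (∀ p, 1 ≤ p → p ≤ V.n → S'.arr .dist 0 s p = V.n) ∧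
      t ≤ 3 * V.n + 2 := by
  have hE := hV.E_ge
  have hW := hV.W_ge
  refine runs_loop (N := V.n) (fun i S' c =>
    (∀ p, 1 ≤ p → p ≤ i → S'.arr .dist 0 s p = V.n) ∧ c ≤ 3 * i + 1)
    (by omega) ?_ ?_ ?_ ?_
  · exact ⟨fun p hp hp' => by omega, by omega⟩
  · simp
  · rintro i S' c hi ⟨h1, h2⟩ hr hF
    have gs : S'.regs .s = s := by rw [hF.1 .s (by decide), hs]
    simp [hr, gs]
    refine ⟨by omega, fun p hp hp' => ?_, by omega⟩
    by_cases hpi : p = i + 1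
    · simp [hpi]
    · simp [hpi, h1 p hp (by omega)]
  · rintro S' c ⟨h1, h2⟩ hr hF
    exact ⟨h1, by omega⟩

/-- The source has no parent at a smaller distance, so `visit_runs` does not apply to it. -/
theorem visit_source_runs (hV : V.Good) (hs : S.regs .s = s) (hs1 : 1 ≤ s) (hsn : s ≤ V.n)
    (hp : S.regs .p = s) (he : S.regs .e = 0) (hu : S.regs .u = 0) (htl : S.regs .tl = 0)
    (hfull : ∀ k j, S.arr .full 0 k j ≠ s)
    (hdist : ∀ p, 1 ≤ p → p ≤ V.n → S.arr .dist 0 s p = V.n) (hpar : ∀ p, S.arr .par 0 s p = 0) :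
    Runs V visitCmd S fun S' t => (Search V.n V.L s M {s} S' ∧ S'.arr .q 0 0 0 = s) ∧
      t ≤ 6 * V.L + 8 := by
  have hE := hV.E_ge
  have hW := hV.W_ge
  unfold visitCmd
  simp only [runs_seq, runs_set, runs_st]
  simp [hs, hp, he, hu, htl]
  refine ⟨by omega, by omega, ?_⟩
  have hm := (mark_runs hV (s := s) (vis := ∅)
    (S := (((S.setArr .dist 0 s s 0).setArr .par 0 s s 0).setArr .q 0 0 0 s).setReg .tl 1)
    ?_ (by simpa using hs) (by simpa [hp] using hsn)).frame
  swap
  · intro k _ j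
    refine iff_of_false (by simpa using hfull k j) fun h => ?_
    exact absurd (h (2 ^ k * j) (Nat.mul_div_cancel_left _ (by positivity))) (by simp)
  refine ⟨by omega, hm.mono ?_⟩
  rintro S' t ⟨⟨g1, g2⟩, gF⟩
  simp [hp] at g1
  have gs : S'.regs .s = s := by rw [gF.1 .s (by decide)]; simp [hs]
  have gt : S'.regs .tl = 1 := by rw [gF.1 .tl (by decide)]; simp
  have gd : ∀ z, S'.arr .dist 0 s z = if z = s then 0 else S.arr .dist 0 s z := by
    intro z; rw [gF.2 .dist (by decide)]; simp
  have gp : ∀ z, S'.arr .par 0 s z = 0 := by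
    intro z; rw [gF.2 .par (by decide)]; simp [hpar]
  have gq : S'.arr .q 0 0 0 = s := by rw [gF.2 .q (by decide)]; simp
  refine ⟨⟨⟨gs, ?_, by simpa using gt, ?_, ?_, ?_, ?_, ?_, ?_, g1, by simp⟩, gq⟩, by omega⟩
  · simp [hs1, hsn]
  · simp [gq]
  · simp [gq]
  · intro i j hij hj
    have hj : j < 1 := by simpa using hj
    rw [show i = j by omega]
  · simp [gd]
  · intro p hp hp' hps
    have hps : p ≠ s := by simpa using hps
    rw [gd, if_neg hps, gp]
    exact ⟨hdist p hp hp', rfl⟩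
  · intro p hp
    obtain rfl : p = s := by simpa using hp
    left
    exact ⟨rfl, by simp [gd], gp p⟩

/-- A bound on the potential. -/
def searchBound (V : Env) (K : ℕ) : ℕ := (14 * V.L + 13) * (K + V.n) + 12 * K * V.L

/-- There are at most `K` run intervals and `n` visited positions. On each level the lists are free
of repetitions and belong to different blocks, so their total length is at most the number of
entries, which is at most `2 * K`. -/
theorem potential_le (hM : IsMatrix V.n M) (hR : IsRunTable M R) (hT : Tables V.n V.L R S)
    (hvis : vis.card ≤ V.n) {K : ℕ} (hK : (changes R V.n).card ≤ K) :
    potential V s R vis S ≤ searchBound V K := by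
  have h1 : intervalCount V.n s R S ≤ K := by
    refine le_trans (Finset.sum_le_sum fun x _ => ?_)
      ((Finset.card_eq_sum_ones _).symm.le.trans ((hR.card_runIntervals hM.supp).trans hK))
    split_ifs <;> simp
  have h2 : entryCount V.n V.L s S ≤ 2 * K * V.L := by
    classical
    have hrow : ∀ k ∈ Finset.range V.L,
        (∑ i ∈ Finset.range (V.n + 1), if S.arr .done 0 k i = s then S.arr .cnt 0 k i else 0) ≤
          2 * K := by
      intro k hk
      have hk := Finset.mem_range.1 hk
      choose f hf1 hf2 hf3 using fun i => (hT.list k hk i).card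
      have hle : ∑ i ∈ Finset.range (V.n + 1), (f i).card ≤ (entries R V.n k).card := by
        rw [← Finset.card_sigma]
        refine Finset.card_le_card_of_injOn (fun x => (x.1, x.2)) ?_ ?_
        · rintro ⟨i, l⟩ hx
          obtain ⟨hx1, hx2⟩ := Finset.mem_sigma.1 hx
          have hx3 := Finset.mem_range.1 hx1
          refine Finset.mem_coe.2 (Finset.mem_filter.2 ⟨Finset.mem_product.2 ⟨?_, hf1 i hx2⟩,
            hf2 i l hx2⟩)
          simp only [Finset.mem_range]; dsimp only at hx3; omega
        · rintro ⟨i, l⟩ _ ⟨i', l'⟩ _ heq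
          simp only [Prod.mk.injEq] at heq
          obtain ⟨rfl, rfl⟩ := heq
          rfl
      calc _ ≤ ∑ i ∈ Finset.range (V.n + 1), (f i).card := Finset.sum_le_sum fun i _ => by
            rw [hf3]; split_ifs <;> simp
        _ ≤ (entries R V.n k).card := hle
        _ ≤ 2 * (changes R V.n).card := hR.card_entries hM.supp k
        _ ≤ 2 * K := by omega
    rw [entryCount, Finset.sum_product]
    refine (Finset.sum_le_card_nsmul _ _ _ hrow).trans ?_
    rw [Finset.card_range, smul_eq_mul, mul_comm]
  have h3 := Nat.mul_le_mul_left (14 * V.L + 13) (Nat.add_le_add h1 hvis)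
  unfold potential searchBound
  have h4 : 6 * (2 * K * V.L) = 12 * K * V.L := by ring
  omega

/-- The invariant is the usual one: neighbours of positions before the head are visited with
distance at most one more, and no queued distance exceeds that of the head by more than one. Time is
bounded by the potential plus `7 * L + 7` for each removed position. -/
theorem search_runs (hV : V.Good) (hM : IsMatrix V.n M) (hR : IsRunTable M R)
    (hT : Tables V.n V.L R S) {K : ℕ} (hK : (changes R V.n).card ≤ K) (hs1 : 1 ≤ s)
    (hsn : s ≤ V.n) (hs : S.regs .s = s) (hf : Fresh s S) :
    Runs V searchCmd S fun S' t =>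
      ((∃ vis, IsSearchTree V.n s M vis (S'.arr .dist 0 s) (S'.arr .par 0 s)) ∧
        Tables V.n V.L R S') ∧
      t ≤ searchBound V K + (7 * V.L + 7) * V.n + 3 * V.n + 6 * V.L + 16 := by
  have hE := hV.E_ge
  have hW := hV.W_ge
  unfold searchCmd
  rw [runs_seq]
  refine (clear_runs hV hs hsn).frame.mono ?_
  rintro S1 t1 ⟨⟨h1, ht1⟩, hF1⟩
  have gs1 : S1.regs .s = s := by rw [hF1.1 .s (by decide), hs]
  simp only [runs_seq, runs_set]
  simp [gs1]
  refine ⟨by omega, ?_⟩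
  refine (visit_source_runs hV (M := M) (s := s)
    (S := ((((S1.setReg .p s).setReg .e 0).setReg .u 0).setReg .tl 0)) (by simpa using gs1) hs1
    hsn (by simp) (by simp) (by simp) (by simp)
    (fun k j => by simpa [hF1.2 .full (by decide)] using hf.full 0 k j) h1
    (fun j => by simpa [hF1.2 .par (by decide)] using hf.par j)).frame.mono ?_
  rintro S2 t2 ⟨⟨⟨h2, hq2⟩, ht2⟩, hF2⟩
  have hT2 : Tables V.n V.L R (S2.setReg .h 0) := by
    refine hT.congr ?_ ?_ ?_
    · rw [setReg_arr, hF2.2 .run (by decide)]; exact hF1.2 .run (by decide)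
    · rw [setReg_arr, hF2.2 .cnt (by decide)]; exact hF1.2 .cnt (by decide)
    · rw [setReg_arr, hF2.2 .lst (by decide)]; exact hF1.2 .lst (by decide)
  have hM2 : Marks V.n V.L s R {s} (S2.setReg .h 0) := by
    refine ⟨fun l r _ h => ?_, fun k _ j h => ?_⟩
    · rw [setReg_arr, hF2.2 .idone (by decide)] at h
      simp only [setReg_arr] at h
      rw [hF1.2 .idone (by decide)] at h
      exact absurd h (hf.idone _ _ _)
    · rw [setReg_arr, hF2.2 .done (by decide)] at h
      simp only [setReg_arr] at h
      rw [hF1.2 .done (by decide)] at h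
      exact absurd h (hf.done _ _ _)
  have h2' : Search V.n V.L s M {s} (S2.setReg .h 0) :=
    h2.congr (by simp) (by simp) rfl rfl rfl rfl
  have hs0 : (S2.setReg .h 0).arr .dist 0 s s = 0 := by
    rcases h2'.parent s (by simp) with h | h
    · exact h.2.1
    · exact absurd rfl h.1
  refine ⟨by omega, runs_whl (fun S' c => ∃ vis, (Search V.n V.L s M vis S' ∧ Tables V.n V.L R S' ∧
      Marks V.n V.L s R vis S' ∧ S'.regs .h ≤ vis.card ∧
      (∀ i < S'.regs .h, ∀ v, M (S'.arr .q 0 0 i) v ≠ 0 → v ∈ vis ∧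
        S'.arr .dist 0 s v ≤ S'.arr .dist 0 s (S'.arr .q 0 0 i) + 1) ∧
      (S'.regs .h < vis.card → ∀ p ∈ vis,
        S'.arr .dist 0 s p ≤ S'.arr .dist 0 s (S'.arr .q 0 0 (S'.regs .h)) + 1)) ∧
      c ≤ potential V s R vis S' + (7 * V.L + 7) * S'.regs .h)
    (searchBound V K + (7 * V.L + 7) * V.n) ?_ ?_ ?_ ?_ ?_⟩
  · refine ⟨{s}, ⟨h2', hT2, hM2, by simp, by simp, fun _ p hp => ?_⟩, by omega⟩
    obtain rfl : p = s := by simpa using hp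
    rw [hs0]; omega
  · simp
  · rintro S' c ⟨vis, ⟨k1, k2, k3, k4, k5, k6⟩, k7⟩
    have e1 := k1.card_le
    have e2 := potential_le (s := s) hM hR k2 e1 hK
    have e3 := Nat.mul_le_mul_left (7 * V.L + 7) (k4.trans e1)
    omega
  · rintro S' c ⟨vis, ⟨k1, k2, k3, k4, k5, k6⟩, k7⟩ hF hne
    have hlt : S'.regs .h < vis.card := by
      simpa [k1.tail] using hne
    refine (pop_runs hV hM hR hsn k1 k2 k3 rfl hlt rfl (k6 hlt)).mono ?_
    rintro S3 t3 ⟨vis3, ⟨m1, m2, m3, m4, m5, m6⟩, m7⟩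
    have hsub := Finset.card_le_card m4.subset
    have hold : ∀ i < S'.regs .h + 1, S3.arr .q 0 0 i = S'.arr .q 0 0 i ∧
        S3.arr .dist 0 s (S3.arr .q 0 0 i) = S'.arr .dist 0 s (S'.arr .q 0 0 i) := by
      intro i hi
      have hq := m4.q i (by omega)
      rw [hq]
      exact ⟨rfl, m4.dist _ (k1.q_mem i (by omega))⟩
    refine ⟨vis3, ⟨m1, m2, m3, by omega, ?_, ?_⟩, ?_⟩
    · intro i hi v hv
      rw [m5] at hi
      have hi' := hold i hi
      rw [hi'.1] at hv
      rw [hi'.2]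
      by_cases hih : i < S'.regs .h
      · have := k5 i hih v hv
        exact ⟨m4.subset this.1, by rw [m4.dist v this.1]; exact this.2⟩
      · rw [show i = S'.regs .h by omega] at hv ⊢
        exact ⟨(m6 v).2 hv, (m6 v).1 ((m6 v).2 hv)⟩
    -- The queue is sorted, so the new head is at least as far from the source as the old one.
    · intro hlt' p hp
      have e1 := (m6 p).1 hp
      rw [m5] at hlt' ⊢
      have e2 := m1.mono (S'.regs .h) (S'.regs .h + 1) (by omega) hlt'
      rw [(hold _ (by omega)).2] at e2
      omega
    · rw [m5, mul_add_one]
      omega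
  · rintro S' c ⟨vis, ⟨k1, k2, k3, k4, k5, k6⟩, k7⟩ hF hz
    have hge : vis.card ≤ S'.regs .h := by
      simpa [k1.tail] using hz
    have e1 := k1.card_le
    have e2 := potential_le (s := s) hM hR k2 e1 hK
    have e3 := Nat.mul_le_mul_left (7 * V.L + 7) (k4.trans e1)
    refine ⟨⟨⟨vis, k1.src, k1.range, k1.parent, fun p hp v hv => ?_, k1.unvis⟩, k2⟩, by omega⟩
    obtain ⟨i, hi, rfl⟩ := k1.q_surj p hp
    exact k5 i (by omega) v hv

/-- Marks carry the number of the source, so nothing is cleared between searches: a search from `s`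
writes only the mark `s` and only the row `s` of distances and parents. Later sources find fresh
arrays, and earlier rows remain intact. -/
theorem bfs_runs (hV : V.Good) (hM : IsMatrix V.n M) (hR : IsRunTable M R)
    (hT : Tables V.n V.L R S) {K : ℕ} (hK : (changes R V.n).card ≤ K)
    (hf : ∀ s, 1 ≤ s → s ≤ V.n → Fresh s S) :
    Runs V bfsCmd S fun S' t =>
      (∀ s, 1 ≤ s → s ≤ V.n →
        ∃ vis, IsSearchTree V.n s M vis (S'.arr .dist 0 s) (S'.arr .par 0 s)) ∧
      t ≤ (searchBound V K + (7 * V.L + 7) * V.n + 3 * V.n + 6 * V.L + 19) * V.n + 2 := by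
  have hE := hV.E_ge
  have hW := hV.W_ge
  set B := searchBound V K + (7 * V.L + 7) * V.n + 3 * V.n + 6 * V.L + 16 with hB
  refine runs_loop (N := V.n) (fun t S' c => (Tables V.n V.L R S' ∧
    (∀ s, 1 ≤ s → s ≤ t →
        ∃ vis, IsSearchTree V.n s M vis (S'.arr .dist 0 s) (S'.arr .par 0 s)) ∧
    ∀ s, t < s → s ≤ V.n → Fresh s S') ∧ c ≤ (B + 3) * t + 1) (by omega) ?_ ?_ ?_ ?_
  · refine ⟨⟨hT.congr rfl rfl rfl, fun s hs hs' => by omega, fun s hs hs' => ?_⟩, by omega⟩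
    have := hf s hs hs'
    exact ⟨this.1, this.2, this.3, this.4⟩
  · simp
  · rintro t S1 c ht ⟨⟨h1, h2, h3⟩, h4⟩ hr hF
    rw [runs_seq, runs_set]
    refine ⟨by simp [hr]; omega, ?_⟩
    simp only [aeval_add, aeval_r, aeval_ofNat, hr]
    have hf' := h3 (t + 1) (by omega) (by omega)
    obtain ⟨τ, S2, hx, ⟨h5, h6⟩, h7⟩ := search_runs hV hM hR (s := t + 1)
      (S := S1.setReg .s (t + 1)) (h1.congr rfl rfl rfl) hK (by omega) (by omega) (by simp)
      ⟨hf'.1, hf'.2, hf'.3, hf'.4⟩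
    have hfr := hx.frame
    have hsf := hx.searchFrame
    simp only [setReg_regs, if_true] at hsf
    refine ⟨τ, S2, hx, ?_, ⟨h6.congr rfl rfl rfl, fun s hs hs' => ?_, fun s hs hs' => ?_⟩, ?_⟩
    · rw [hfr.1 .t (by decide)]; simp [hr]
    · by_cases hst : s = t + 1
      · subst hst; exact h5
      · obtain ⟨vis, hv⟩ := h2 s hs (by omega)
        refine ⟨vis, ?_⟩
        have e1 : S2.arr .dist 0 s = S1.arr .dist 0 s := funext fun j =>
          (hsf.dist 0 s j).resolve_right hst
        have e2 : S2.arr .par 0 s = S1.arr .par 0 s := funext fun j =>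
          (hsf.par 0 s j).resolve_right hst
        change IsSearchTree V.n s M vis (S2.arr .dist 0 s) (S2.arr .par 0 s)
        rw [e1, e2]; exact hv
    · have hfs := h3 s (by omega) hs'
      refine ⟨fun k i j => ?_, fun k i j => ?_, fun k i j => ?_, fun j => ?_⟩
      · rcases hsf.full k i j with h | h
        · rw [setReg_arr, h]; exact hfs.full k i j
        · rw [setReg_arr, h]; omega
      · rcases hsf.done k i j with h | h
        · rw [setReg_arr, h]; exact hfs.done k i j
        · rw [setReg_arr, h]; omega
      · rcases hsf.idone k i j with h | h
        · rw [setReg_arr, h]; exact hfs.idone k i j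
        · rw [setReg_arr, h]; omega
      · rcases hsf.par 0 s j with h | h
        · rw [setReg_arr, h]; exact hfs.par j
        · omega
    · rw [mul_add_one]; omega
  · rintro S' c ⟨⟨h1, h2, h3⟩, h4⟩ hr hF
    exact ⟨h2, by
      rw [show searchBound V K + (7 * V.L + 7) * V.n + 3 * V.n + 6 * V.L + 19 = B + 3 by omega]
      omega⟩

end BFS

end WordRAM

/-! ### Output and assembly of the phases -/

namespace WordRAM

open MergeWidth

/-- Write the distances and the parents to the output area. -/
def outputCmd : Cmd :=
  .loop .x .n (.loop .y .n
    (.put (.r .x * .n + .r .y) (.ld2 .dist (.ld1 .start (.r .x)) (.ld1 .start (.r .y))) ;;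
     .put (.n * .n + (.r .x * .n + .r .y))
      (.ld1 .ord (.ld2 .par (.ld1 .start (.r .x)) (.ld1 .start (.r .y))))))

/-- All-Pairs Shortest Path. -/
def mainCmd : Cmd :=
  initCmd ;; forwardCmd ;; startCmd ;; backwardCmd ;; matCmd ;; runsCmd ;; levelsCmd ;; bfsCmd ;;
    outputCmd

/-- `D` and `P` are the distances and the parents of a shortest-path tree rooted at `x` of the graph
on `0, …, n - 1` with the adjacency matrix `A`, where `n` stands for a value that does not exist. -/
structure IsTreeOutput (n x : ℕ) (A : ℕ → ℕ → ℕ) (vis : Set ℕ) (D P : ℕ → ℕ) : Prop where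
  src : x ∈ vis
  parent : ∀ y < n, y ∈ vis → (y = x ∧ D y = 0 ∧ P y = n) ∨
    (y ≠ x ∧ P y < n ∧ P y ∈ vis ∧ A (P y) y ≠ 0 ∧ D y = D (P y) + 1)
  closed : ∀ y < n, y ∈ vis → ∀ z < n, A y z ≠ 0 → z ∈ vis ∧ D z ≤ D y + 1
  unvis : ∀ y < n, y ∉ vis → D y = n ∧ P y = n

section Output

variable {V : Env} {S : AState} {c : Script}

theorem mul_add_injective {n x y x' y' : ℕ} (hy : y < n) (hy' : y' < n)
    (h : x * n + y = x' * n + y') : x = x' ∧ y = y' := by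
  have h1 : (x * n + y) / n = x := by
    rw [mul_comm, Nat.mul_add_div (by omega), Nat.div_eq_of_lt hy, add_zero]
  have h2 : (x' * n + y') / n = x' := by
    rw [mul_comm, Nat.mul_add_div (by omega), Nat.div_eq_of_lt hy', add_zero]
  have h3 : x = x' := by rw [← h1, ← h2, h]
  subst h3
  exact ⟨rfl, by omega⟩

theorem mul_add_lt_sq {n x y : ℕ} (hx : x < n) (hy : y < n) : x * n + y < n * n := by
  have : (x + 1) * n ≤ n * n := Nat.mul_le_mul_right _ hx
  rw [add_mul, one_mul] at this
  omega

theorem output_runs (hV : V.Good)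
    (h1 : ∀ x < V.n, S.arr .start 0 0 x ≤ V.n)
    (h2 : ∀ x < V.n, ∀ y < V.n,
      S.arr .par 0 (S.arr .start 0 0 x) (S.arr .start 0 0 y) ≤ V.n) :
    Runs V outputCmd S fun S' t =>
      (∀ x < V.n, ∀ y < V.n,
        S'.out (x * V.n + y) = S.arr .dist 0 (S.arr .start 0 0 x) (S.arr .start 0 0 y) ∧
        S'.out (V.n * V.n + (x * V.n + y)) =
          S.arr .ord 0 0 (S.arr .par 0 (S.arr .start 0 0 x) (S.arr .start 0 0 y))) ∧
      t ≤ (4 * V.n + 4) * V.n + 2 := by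
  have hE := hV.E_ge
  have hW := hV.W_ge
  have hEE : 2 * (V.n * V.n) ≤ V.E * V.E := by nlinarith
  have hEW : V.E * V.E < V.W := by
    have := hV.W_gt
    have h3 : 17 * (V.E * V.E) * 1 ≤ 17 * (V.E * V.E) * V.E := Nat.mul_le_mul_left _ (by omega)
    nlinarith
  refine runs_loop (N := V.n) (fun i S' T => (∀ x < i, ∀ y < V.n,
        S'.out (x * V.n + y) = S.arr .dist 0 (S.arr .start 0 0 x) (S.arr .start 0 0 y) ∧
        S'.out (V.n * V.n + (x * V.n + y)) =
          S.arr .ord 0 0 (S.arr .par 0 (S.arr .start 0 0 x) (S.arr .start 0 0 y))) ∧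
      T ≤ (4 * V.n + 4) * i + 1) (by omega) ?_ ?_ ?_ ?_
  · exact ⟨fun x hx => by omega, by omega⟩
  · simp
  · rintro i S1 T hi ⟨k1, k2⟩ hr hF
    have hin : Runs V (.loop .y .n
        (.put (.r .x * .n + .r .y) (.ld2 .dist (.ld1 .start (.r .x)) (.ld1 .start (.r .y))) ;;
         .put (.n * .n + (.r .x * .n + .r .y))
          (.ld1 .ord (.ld2 .par (.ld1 .start (.r .x)) (.ld1 .start (.r .y)))))) S1 fun S' t =>
        (S'.regs .x = i ∧ ∀ x < i + 1, ∀ y < V.n,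
          S'.out (x * V.n + y) = S.arr .dist 0 (S.arr .start 0 0 x) (S.arr .start 0 0 y) ∧
          S'.out (V.n * V.n + (x * V.n + y)) =
            S.arr .ord 0 0 (S.arr .par 0 (S.arr .start 0 0 x) (S.arr .start 0 0 y))) ∧
        t ≤ 4 * V.n + 2 := by
      refine runs_loop (N := V.n) (fun j S' T => (∀ x, ∀ y < V.n, (x < i ∨ (x = i ∧ y < j)) →
          S'.out (x * V.n + y) = S.arr .dist 0 (S.arr .start 0 0 x) (S.arr .start 0 0 y) ∧
          S'.out (V.n * V.n + (x * V.n + y)) =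
            S.arr .ord 0 0 (S.arr .par 0 (S.arr .start 0 0 x) (S.arr .start 0 0 y))) ∧
        T ≤ 4 * j + 1) (by omega) ?_ ?_ ?_ ?_
      · exact ⟨fun x y hy hxy => k1 x (by omega) y hy, by omega⟩
      · simp
      · rintro j S2 T2 hj ⟨m1, m2⟩ hr2 hF2
        have gx : S2.regs .x = i := by rw [hF2.1 .x (by decide), hr]
        have ga : S2.arr = S.arr := by
          funext x
          rw [hF2.2 x (by cases x <;> decide), hF.2 x (by cases x <;> decide)]
        have b1 := h1 i hi
        have b2 := h1 j hj
        have b3 := h2 i hi j hj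
        have b4 := mul_add_lt_sq hi hj
        simp only [runs_seq, runs_put]
        simp [gx, hr2, ga]
        refine ⟨by omega, by omega, fun x y hy hxy => ⟨?_, ?_⟩, by omega⟩
        · have hne : x * V.n + y ≠ V.n * V.n + (i * V.n + j) := by
            have := mul_add_lt_sq (x := x) (by omega) hy
            omega
          rw [if_neg hne]
          by_cases heq : x * V.n + y = i * V.n + j
          · obtain ⟨rfl, rfl⟩ := mul_add_injective hy hj heq
            rw [if_pos rfl]
          · rw [if_neg heq]
            refine (m1 x y hy ?_).1
            rcases hxy with h | ⟨rfl, h⟩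
            · exact Or.inl h
            · exact Or.inr ⟨rfl, by omega⟩
        · by_cases heq : x * V.n + y = i * V.n + j
          · obtain ⟨rfl, rfl⟩ := mul_add_injective hy hj heq
            rw [if_pos rfl]
          · rw [if_neg heq, if_neg (by omega)]
            refine (m1 x y hy ?_).2
            rcases hxy with h | ⟨rfl, h⟩
            · exact Or.inl h
            · exact Or.inr ⟨rfl, by omega⟩
      · rintro S2 T2 ⟨m1, m2⟩ hr2 hF2
        exact ⟨⟨by rw [hF2.1 .x (by decide), hr], fun x hx y hy => m1 x y hy (by omega)⟩, by omega⟩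
    refine hin.mono ?_
    rintro S3 t3 ⟨⟨q1, q2⟩, q3⟩
    exact ⟨q1, q2, by rw [mul_add_one]; omega⟩
  · rintro S' T ⟨k1, k2⟩ hr hF
    exact ⟨k1, by omega⟩

/-- The running time of the abstract algorithm. -/
def timeBound (V : Env) (K : ℕ) : ℕ :=
  (4 * V.n + 2) + (10 * V.m + (4 * V.n + 10) * V.n + 2) + (6 * V.n + 3) +
    (10 * V.m + (6 * V.n + 10) * V.n + 2) + ((3 * V.n + 5) * V.n + 3) +
    ((6 * V.n + 11) * (V.n + 1) + 2) + (((11 * (V.n + 1) + 4) * (V.n + 3) + 4) * V.L + 2) +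
    ((searchBound V K + (7 * V.L + 7) * V.n + 3 * V.n + 6 * V.L + 19) * V.n + 2) +
    ((4 * V.n + 4) * V.n + 2)

theorem main_runs (hV : V.Good) (hc : c.Valid) (hn : V.n = c.n) (hm : V.m = c.m) {d : ℕ}
    (hd : ∀ t ≤ c.m, ∀ x < c.n, (c.ball t x).card ≤ d)
    (hin : ∀ t < c.m, S.arr .inp 0 0 (3 * t + 2) = c.op t ∧ S.arr .inp 0 0 (3 * t + 3) = c.a t ∧
      S.arr .inp 0 0 (3 * t + 4) = c.b t)
    (hzero : ∀ x, x ≠ Arr.inp → ∀ k i j, S.arr x k i j = 0) :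
    Runs V mainCmd S fun S' t => (∀ x < c.n, ∃ vis, IsTreeOutput c.n x c.adj vis
      (fun y => S'.out (x * c.n + y)) fun y => S'.out (c.n * c.n + (x * c.n + y))) ∧
      t ≤ timeBound V (16 * d * (c.n + 1)) := by
  unfold mainCmd
  rw [runs_seq]
  refine (init_runs hV).frame.mono ?_
  rintro S1 t1 ⟨⟨h1, ht1⟩, hF1⟩
  rw [runs_seq]
  refine (forward_runs hV hc hn hm (hn ▸ h1)
    (by rw [hF1.2 .inp (by decide)]; exact hin)).frame.mono ?_
  rintro S2 t2 ⟨⟨h2, h2', ht2⟩, hF2⟩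
  rw [runs_seq]
  refine (start_runs hV hc hn h2).frame.mono ?_
  rintro S3 t3 ⟨⟨h3, ht3⟩, hF3⟩
  rw [runs_seq]
  refine (backward_runs hV hc hn hm (by
      rw [hF3.2 .size (by decide)]; exact fun x hx => (h2 x hx).2) h3
    (by rw [hF3.2 .inp (by decide)]; exact h2')
    (by rw [hF3.2 .val (by decide), hF2.2 .val (by decide), hF1.2 .val (by decide)]
        exact hzero _ (by decide) 0)).frame.mono ?_
  rintro S4 t4 ⟨⟨h4, h4', ht4⟩, hF4⟩
  have z4 : ∀ x, x ∉ initCmd.arrMod → x ∉ forwardCmd.arrMod → x ∉ startCmd.arrMod →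
      x ∉ backwardCmd.arrMod → x ≠ .inp → ∀ k i j, S4.arr x k i j = 0 := by
    intro x x1 x2 x3 x4 x5
    rw [hF4.2 x x4, hF3.2 x x3, hF2.2 x x2, hF1.2 x x1]
    exact hzero x x5
  rw [runs_seq]
  refine (mat_runs hV hc hn h4' h4
    (z4 _ (by decide) (by decide) (by decide) (by decide) (by decide) 0)).frame.mono ?_
  rintro S5 t5 ⟨⟨h5, h5', h5'', ht5⟩, hF5⟩
  have hM : IsMatrix V.n c.mat := by
    refine ⟨c.mat_le_one, fun a b hab => ?_⟩
    unfold Script.mat at hab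
    split_ifs at hab with h
    · rw [hn]; exact h
    · exact absurd rfl hab
  rw [runs_seq]
  refine (runs_runs hV hM h5 (by
    rw [hF5.2 .run (by decide)]
    exact z4 _ (by decide) (by decide) (by decide) (by decide) (by decide))).frame.mono ?_
  rintro S6 t6 ⟨⟨h6, h6', ht6⟩, hF6⟩
  rw [runs_seq]
  have hRV : RunsVanish V.n (S6.arr .run 0) := by
    intro a l hal
    have := h6.bounds hM.supp hal
    omega
  refine (levels_runs hV hRV (fun k i l => by
      split_ifs with h
      · rw [h]
      · exact h6' k i l h) (by
    rw [hF6.2 .cnt (by decide), hF5.2 .cnt (by decide)]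
    exact z4 _ (by decide) (by decide) (by decide) (by decide) (by decide) 0)).frame.mono ?_
  rintro S7 t7 ⟨⟨h7, h7', ht7⟩, hF7⟩
  have z7 : ∀ x, x ∉ initCmd.arrMod → x ∉ forwardCmd.arrMod → x ∉ startCmd.arrMod →
      x ∉ backwardCmd.arrMod → x ∉ matCmd.arrMod → x ∉ runsCmd.arrMod → x ∉ levelsCmd.arrMod →
      x ≠ .inp → ∀ k i j, S7.arr x k i j = 0 := by
    intro x x1 x2 x3 x4 x5 x6 x7 x8
    rw [hF7.2 x x7, hF6.2 x x6, hF5.2 x x5]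
    exact z4 x x1 x2 x3 x4 x8
  -- At most two changes are charged to each of the at most `8 * d * (n + 1)` corners.
  have hK : (changes (S6.arr .run 0) V.n).card ≤ 16 * d * (c.n + 1) := by
    have e1 := h6.card_changes hM.le_one hM.supp
    have e2 := hc.card_corners hd
    rw [← hn] at e2 ⊢
    calc _ ≤ 2 * (Script.corners c.mat V.n).card := e1
      _ ≤ 2 * (8 * d * (V.n + 1)) := Nat.mul_le_mul_left _ e2
      _ = _ := by ring
  rw [runs_seq]
  refine (bfs_runs hV hM h6 ⟨h7, h7'⟩ hK (fun s hs _ => ⟨?_, ?_, ?_, ?_⟩)).frame.mono ?_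
  iterate 3
    · intro k i j
      rw [z7 _ (by decide) (by decide) (by decide) (by decide) (by decide) (by decide) (by decide)
        (by decide)]
      omega
  · intro j
    exact z7 _ (by decide) (by decide) (by decide) (by decide) (by decide) (by decide) (by decide)
        (by decide) _ _ _
  rintro S8 t8 ⟨⟨h8, ht8⟩, hF8⟩
  have hst : ∀ x < c.n, S8.arr .start 0 0 x = c.pos x := by
    rw [hF8.2 .start (by decide), hF7.2 .start (by decide), hF6.2 .start (by decide),
      hF5.2 .start (by decide)]
    exact h4'
  have hord : S8.arr .ord = S5.arr .ord := by
    rw [hF8.2 .ord (by decide), hF7.2 .ord (by decide), hF6.2 .ord (by decide)]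
  have hpar : ∀ x < c.n, ∀ y < c.n, S8.arr .par 0 (c.pos x) (c.pos y) ≤ c.n := by
    intro x hx y hy
    obtain ⟨e1, e2⟩ := hc.pos_bounds hx
    obtain ⟨e3, e4⟩ := hc.pos_bounds hy
    obtain ⟨vis, hvis⟩ := h8 (c.pos x) e1 (by omega)
    by_cases hm : c.pos y ∈ vis
    · rcases hvis.parent _ hm with h | h
      · omega
      · have := hvis.range _ h.2.1; omega
    · have := (hvis.unvis _ e3 (by omega) hm).2; omega
  refine (output_runs hV (by
      intro x hx
      rw [hst x (by omega)]
      have := hc.pos_bounds (x := x) (by omega)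
      omega) (by
      intro x hx y hy
      rw [hst x (by omega), hst y (by omega), hn]
      exact hpar x (by omega) y (by omega))).mono ?_
  rintro S9 t9 ⟨h9, ht9⟩
  rw [hn] at h9
  refine ⟨fun x hx => ?_, by unfold timeBound; rw [hn, hm] at *; omega⟩
  obtain ⟨e1, e2⟩ := hc.pos_bounds hx
  obtain ⟨vis, hvis⟩ := h8 (c.pos x) e1 (by omega)
  have hD : ∀ y < c.n, S9.out (x * c.n + y) = S8.arr .dist 0 (c.pos x) (c.pos y) := by
    intro y hy
    rw [(h9 x hx y hy).1, hst x hx, hst y hy]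
  have hP : ∀ y < c.n, S9.out (c.n * c.n + (x * c.n + y)) =
      S5.arr .ord 0 0 (S8.arr .par 0 (c.pos x) (c.pos y)) := by
    intro y hy
    rw [(h9 x hx y hy).2, hst x hx, hst y hy, hord]
  refine ⟨{y | c.pos y ∈ vis}, hvis.src, fun y hy hyv => ?_, fun y hy hyv z hz hyz => ?_,
    fun y hy hyv => ?_⟩
  · rw [hP y hy, hD y hy]
    rcases hvis.parent _ hyv with ⟨f1, f2, f3⟩ | ⟨f1, f2, f3, f4⟩
    · left
      rw [f3, h5']
      exact ⟨hc.pos_injOn hy hx f1, f2, rfl⟩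
    · right
      have hr := hvis.range _ f2
      obtain ⟨g1, g2⟩ := hc.ord_spec hr.1 (by omega)
      rw [h5'' _ hr.1 (by omega)]
      rw [hD _ g1, Set.mem_ofPred_eq, g2]
      refine ⟨fun h => f1 (h ▸ rfl), g1, f2, ?_, f4⟩
      rw [← hc.mat_pos g1 hy, g2]
      exact f3
  · rw [hD y hy, hD z hz]
    rw [← hc.mat_pos hy hz] at hyz
    exact hvis.closed _ hyv _ hyz
  · obtain ⟨e3, e4⟩ := hc.pos_bounds hy
    obtain ⟨f1, f2⟩ := hvis.unvis _ e3 (by omega) hyv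
    rw [hD y hy, hP y hy, f2, h5', f1, hn]
    exact ⟨rfl, rfl⟩

end Output

end WordRAM

/-! ### The output certifies distances and shortest-path trees -/

namespace WordRAM

section Certificate

variable {n : ℕ} {G : SimpleGraph (Fin n)} {A : ℕ → ℕ → ℕ} {u : Fin n} {vis : Set ℕ} {D P : ℕ → ℕ}

/-- Going to the parent lowers `D` by one, and only the source has value `0`; the parents thus trace
a walk of length `D v`. -/
theorem IsTreeOutput.exists_walk (hA : ∀ u v : Fin n, G.Adj u v ↔ u ≠ v ∧ A u v ≠ 0)
    (h : IsTreeOutput n u A vis D P) (k : ℕ) (v : Fin n) (hv : (v : ℕ) ∈ vis) (hk : D v = k) :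
    ∃ p : G.Walk u v, p.length = k := by
  induction k generalizing v with
  | zero =>
    rcases h.parent v v.2 hv with ⟨h1, _⟩ | ⟨_, _, _, _, h5⟩
    · obtain rfl := Fin.ext h1
      exact ⟨.nil, rfl⟩
    · omega
  | succ k ih =>
    rcases h.parent v v.2 hv with ⟨_, h2, _⟩ | ⟨_, h2, h3, h4, h5⟩
    · omega
    · obtain ⟨p, hp⟩ := ih ⟨P v, h2⟩ h3 (by dsimp only; omega)
      have hadj : G.Adj ⟨P v, h2⟩ v := by
        -- The diagonal of `A` may be nonzero, but no vertex is its own parent, since `D` differs by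
        -- one between parent and child.
        refine (hA _ _).2 ⟨fun he => ?_, h4⟩
        have : P v = v := congrArg Fin.val he
        rw [this] at h5
        omega
      exact ⟨p.concat hadj, by rw [SimpleGraph.Walk.length_concat, hp]⟩

/-- By `closed`, each edge of a walk stays among the visited vertices and raises `D` by at most one.
With `exists_walk` this gives both bounds for the distance. -/
theorem IsTreeOutput.le_length (hA : ∀ u v : Fin n, G.Adj u v ↔ u ≠ v ∧ A u v ≠ 0)
    (h : IsTreeOutput n u A vis D P) {a v : Fin n} (p : G.Walk a v) (ha : (a : ℕ) ∈ vis) :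
    (v : ℕ) ∈ vis ∧ D v ≤ D a + p.length := by
  induction p with
  | nil => exact ⟨ha, by simp⟩
  | @cons a b v hab p ih =>
    obtain ⟨h1, h2⟩ := h.closed a a.2 ha b b.2 ((hA a b).1 hab).2
    obtain ⟨h3, h4⟩ := ih h1
    exact ⟨h3, by rw [SimpleGraph.Walk.length_cons]; omega⟩

theorem IsTreeOutput.mem_iff (hA : ∀ u v : Fin n, G.Adj u v ↔ u ≠ v ∧ A u v ≠ 0)
    (h : IsTreeOutput n u A vis D P) (v : Fin n) : (v : ℕ) ∈ vis ↔ G.Reachable u v :=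
  ⟨fun hv => ⟨(h.exists_walk hA _ v hv rfl).choose⟩, fun ⟨p⟩ => (h.le_length hA p h.src).1⟩

theorem IsTreeOutput.dist_eq (hA : ∀ u v : Fin n, G.Adj u v ↔ u ≠ v ∧ A u v ≠ 0)
    (h : IsTreeOutput n u A vis D P) {v : Fin n} (hv : (v : ℕ) ∈ vis) : D v = G.dist u v := by
  obtain ⟨p, hp⟩ := h.exists_walk hA _ v hv rfl
  obtain ⟨q, hq⟩ := SimpleGraph.Reachable.exists_walk_length_eq_dist ⟨p⟩
  have h1 := (h.le_length hA q h.src).2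
  have h2 := SimpleGraph.dist_le p
  have h3 : D u = 0 := by
    rcases h.parent u u.2 h.src with h | h
    · exact h.2.1
    · exact absurd rfl h.1
  omega

theorem solvesAPSP_of_isTreeOutput (hA : ∀ u v : Fin n, G.Adj u v ↔ u ≠ v ∧ A u v ≠ 0) {τ : State}
    (h : ∀ x < n, ∃ vis, IsTreeOutput n x A vis (fun y => τ.mem (τ.regs 0 + x * n + y))
      fun y => τ.mem (τ.regs 1 + x * n + y)) : τ.SolvesAPSP G := by
  intro u v
  obtain ⟨vis, hv⟩ := h u u.2
  have hmem := hv.mem_iff hA v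
  refine ⟨fun hr => hv.dist_eq hA (hmem.2 hr), fun hr => (hv.unvis v v.2 (mt hmem.1 hr)).1,
    fun hr hne => ?_, fun hr => ?_⟩
  · rcases hv.parent v v.2 (hmem.2 hr) with h1 | ⟨h1, h2, h3, h4, h5⟩
    · exact absurd (Fin.ext h1.1).symm hne
    · have h6 := hv.dist_eq hA (v := ⟨_, h2⟩) h3
      have h7 := hv.dist_eq hA (hmem.2 hr)
      dsimp only at h5 h6 h7
      refine ⟨⟨_, h2⟩, rfl, (hA _ _).2 ⟨fun he => ?_, h4⟩, (hv.mem_iff hA _).1 h3, by omega⟩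
      have he' : τ.mem (τ.regs 1 + u * n + v) = v := congrArg Fin.val he
      rw [he'] at h5
      omega
  · by_cases hvis : (v : ℕ) ∈ vis
    · rcases hr with rfl | hr
      · rcases hv.parent u u.2 hvis with h1 | h1
        · exact h1.2.2
        · exact absurd rfl h1.1
      · exact absurd (hmem.1 hvis) hr
    · exact (hv.unvis v v.2 hvis).2

end Certificate

end WordRAM

/-! ### From construction sequences to scripts -/

namespace MergeWidth

/-- The three words that encode an instruction. -/
def Instr.word {n : ℕ} : Instr (Fin n) → ℕ → ℕ
  | i, k => i.encode.getD k 0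

section

variable {V : Type*} [DecidableEq V]

theorem Stage.card_le_ballParts {ι : Type*} {s : Stage V} {r : ℕ} {v : V} {I : Finset ι}
    (f : ι → Finset V)
    (hf : ∀ i ∈ I, f i ∈ s.parts ∧ ∃ u ∈ f i, s.resolvedGraph.edist v u ≤ r)
    (hinj : Set.InjOn f I) : I.card ≤ s.ballParts r v :=
  Finset.card_le_card_of_injOn f (fun i hi => Finset.mem_coe.2 (Finset.mem_filter.2 (hf i hi))) hinj

theorem Stage.ballParts_le (s : Stage V) (r : ℕ) (v : V) : s.ballParts r v ≤ s.parts.card :=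
  Finset.card_filter_le _ _

theorem ConstructionSequence.ballParts_le_width [Fintype V] (S : ConstructionSequence V) (r : ℕ)
    (i : Fin (S.numInstr + 1)) (v : V) : (S.stage i).ballParts r v ≤ S.width r :=
  (Finset.le_sup (f := fun v => (S.stage i).ballParts r v) (Finset.mem_univ v)).trans
    (Finset.le_sup (f := fun i => Finset.univ.sup fun v => (S.stage i).ballParts r v)
      (Finset.mem_univ i))

end

namespace ConstructionSequence

variable {n : ℕ} (S : ConstructionSequence (Fin n))

/-- The word `k` of the instruction `t`. -/
def word (k t : ℕ) : ℕ := if h : t < S.numInstr then (S.instr ⟨t, h⟩).word k else 0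

/-- The instructions of a construction sequence. -/
def script : Script := ⟨n, S.numInstr, S.word 0, S.word 1, S.word 2⟩

theorem word_eq (k : ℕ) {t : ℕ} (h : t < S.numInstr) : S.word k t = (S.instr ⟨t, h⟩).word k :=
  dif_pos h

/-- The vertices with the same representative as `v`. -/
def fibre (t : ℕ) (v : Fin n) : Finset (Fin n) :=
  Finset.univ.filter fun u => S.script.rep t u = S.script.rep t v

variable {S}

theorem mem_fibre {t : ℕ} {u v : Fin n} :
    u ∈ S.fibre t v ↔ S.script.rep t u = S.script.rep t v := by
  simp [fibre]

theorem fibre_eq_iff {t : ℕ} {u v : Fin n} :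
    S.fibre t u = S.fibre t v ↔ S.script.rep t u = S.script.rep t v := by
  refine ⟨fun h => mem_fibre.1 (h ▸ mem_fibre.2 rfl), fun h => ?_⟩
  ext x
  rw [mem_fibre, mem_fibre, h]

theorem mem_pairsBetween {A B : Finset (Fin n)} {x y : Fin n} :
    s(x, y) ∈ pairsBetween A B ↔ x ≠ y ∧ ((x ∈ A ∧ y ∈ B) ∨ (y ∈ A ∧ x ∈ B)) := by
  simp only [pairsBetween, Finset.mem_image, Finset.mem_filter, Finset.mem_product, Prod.exists,
    Sym2.eq_iff]
  constructor
  · rintro ⟨a, b, ⟨⟨h1, h2⟩, h3⟩, ⟨rfl, rfl⟩ | ⟨rfl, rfl⟩⟩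
    · exact ⟨h3, Or.inl ⟨h1, h2⟩⟩
    · exact ⟨Ne.symm h3, Or.inr ⟨h1, h2⟩⟩
  · rintro ⟨h, ⟨h1, h2⟩ | ⟨h1, h2⟩⟩
    · exact ⟨x, y, ⟨⟨h1, h2⟩, h⟩, Or.inl ⟨rfl, rfl⟩⟩
    · exact ⟨y, x, ⟨⟨h1, h2⟩, h.symm⟩, Or.inr ⟨rfl, rfl⟩⟩

variable (S) in
/-- The script describes the stage `t`. -/
structure StageSpec (t : ℕ) (s : Stage (Fin n)) : Prop where
  parts : ∀ A, A ∈ s.parts ↔ ∃ v, A = S.fibre t v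
  resolved : ∀ x y : Fin n, x ≠ y → (s(x, y) ∈ s.E ∨ s(x, y) ∈ s.N ↔ S.script.Cov t x y)
  -- The value `adj` is what the past has decided or else what the future will decide. At stage `0`
  -- nothing is in `E`; at the last stage `fut 0` is `0`, so `E` is the edge set given by `adj`.
  edge : ∀ x y : Fin n, x ≠ y → ((s(x, y) ∈ s.E ∨
    (¬ S.script.Cov t x y ∧ S.script.fut (S.numInstr - t) x y = 1)) ↔ S.script.adj x y = 1)

theorem stageSpec_zero : S.StageSpec 0 (S.stage 0) := by
  rw [S.stage_zero]
  refine ⟨fun A => ?_, fun x y _ => ?_, fun x y _ => ?_⟩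
  · simp only [Stage.initial, Finset.mem_image, Finset.mem_univ, true_and]
    refine exists_congr fun v => ?_
    have : S.fibre 0 v = {v} := by
      ext u
      rw [mem_fibre, Finset.mem_singleton]
      exact Fin.val_inj
    rw [this, eq_comm]
  · simp [Stage.initial, Script.Cov]
  · have : S.script.adj x y = S.script.fut (S.numInstr - 0) x y := rfl
    rw [this]
    simp [Stage.initial, Script.Cov]

theorem StageSpec.eq_fibre {t : ℕ} {s : Stage (Fin n)} (h : S.StageSpec t s) {A : Finset (Fin n)}
    (hA : A ∈ s.parts) {u : Fin n} (hu : u ∈ A) : A = S.fibre t u := by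
  obtain ⟨v, rfl⟩ := (h.parts A).1 hA
  exact fibre_eq_iff.2 (mem_fibre.1 hu).symm

theorem cov_succ {c : Script} {t x y : ℕ} :
    c.Cov (t + 1) x y ↔ c.Cov t x y ∨ (c.op t ≠ 0 ∧ c.Covers t x y) := by
  constructor
  · rintro ⟨i, hi, h⟩
    by_cases hit : i = t
    · subst hit; exact Or.inr h
    · exact Or.inl ⟨i, by omega, h⟩
  · rintro (⟨i, hi, h⟩ | h)
    · exact ⟨i, by omega, h⟩
    · exact ⟨t, by omega, h⟩

/-- The parts named by the instruction `t`. -/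
theorem mem_fibre_pair {t : ℕ} {u v x y : Fin n} (ha : S.script.a t = u) (hb : S.script.b t = v) :
    S.script.Covers t x y ↔
      (x ∈ S.fibre t u ∧ y ∈ S.fibre t v) ∨ (y ∈ S.fibre t u ∧ x ∈ S.fibre t v) := by
  simp only [Script.Covers, Script.ra, Script.rb, ha, hb, mem_fibre]
  tauto

theorem op_eq {t : ℕ} (ht : t < S.numInstr) {i : Instr (Fin n)} (hi : S.instr ⟨t, ht⟩ = i) :
    S.script.op t = i.word 0 ∧ S.script.a t = i.word 1 ∧ S.script.b t = i.word 2 := by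
  subst hi
  exact ⟨S.word_eq 0 ht, S.word_eq 1 ht, S.word_eq 2 ht⟩

theorem fibre_succ_of_ne {t : ℕ} (h : S.script.op t ≠ 0) (v : Fin n) :
    S.fibre (t + 1) v = S.fibre t v := by
  ext x
  rw [mem_fibre, mem_fibre, Script.rep_succ_of_ne _ h, Script.rep_succ_of_ne _ h]

/-- A merge resolves no pair, so `Cov` and `fut` keep their values; only the fibres of `u` and `v`
are united. -/
theorem StageSpec.merge {t : ℕ} (ht : t < S.numInstr) {s : Stage (Fin n)} (h : S.StageSpec t s)
    {u v : Fin n} (hi : S.instr ⟨t, ht⟩ = .merge u v) (hne : S.fibre t u ≠ S.fibre t v) :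
    S.StageSpec (t + 1)
      ⟨insert (S.fibre t u ∪ S.fibre t v) ((s.parts.erase (S.fibre t u)).erase (S.fibre t v)),
        s.E, s.N⟩ := by
  obtain ⟨h0, ha, hb⟩ := op_eq ht hi
  change S.script.op t = 0 at h0
  change S.script.a t = u at ha
  change S.script.b t = v at hb
  have hrep : ∀ x, S.script.rep (t + 1) x =
      if S.script.rep t x = S.script.rep t v then S.script.rep t u else S.script.rep t x := by
    intro x
    rw [Script.rep_succ, Script.ra, Script.rb, ha, hb]
    simp [h0]
  have hne' : S.script.rep t u ≠ S.script.rep t v := fun h => hne (fibre_eq_iff.2 h)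
  have f1 : ∀ w, w ∈ S.fibre t u ∪ S.fibre t v → S.fibre (t + 1) w = S.fibre t u ∪ S.fibre t v := by
    intro w hw
    rw [Finset.mem_union, mem_fibre, mem_fibre] at hw
    ext x
    rw [Finset.mem_union, mem_fibre, mem_fibre, mem_fibre, hrep, hrep]
    grind
  have f2 : ∀ w, w ∉ S.fibre t u ∪ S.fibre t v → S.fibre (t + 1) w = S.fibre t w := by
    intro w hw
    rw [Finset.mem_union, mem_fibre, mem_fibre] at hw
    ext x
    rw [mem_fibre, mem_fibre, hrep, hrep]
    grind
  have hcov : ∀ x y, S.script.Cov (t + 1) x y ↔ S.script.Cov t x y := by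
    intro x y
    rw [cov_succ]
    simp [h0]
  refine ⟨fun W => ?_, fun x y hxy => ?_, fun x y hxy => ?_⟩
  · simp only [Finset.mem_insert, Finset.mem_erase]
    constructor
    · rintro (rfl | ⟨h1, h2, h3⟩)
      · exact ⟨u, (f1 u (Finset.mem_union_left _ (mem_fibre.2 rfl))).symm⟩
      · obtain ⟨w, rfl⟩ := (h.parts _).1 h3
        refine ⟨w, (f2 w fun hw => ?_).symm⟩
        rcases Finset.mem_union.1 hw with hw | hw
        · exact h2 (fibre_eq_iff.2 (mem_fibre.1 hw))
        · exact h1 (fibre_eq_iff.2 (mem_fibre.1 hw))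
    · rintro ⟨w, rfl⟩
      by_cases hw : w ∈ S.fibre t u ∪ S.fibre t v
      · exact Or.inl (f1 w hw)
      · right
        rw [f2 w hw]
        rw [Finset.mem_union, mem_fibre, mem_fibre, not_or] at hw
        exact ⟨fun h => hw.2 (fibre_eq_iff.1 h), fun h => hw.1 (fibre_eq_iff.1 h),
          (h.parts _).2 ⟨w, rfl⟩⟩
  · rw [hcov]
    exact h.resolved x y hxy
  · have hf : S.script.fut (S.numInstr - t) x y = S.script.fut (S.numInstr - (t + 1)) x y :=
      S.script.fut_of_not_covers (t := t) ht fun h => h.1 h0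
    rw [hcov, ← h.edge x y hxy, hf]

/-- A pair between the two parts that is already resolved keeps its value, because the other set is
subtracted. Any other such pair is covered for the first time, and there `fut` takes its value from
this very instruction. -/
theorem StageSpec.resolve {t : ℕ} (ht : t < S.numInstr) {s s' : Stage (Fin n)}
    (h : S.StageSpec t s) {u v : Fin n} (ha : S.script.a t = u) (hb : S.script.b t = v)
    (hp : s'.parts = s.parts)
    (hs : (S.script.op t = 1 ∧ s'.N = s.N ∧
        s'.E = s.E ∪ (pairsBetween (S.fibre t u) (S.fibre t v) \ s.N)) ∨
      (S.script.op t = 2 ∧ s'.E = s.E ∧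
        s'.N = s.N ∪ (pairsBetween (S.fibre t u) (S.fibre t v) \ s.E))) :
    S.StageSpec (t + 1) s' := by
  classical
  have h0 : S.script.op t ≠ 0 := by omega
  have hcov : ∀ x y : Fin n, x ≠ y → (S.script.Cov (t + 1) x y ↔ S.script.Cov t x y ∨
      s(x, y) ∈ pairsBetween (S.fibre t u) (S.fibre t v)) := by
    intro x y hxy
    rw [cov_succ, mem_fibre_pair ha hb, mem_pairsBetween]
    tauto
  refine ⟨fun W => ?_, fun x y hxy => ?_, fun x y hxy => ?_⟩
  · rw [hp, h.parts]
    simp only [fibre_succ_of_ne h0]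
  · rw [hcov x y hxy, ← h.resolved x y hxy]
    rcases hs with ⟨_, h1, h2⟩ | ⟨_, h1, h2⟩ <;> rw [h1, h2, Finset.mem_union, Finset.mem_sdiff] <;>
      tauto
  · rw [hcov x y hxy, ← h.edge x y hxy]
    have hf := S.script.fut_step (t := t) ht x y
    have hm : S.script.m = S.numInstr := rfl
    rw [hm] at hf
    have hc : S.script.Covers t x y ↔ s(x, y) ∈ pairsBetween (S.fibre t u) (S.fibre t v) := by
      rw [mem_fibre_pair ha hb, mem_pairsBetween]
      tauto
    have hr := h.resolved x y hxy
    rw [hf]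
    by_cases hxc : s(x, y) ∈ pairsBetween (S.fibre t u) (S.fibre t v)
    · rw [if_pos ⟨h0, hc.2 hxc⟩]
      rcases hs with ⟨h3, h1, h2⟩ | ⟨h3, h1, h2⟩
      · rw [h2, Finset.mem_union, Finset.mem_sdiff, if_pos h3, ← hr]
        simp only [hxc, true_and, or_true, not_true, false_and, or_false, and_true, not_or]
        by_cases he : s(x, y) ∈ s.E <;> simp [he]
      · rw [h1, if_neg (by omega)]
        simp [hxc]
    · rw [if_neg fun h => hxc (hc.1 h.2)]
      rcases hs with ⟨h3, h1, h2⟩ | ⟨h3, h1, h2⟩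
      · rw [h2, Finset.mem_union, Finset.mem_sdiff]
        simp [hxc]
      · rw [h1]
        simp [hxc]

theorem StageSpec.step {t : ℕ} (ht : t < S.numInstr) {s s' : Stage (Fin n)} (h : S.StageSpec t s)
    (hs : Step s (S.instr ⟨t, ht⟩) s') :
    S.StageSpec (t + 1) s' ∧ S.script.op t ≤ 2 ∧ S.script.a t < n ∧ S.script.b t < n ∧
      (S.script.op t = 0 → S.script.ra t ≠ S.script.rb t) := by
  generalize hi : S.instr ⟨t, ht⟩ = i at hs
  obtain ⟨h0, ha, hb⟩ := op_eq ht hi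
  cases hs with
  | @merge A B u v hA hB hne hu hv =>
    change S.script.op t = 0 at h0
    change S.script.a t = u at ha
    change S.script.b t = v at hb
    obtain rfl := h.eq_fibre hA hu
    obtain rfl := h.eq_fibre hB hv
    refine ⟨h.merge ht hi hne, by omega, by omega, by omega, fun _ he => hne (fibre_eq_iff.2 ?_)⟩
    rw [Script.ra, Script.rb, ha, hb] at he
    exact he
  | @resolvePos A B u v hA hB hu hv =>
    change S.script.op t = 1 at h0
    change S.script.a t = u at ha
    change S.script.b t = v at hb
    obtain rfl := h.eq_fibre hA hu
    obtain rfl := h.eq_fibre hB hv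
    exact ⟨h.resolve ht ha hb rfl (Or.inl ⟨h0, rfl, rfl⟩), by omega, by omega, by omega,
      fun h => by omega⟩
  | @resolveNeg A B u v hA hB hu hv =>
    change S.script.op t = 2 at h0
    change S.script.a t = u at ha
    change S.script.b t = v at hb
    obtain rfl := h.eq_fibre hA hu
    obtain rfl := h.eq_fibre hB hv
    exact ⟨h.resolve ht ha hb rfl (Or.inr ⟨h0, rfl, rfl⟩), by omega, by omega, by omega,
      fun h => by omega⟩

variable (S)

theorem stageSpec (t : ℕ) (ht : t < S.numInstr + 1) : S.StageSpec t (S.stage ⟨t, ht⟩) := by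
  induction t with
  | zero => exact stageSpec_zero
  | succ t ih => exact ((ih (by omega)).step (by omega) (S.step ⟨t, by omega⟩)).1

theorem script_valid : S.script.Valid := by
  have key := fun t (ht : t < S.numInstr) =>
    ((S.stageSpec t (by omega)).step ht (S.step ⟨t, ht⟩)).2
  exact ⟨fun t ht => (key t ht).1, fun t ht => (key t ht).2.1, fun t ht => (key t ht).2.2.1,
    fun t ht => (key t ht).2.2.2⟩

theorem adj_iff {G : SimpleGraph (Fin n)} (hG : S.Constructs G) (u v : Fin n) :
    G.Adj u v ↔ u ≠ v ∧ S.script.adj u v ≠ 0 := by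
  have h1 := S.script.adj_le_one u v
  rw [hG, SimpleGraph.fromEdgeSet_adj, Finset.mem_coe]
  have h2 : ∀ hne : u ≠ v, _ := (S.stageSpec S.numInstr (by omega)).edge u v
  simp only [Nat.sub_self, Script.fut] at h2
  constructor
  · rintro ⟨h3, h4⟩
    have := (h2 h4).1 (Or.inl h3)
    exact ⟨h4, by omega⟩
  · rintro ⟨h3, h4⟩
    have := (h2 h3).2 (by omega)
    exact ⟨this.resolve_right (by omega), h3⟩

/-- Representatives correspond to parts, and `Near` means distance `0` or adjacency in the graph of
resolved pairs. -/
theorem card_ball_le {t : ℕ} (ht : t ≤ S.numInstr) {x : ℕ} (hx : x < n) :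
    (S.script.ball t x).card ≤ S.width 1 := by
  classical
  have hspec := S.stageSpec t (by omega)
  refine le_trans ?_ (S.ballParts_le_width 1 ⟨t, by omega⟩ ⟨x, hx⟩)
  refine Stage.card_le_ballParts
    (fun ℓ => Finset.univ.filter fun u : Fin n => S.script.rep t u = ℓ) ?_ ?_
  · intro ℓ hℓ
    obtain ⟨h2, y, hy, rfl, hnear⟩ := Finset.mem_filter.1 hℓ
    change y < n at hy
    refine ⟨(hspec.parts _).2 ⟨⟨y, hy⟩, rfl⟩, ⟨y, hy⟩, by simp, ?_⟩
    by_cases hxy : (⟨x, hx⟩ : Fin n) = ⟨y, hy⟩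
    · rw [hxy, SimpleGraph.edist_self]; exact zero_le
    · have hcov : S.script.Cov t x y := by
        rcases hnear with h | h
        · exact absurd (Fin.ext h.symm) hxy
        · exact h
      have hadj : (S.stage ⟨t, by omega⟩).resolvedGraph.Adj ⟨x, hx⟩ ⟨y, hy⟩ := by
        rw [Stage.resolvedGraph, SimpleGraph.fromEdgeSet_adj, Finset.mem_coe, Finset.mem_union]
        exact ⟨(hspec.resolved _ _ hxy).2 hcov, hxy⟩
      exact (SimpleGraph.edist_eq_one_iff_adj.2 hadj).le
  · intro ℓ hℓ ℓ' hℓ' heq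
    obtain ⟨h2, y, hy, rfl, hnear⟩ := Finset.mem_filter.1 hℓ
    change y < n at hy
    have h := (Finset.ext_iff.1 heq ⟨y, hy⟩).1 (by simp)
    simpa using h

/-- Lets `d + 1` be absorbed by a multiple of `d` in the final time bound. -/
theorem one_le_width (hn : 0 < n) : 1 ≤ S.width 1 := by
  classical
  refine le_trans ?_ (S.card_ball_le (Nat.zero_le _) hn)
  refine Finset.card_pos.2 ⟨0, Finset.mem_filter.2 ⟨Finset.mem_range.2 hn, 0, hn, rfl, Or.inl rfl⟩⟩

/-- A crude bound that is needed only for `n ≤ 1`, where the term with the logarithm vanishes and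
the width has to be bounded by a constant. -/
theorem width_le : S.width 1 ≤ 2 ^ n := by
  refine Finset.sup_le fun i _ => Finset.sup_le fun v _ => ?_
  refine (Stage.ballParts_le _ _ _).trans ((Finset.card_le_univ _).trans ?_)
  simp

end ConstructionSequence

end MergeWidth

/-! ### Encoding of the input; length of irredundant sequences -/

namespace MergeWidth

theorem Instr.length_encode {n : ℕ} (i : Instr (Fin n)) : i.encode.length = 3 := by
  cases i <;> rfl

theorem getD_flatMap_encode {n : ℕ} (l : List (Instr (Fin n))) (t k : ℕ) (ht : t < l.length)
    (hk : k < 3) : (l.flatMap Instr.encode).getD (3 * t + k) 0 = l[t].word k := by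
  induction l generalizing t with
  | nil => simp at ht
  | cons i l ih =>
    rw [List.flatMap_cons]
    have hi := i.length_encode
    cases t with
    | zero =>
      rw [List.getD_append _ _ _ _ (by omega)]
      simp [Instr.word]
    | succ t =>
      rw [List.getD_append_right _ _ _ _ (by omega), hi,
        show 3 * (t + 1) + k - 3 = 3 * t + k by omega, ih t (by simpa using ht)]
      simp

theorem length_flatMap_encode {n : ℕ} (l : List (Instr (Fin n))) :
    (l.flatMap Instr.encode).length = 3 * l.length := by
  induction l with
  | nil => rfl
  | cons i l ih => rw [List.flatMap_cons, List.length_append, ih, i.length_encode,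
      List.length_cons]; ring

namespace ConstructionSequence

variable {n : ℕ} (S : ConstructionSequence (Fin n))

theorem length_encode : S.encode.length = 3 * S.numInstr + 2 := by
  rw [encode, List.length_cons, List.length_cons, length_flatMap_encode, List.length_ofFn]

theorem getD_encode {t k : ℕ} (ht : t < S.numInstr) (hk : k < 3) :
    S.encode.getD (3 * t + (k + 2)) 0 = S.word k t := by
  rw [S.word_eq k ht, encode, ← add_assoc, List.getD_cons_succ, List.getD_cons_succ,
    getD_flatMap_encode _ _ _ (by simpa using ht) hk]
  simp

theorem getD_encode_le (a : ℕ) : S.encode.getD a 0 ≤ n + S.numInstr + 2 := by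
  have key : ∀ x ∈ S.encode, x ≤ n + S.numInstr + 2 := by
    intro x hx
    rw [encode, List.mem_cons, List.mem_cons, List.mem_flatMap] at hx
    rcases hx with rfl | rfl | ⟨i, _, hx⟩
    · omega
    · omega
    · cases i <;> simp only [Instr.encode, List.mem_cons, List.not_mem_nil, or_false] at hx <;>
        omega
  by_cases ha : a < S.encode.length
  · rw [List.getD_eq_getElem _ _ ha]
    exact key _ (List.getElem_mem ha)
  · rw [List.getD_eq_default _ _ (by omega)]
    omega

/-- The parts of the first `t + 1` stages. -/
def partsUpTo (t : ℕ) : Finset (Finset (Fin n)) :=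
  (Finset.range (t + 1)).biUnion fun i => Finset.univ.image (S.fibre i)

/-- There are `n` parts at the beginning, and each merge creates at most one new part. -/
theorem card_partsUpTo (t : ℕ) : (S.partsUpTo t).card ≤ n + S.script.merges t := by
  induction t with
  | zero =>
    have : S.partsUpTo 0 = Finset.univ.image (S.fibre 0) := by simp [partsUpTo]
    rw [this]
    refine Finset.card_image_le.trans ?_
    simp
  | succ t ih =>
    have hstep : S.partsUpTo (t + 1) = S.partsUpTo t ∪ Finset.univ.image (S.fibre (t + 1)) := by
      rw [partsUpTo, Finset.range_add_one, Finset.biUnion_insert, Finset.union_comm]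
      rfl
    have hold : ∀ w, S.fibre t w ∈ S.partsUpTo t := fun w =>
      Finset.mem_biUnion.2 ⟨t, by simp, Finset.mem_image_of_mem _ (Finset.mem_univ _)⟩
    rw [hstep, S.script.merges_succ]
    by_cases h0 : S.script.op t = 0
    · rw [if_pos h0]
      have hsub : S.partsUpTo t ∪ Finset.univ.image (S.fibre (t + 1)) ⊆
          insert (Finset.univ.filter fun x : Fin n => S.script.rep (t + 1) x = S.script.ra t)
            (S.partsUpTo t) := by
        refine Finset.union_subset (Finset.subset_insert _ _) fun W hW => ?_
        obtain ⟨w, _, rfl⟩ := Finset.mem_image.1 hW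
        by_cases hw : S.script.rep (t + 1) w = S.script.ra t
        · refine Finset.mem_insert.2 (Or.inl ?_)
          rw [fibre, hw]
        · refine Finset.mem_insert_of_mem ?_
          have : S.fibre (t + 1) w = S.fibre t w := by
            ext x
            rw [Script.rep_succ] at hw
            rw [mem_fibre, mem_fibre, Script.rep_succ, Script.rep_succ]
            grind
          rw [this]
          exact hold w
      have h1 := Finset.card_le_card hsub
      have h2 := Finset.card_insert_le (Finset.univ.filter fun x : Fin n =>
        S.script.rep (t + 1) x = S.script.ra t) (S.partsUpTo t)
      omega
    · rw [if_neg h0]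
      have hsub : S.partsUpTo t ∪ Finset.univ.image (S.fibre (t + 1)) ⊆ S.partsUpTo t := by
        refine Finset.union_subset subset_rfl fun W hW => ?_
        obtain ⟨w, _, rfl⟩ := Finset.mem_image.1 hW
        rw [fibre_succ_of_ne h0]
        exact hold w
      exact (Finset.card_le_card hsub).trans ih

theorem fibre_mem_partsUpTo {i t : ℕ} (hi : i ≤ t) (v : Fin n) : S.fibre i v ∈ S.partsUpTo t :=
  Finset.mem_biUnion.2 ⟨i, by simpa [Nat.lt_succ_iff] using hi,
    Finset.mem_image_of_mem _ (Finset.mem_univ _)⟩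

theorem exists_resolves {t : ℕ} (ht : t < S.numInstr) (h0 : S.script.op t ≠ 0) :
    ∃ u v, S.Resolves ⟨t, ht⟩ (S.fibre t u) (S.fibre t v) := by
  have hspec := S.stageSpec t (by omega)
  obtain ⟨h1, _, _⟩ := op_eq ht rfl
  have hmem : ∀ v, S.fibre t v ∈ (S.stage (⟨t, ht⟩ : Fin S.numInstr).castSucc).parts := fun v =>
    (hspec.parts _).2 ⟨v, rfl⟩
  cases hi : S.instr ⟨t, ht⟩ with
  | merge u v => rw [hi] at h1; exact absurd h1 h0
  | resolvePos u v =>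
    exact ⟨u, v, hmem u, hmem v, u, mem_fibre.2 rfl, v, mem_fibre.2 rfl, Or.inl hi⟩
  | resolveNeg u v =>
    exact ⟨u, v, hmem u, hmem v, u, mem_fibre.2 rfl, v, mem_fibre.2 rfl, Or.inr hi⟩

/-- A sequence without repeated resolves is short. -/
theorem numInstr_le_of_irredundant (h : S.Irredundant) : S.numInstr ≤ n + 4 * n ^ 2 := by
  have hmerge : S.script.merges S.numInstr ≤ n := S.script_valid.card_merge_le le_rfl
  have hparts := S.card_partsUpTo S.numInstr
  have hex : ∀ t, ∃ p : Finset (Fin n) × Finset (Fin n), ∀ (ht : t < S.numInstr),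
      S.script.op t ≠ 0 → p ∈ S.partsUpTo S.numInstr ×ˢ S.partsUpTo S.numInstr ∧
        S.Resolves ⟨t, ht⟩ p.1 p.2 := by
    intro t
    by_cases ht : t < S.numInstr ∧ S.script.op t ≠ 0
    · obtain ⟨u, v, huv⟩ := S.exists_resolves ht.1 ht.2
      exact ⟨(_, _), fun _ _ => ⟨Finset.mem_product.2 ⟨S.fibre_mem_partsUpTo ht.1.le u,
        S.fibre_mem_partsUpTo ht.1.le v⟩, huv⟩⟩
    · exact ⟨(∅, ∅), fun h1 h2 => absurd ⟨h1, h2⟩ ht⟩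
  choose g hg using hex
  -- By irredundancy, different resolves have different ordered pairs of parts.
  have hres : ((Finset.range S.numInstr).filter fun i => ¬ S.script.op i = 0).card ≤
      (S.partsUpTo S.numInstr ×ˢ S.partsUpTo S.numInstr).card := by
    refine Finset.card_le_card_of_injOn g (fun t ht => ?_) fun i hi j hj hij => ?_
    · obtain ⟨h1, h2⟩ := Finset.mem_filter.1 ht
      exact (hg t (Finset.mem_range.1 h1) h2).1
    · obtain ⟨h1, h2⟩ := Finset.mem_filter.1 hi
      obtain ⟨h3, h4⟩ := Finset.mem_filter.1 hj
      have e1 := (hg i (Finset.mem_range.1 h1) h2).2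
      have e2 := (hg j (Finset.mem_range.1 h3) h4).2
      rcases Nat.lt_trichotomy i j with hlt | heq | hlt
      · exact absurd (hij ▸ e2) (h _ _ (Fin.mk_lt_mk.2 hlt) _ _ e1).1
      · exact heq
      · exact absurd (hij ▸ e1) (h _ _ (Fin.mk_lt_mk.2 hlt) _ _ e2).1
  have hsum := Finset.card_filter_add_card_filter_not (s := Finset.range S.numInstr)
    fun i => S.script.op i = 0
  rw [Finset.card_range] at hsum
  rw [Finset.card_product] at hres
  unfold Script.merges at hmerge hparts
  have : (S.partsUpTo S.numInstr).card ≤ 2 * n := by omega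
  have h2 := Nat.mul_le_mul this this
  have h3 : 2 * n * (2 * n) = 4 * n ^ 2 := by ring
  omega

end ConstructionSequence

end MergeWidth

namespace WordRAM

open MergeWidth

/-! ## The program -/

/-- Double register `0` and count in register `5` until `n + 2` is reached. -/
def logLoop : Program :=
  .while (.bin .lt (.reg 0) (.bin .add (.reg 3) (.const 2)))
    (.seq (.assign 0 (.bin .mul (.reg 0) (.const 2)))
      (.assign 5 (.bin .add (.reg 5) (.const 1))))

/-- Compute the parameters. -/
def prologue : Program :=
  .seq (.assign 3 (.load (.const 0))) <|
  .seq (.assign 4 (.load (.const 1))) <|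
  .seq (.assign 2 (.bin .add (.bin .add (.bin .mul (.const 3) (.reg 4))
    (.bin .mul (.const 2) (.reg 3))) (.const 10))) <|
  .seq (.assign 0 (.const 1)) logLoop

/-- Compute the addresses of the output. -/
def epilogue : Program :=
  .seq (.assign 0 (.bin .mul (.bin .mul (.bin .mul (.const 16) (.reg 2)) (.reg 2)) (.reg 2)))
    (.assign 1 (.bin .add (.reg 0) (.bin .mul (.reg 3) (.reg 3))))

/-- Here `k` is the number of doublings still to come. Register `0` is doubled only while it is
below `n + 2`, so it stays below `2 * (n + 2)` and does not overflow. -/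
theorem logLoop_exec {w n : ℕ} (hw : 2 * (n + 2) + 10 < 2 ^ w) (k : ℕ) (σ : State)
    (h3 : σ.regs 3 = n) (h0 : σ.regs 0 = 2 ^ σ.regs 5) (h5 : σ.regs 5 + k = Nat.clog 2 (n + 2)) :
    ∃ t τ, Exec w logLoop σ t τ ∧ t ≤ 14 * k + 6 ∧ τ.mem = σ.mem ∧
      (∀ r, r ≠ 0 → r ≠ 5 → τ.regs r = σ.regs r) ∧ τ.regs 5 = Nat.clog 2 (n + 2) := by
  have hlog : Nat.clog 2 (n + 2) ≤ n + 2 := Nat.clog_le_of_le_pow (Nat.lt_two_pow_self).le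
  have ht : (Expr.bin .lt (.reg 0) (.bin .add (.reg 3) (.const 2))).eval w σ =
      if 2 ^ σ.regs 5 < n + 2 then 1 else 0 := by
    simp only [Expr.eval, BinOp.eval, h3, h0]
    rw [Nat.mod_eq_of_lt (show 2 < 2 ^ w by omega), Nat.mod_eq_of_lt (show n + 2 < 2 ^ w by omega)]
    split_ifs <;> exact Nat.mod_eq_of_lt (by omega)
  induction k generalizing σ with
  | zero =>
    have : n + 2 ≤ 2 ^ σ.regs 5 := by
      rw [show σ.regs 5 = Nat.clog 2 (n + 2) by omega]
      exact Nat.le_pow_clog (by norm_num) _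
    exact ⟨_, σ, .while_false (by rw [ht, if_neg (by omega)]), by simp [Expr.cost], rfl,
      fun _ _ _ => rfl, by omega⟩
  | succ k ih =>
    have hlt : 2 ^ σ.regs 5 < n + 2 := (Nat.lt_clog_iff_pow_lt (by norm_num)).1 (by omega)
    have e1 : (Expr.bin .mul (.reg 0) (.const 2)).eval w σ = 2 ^ (σ.regs 5 + 1) := by
      simp only [Expr.eval, BinOp.eval, h0]
      rw [Nat.mod_eq_of_lt (show 2 < 2 ^ w by omega), Nat.mod_eq_of_lt (by omega), pow_succ]
    have e2 : (Expr.bin .add (.reg 5) (.const 1)).eval w (σ.setReg 0 (2 ^ (σ.regs 5 + 1))) =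
        σ.regs 5 + 1 := by
      simp only [Expr.eval, BinOp.eval, State.setReg, Function.update_apply]
      rw [Nat.mod_eq_of_lt (show 1 < 2 ^ w by omega), if_neg (by norm_num),
        Nat.mod_eq_of_lt (by omega)]
    have x1 := Exec.assign (w := w) σ 0 (.bin .mul (.reg 0) (.const 2))
    rw [e1] at x1
    have x2 := Exec.assign (w := w) (σ.setReg 0 (2 ^ (σ.regs 5 + 1))) 5
      (.bin .add (.reg 5) (.const 1))
    rw [e2] at x2
    set σ' := (σ.setReg 0 (2 ^ (σ.regs 5 + 1))).setReg 5 (σ.regs 5 + 1) with hσ'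
    have g5 : σ'.regs 5 = σ.regs 5 + 1 := by simp [hσ', State.setReg]
    have g0 : σ'.regs 0 = 2 ^ (σ.regs 5 + 1) := by simp [hσ', State.setReg]
    have gr : ∀ r, r ≠ 0 → r ≠ 5 → σ'.regs r = σ.regs r := by
      intro r hr hr'
      simp [hσ', State.setReg, hr, hr']
    have h3' : σ'.regs 3 = n := by rw [gr 3 (by norm_num) (by norm_num), h3]
    have h0' : σ'.regs 0 = 2 ^ σ'.regs 5 := by rw [g0, g5]
    obtain ⟨t, τ, y1, y2, y3, y4, y5⟩ := ih σ' h3' h0' (by omega) (by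
      simp only [Expr.eval, BinOp.eval, h3', h0']
      rw [Nat.mod_eq_of_lt (show 2 < 2 ^ w by omega),
        Nat.mod_eq_of_lt (show n + 2 < 2 ^ w by omega)]
      split_ifs <;> exact Nat.mod_eq_of_lt (by omega))
    refine ⟨_, τ, .while_true (by rw [ht, if_pos hlt]; norm_num) (.seq x1 x2) y1, ?_, y3,
      fun r hr hr' => (y4 r hr hr').trans (gr r hr hr'), y5⟩
    simp only [Expr.cost]
    omega

theorem prologue_exec {w : ℕ} {input : List ℕ}
    (hw : 3 * input.getD 1 0 + 2 * input.getD 0 0 + 20 < 2 ^ w) :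
    ∃ t τ, Exec w prologue (.init input) t τ ∧ t ≤ 14 * Nat.clog 2 (input.getD 0 0 + 2) + 30 ∧
      τ.mem = (State.init input).mem ∧ (∀ r, 6 ≤ r → τ.regs r = 0) ∧
      τ.regs 2 = 3 * input.getD 1 0 + 2 * input.getD 0 0 + 10 ∧ τ.regs 3 = input.getD 0 0 ∧
      τ.regs 4 = input.getD 1 0 ∧ τ.regs 5 = Nat.clog 2 (input.getD 0 0 + 2) := by
  set n := input.getD 0 0 with hn
  set m := input.getD 1 0 with hm
  have hmod : ∀ a, a ≤ 3 * m + 2 * n + 10 → a % 2 ^ w = a := fun a ha =>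
    Nat.mod_eq_of_lt (by omega)
  have x1 := Exec.assign (w := w) (.init input) 3 (.load (.const 0))
  have e1 : (Expr.load (.const 0)).eval w (.init input) = n := by
    simp [Expr.eval, State.init, hn]
  rw [e1] at x1
  set σ1 := (State.init input).setReg 3 n with hσ1
  have x2 := Exec.assign (w := w) σ1 4 (.load (.const 1))
  have e2 : (Expr.load (.const 1)).eval w σ1 = m := by
    simp only [Expr.eval, hσ1, State.setReg, State.init, hm]
    rw [hmod 1 (by omega)]
  rw [e2] at x2
  set σ2 := σ1.setReg 4 m with hσ2
  have x3 := Exec.assign (w := w) σ2 2 (.bin .add (.bin .add (.bin .mul (.const 3) (.reg 4))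
    (.bin .mul (.const 2) (.reg 3))) (.const 10))
  have e3 : (Expr.bin .add (.bin .add (.bin .mul (.const 3) (.reg 4))
      (.bin .mul (.const 2) (.reg 3))) (.const 10)).eval w σ2 = 3 * m + 2 * n + 10 := by
    have g4 : σ2.regs 4 = m := by simp [hσ2, State.setReg]
    have g3 : σ2.regs 3 = n := by simp [hσ2, hσ1, State.setReg]
    simp only [Expr.eval, BinOp.eval, g4, g3]
    rw [hmod 3 (by omega), hmod 2 (by omega), hmod 10 (by omega), hmod (3 * m) (by omega),
      hmod (2 * n) (by omega), hmod (3 * m + 2 * n) (by omega), hmod _ le_rfl]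
  rw [e3] at x3
  set σ3 := σ2.setReg 2 (3 * m + 2 * n + 10) with hσ3
  have x4 := Exec.assign (w := w) σ3 0 (.const 1)
  have e4 : (Expr.const 1).eval w σ3 = 1 := by
    simp only [Expr.eval]
    rw [hmod 1 (by omega)]
  rw [e4] at x4
  set σ4 := σ3.setReg 0 1 with hσ4
  have r4 : ∀ r, σ4.regs r = if r = 0 then 1 else if r = 2 then 3 * m + 2 * n + 10 else
      if r = 4 then m else if r = 3 then n else 0 := by
    intro r
    simp [hσ4, hσ3, hσ2, hσ1, State.setReg, State.init, Function.update_apply]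
  obtain ⟨t, τ, y1, y2, y3, y4, y5⟩ := logLoop_exec (w := w) (n := n) (by omega)
    (Nat.clog 2 (n + 2)) σ4 (by simp [r4]) (by simp [r4]) (by simp [r4])
  refine ⟨_, τ, .seq x1 (.seq x2 (.seq x3 (.seq x4 y1))), ?_, y3, fun r hr => ?_, ?_, ?_, ?_, y5⟩
  · simp only [Expr.cost]
    omega
  · rw [y4 r (by omega) (by omega), r4]
    simp [show r ≠ 0 by omega, show r ≠ 2 by omega, show r ≠ 4 by omega, show r ≠ 3 by omega]
  · rw [y4 2 (by omega) (by omega), r4]; simp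
  · rw [y4 3 (by omega) (by omega), r4]; simp
  · rw [y4 4 (by omega) (by omega), r4]; simp

theorem epilogue_exec {V : Env} (hV : V.Good) {w : ℕ} (hw : 2 ^ w = V.W) {σ : State}
    (hE : σ.regs 2 = V.E) (hn : σ.regs 3 = V.n) :
    ∃ t τ, Exec w epilogue σ t τ ∧ t ≤ 20 ∧ τ.mem = σ.mem ∧
      τ.regs 0 = 16 * V.E * V.E * V.E ∧ τ.regs 1 = 16 * V.E * V.E * V.E + V.n * V.n := by
  have h1 := hV.W_gt
  have h2 := hV.E_ge
  have hE1 : V.n * V.n ≤ V.E * V.E := Nat.mul_le_mul (by omega) (by omega)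
  have hE2 : V.E * V.E ≤ V.E * V.E * V.E := Nat.le_mul_of_pos_right _ (by omega)
  have hE3 : 17 * V.E * V.E * V.E = 16 * V.E * V.E * V.E + V.E * V.E * V.E := by ring
  have hE4 : 16 * V.E * V.E ≤ 16 * V.E * V.E * V.E := Nat.le_mul_of_pos_right _ (by omega)
  have hE5 : 16 * V.E ≤ 16 * V.E * V.E := Nat.le_mul_of_pos_right _ (by omega)
  have x1 := Exec.assign (w := w) σ 0
    (.bin .mul (.bin .mul (.bin .mul (.const 16) (.reg 2)) (.reg 2)) (.reg 2))
  have e1 : (Expr.bin .mul (.bin .mul (.bin .mul (.const 16) (.reg 2)) (.reg 2)) (.reg 2)).eval w σ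
      = 16 * V.E * V.E * V.E := by
    simp only [Expr.eval, BinOp.eval, hE, hw]
    rw [Nat.mod_eq_of_lt (show 16 < V.W by omega), Nat.mod_eq_of_lt (show 16 * V.E < V.W by omega),
      Nat.mod_eq_of_lt (show 16 * V.E * V.E < V.W by omega), Nat.mod_eq_of_lt (by omega)]
  rw [e1] at x1
  have x2 := Exec.assign (w := w) (σ.setReg 0 (16 * V.E * V.E * V.E)) 1
    (.bin .add (.reg 0) (.bin .mul (.reg 3) (.reg 3)))
  have e2 : (Expr.bin .add (.reg 0) (.bin .mul (.reg 3) (.reg 3))).eval w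
      (σ.setReg 0 (16 * V.E * V.E * V.E)) = 16 * V.E * V.E * V.E + V.n * V.n := by
    have g0 : (σ.setReg 0 (16 * V.E * V.E * V.E)).regs 0 = 16 * V.E * V.E * V.E := by
      simp [State.setReg]
    have g3 : (σ.setReg 0 (16 * V.E * V.E * V.E)).regs 3 = V.n := by
      simp [State.setReg, hn]
    simp only [Expr.eval, BinOp.eval, g0, g3, hw]
    rw [Nat.mod_eq_of_lt (show V.n * V.n < V.W by omega), Nat.mod_eq_of_lt (by omega)]
  rw [e2] at x2
  refine ⟨_, _, .seq x1 x2, by simp [Expr.cost], rfl, ?_, ?_⟩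
  · simp [State.setReg]
  · simp [State.setReg]

/-- The abstract state before the start. -/
def initState (E : ℕ) (input : List ℕ) : AState where
  regs := fun _ => 0
  arr := fun x k i j => input.getD (address E x.ctorIdx k i j) 0
  out := fun i => input.getD (16 * E * E * E + i) 0

theorem timeBound_le (V : Env) (d : ℕ) :
    timeBound V (16 * d * (V.n + 1)) ≤
      20 * V.m + 1000 * ((d + 1) * (V.n + 1) ^ 2 * (V.L + 1)) := by
  unfold timeBound searchBound
  generalize V.n = n
  generalize V.L = L
  generalize V.m = m
  zify
  have hn : (0 : ℤ) ≤ n := by positivity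
  have hL : (0 : ℤ) ≤ L := by positivity
  have hd : (0 : ℤ) ≤ d := by positivity
  rw [← sub_nonneg]
  -- After expansion the difference is a polynomial with nonnegative coefficients.
  ring_nf
  positivity

/-- The program that solves All-Pairs Shortest Path. -/
def apspProgram : Program := .seq prologue (.seq mainCmd.compile epilogue)

theorem apspProgram_exec {n : ℕ} (S : ConstructionSequence (Fin n)) {G : SimpleGraph (Fin n)}
    (hG : S.Constructs G) {w : ℕ} (hw : (n + S.length + 1) ^ 15 ≤ 2 ^ w) :
    ∃ t τ, Exec w apspProgram (State.init S.encode) t τ ∧ τ.SolvesAPSP G ∧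
      t ≤ (mainCmd.stepCost + 1) * (20 * S.numInstr +
        1000 * ((S.width 1 + 1) * (n + 1) ^ 2 * (Nat.clog 2 (n + 2) + 1))) := by
  have hlen : S.length = S.numInstr + 1 := rfl
  set m := S.numInstr with hm
  obtain ⟨X, hX⟩ : ∃ X, n + S.length + 1 = X := ⟨_, rfl⟩
  rw [hX] at hw
  let V : Env := ⟨n, m, Nat.clog 2 (n + 2), 3 * m + 2 * n + 10, 2 ^ w⟩
  have hEX : V.E ≤ 5 * X := by change 3 * m + 2 * n + 10 ≤ 5 * X; omega
  have hlog : Nat.clog 2 (n + 2) ≤ n + 2 := Nat.clog_le_of_le_pow (Nat.lt_two_pow_self).le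
  -- Here the exponent `15` is used: memory needs `17 * E ^ 3` addresses, which is at most `2125 * X
  -- ^ 3`, and `2125 < 2 ^ 12 ≤ X ^ 12` as `X ≥ 2`.
  have hW : 17 * V.E * V.E * V.E < 2 ^ w := by
    calc 17 * V.E * V.E * V.E = 17 * (V.E * V.E * V.E) := by ring
      _ ≤ 17 * (5 * X * (5 * X) * (5 * X)) := by gcongr
      _ = 2125 * X ^ 3 := by ring
      _ < 2 ^ 12 * X ^ 3 := by
        have : 0 < X ^ 3 := by have : 0 < X := by omega
                               positivity
        omega
      _ ≤ X ^ 12 * X ^ 3 := by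
        have : 2 ≤ X := by omega
        gcongr
      _ = X ^ 15 := by ring
      _ ≤ 2 ^ w := hw
  have hV : V.Good := by
    refine ⟨le_rfl, ?_, ?_, hW⟩
    · change Nat.clog 2 (n + 2) + 2 ≤ 3 * m + 2 * n + 10
      omega
    · exact Nat.lt_of_succ_le (Nat.le_pow_clog (by norm_num) _)
  have hWE := hV.W_ge
  change 1000 * (3 * m + 2 * n + 10) ≤ 2 ^ w at hWE
  have hg0 : S.encode.getD 0 0 = n := rfl
  have hg1 : S.encode.getD 1 0 = m := rfl
  obtain ⟨t1, σ1, p1, p2, p3, p4, p5, p6, p7, p8⟩ := prologue_exec (w := w) (input := S.encode)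
    (by rw [hg0, hg1]; omega)
  rw [hg0] at p2
  rw [hg0, hg1] at p5
  rw [hg0] at p6 p8
  rw [hg1] at p7
  have hle : ∀ a, S.encode.getD a 0 < 2 ^ w := fun a => by
    have := S.getD_encode_le a
    omega
  have hR : Repr V σ1 (initState V.E S.encode) := by
    refine ⟨p5, p6, p7, p8, fun r => p4 _ (by omega), fun x k i j _ _ _ => ?_, fun i _ => ?_,
      fun r => ?_, fun x k i j _ _ _ => hle _⟩
    · rw [p3]; rfl
    · rw [p3]; rfl
    · exact Nat.two_pow_pos w
  -- The input is shorter than `E`. Since `inp` is array number `0`, its row `(0, 0)` coincides with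
  -- the input, and all other arrays start with zeros.
  have hbig : ∀ a, V.E ≤ a → S.encode.getD a 0 = 0 := by
    intro a ha
    refine List.getD_eq_default _ _ ?_
    rw [S.length_encode]
    change 3 * m + 2 * n + 10 ≤ a at ha
    omega
  have hcell : ∀ t k, t < m → k < 3 →
      (initState V.E S.encode).arr .inp 0 0 (3 * t + (k + 2)) = S.word k t := by
    intro t k ht hk
    rw [← S.getD_encode ht hk]
    change S.encode.getD (address V.E 0 0 0 (3 * t + (k + 2))) 0 = _
    simp only [address, zero_mul, zero_add]
  obtain ⟨t2, S2, r1, r2, r3⟩ := main_runs (S := initState V.E S.encode) hV S.script_valid rfl rfl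
    (d := S.width 1) (fun t ht x hx => S.card_ball_le ht hx)
    (fun t ht => ⟨hcell t 0 ht (by norm_num), hcell t 1 ht (by norm_num),
      hcell t 2 ht (by norm_num)⟩)
    (fun x hx k i j => by
      refine hbig _ ?_
      have h1 : 1 ≤ x.ctorIdx := by cases x <;> first | exact absurd rfl hx | decide
      have h2 : 1 ≤ V.E := by change 1 ≤ 3 * m + 2 * n + 10; omega
      have h3 : V.E * 1 ≤ V.E * (x.ctorIdx * V.E * V.E) := by
        gcongr
        exact Nat.mul_pos (Nat.mul_pos h1 h2) h2
      have h4 : address V.E x.ctorIdx k i j =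
          V.E * (x.ctorIdx * V.E * V.E) + ((k * V.E + i) * V.E + j) := by
        unfold address; ring
      omega)
  obtain ⟨t2', σ2, q1, q2, q3⟩ := r1.simulate hV.fits rfl le_rfl hR
  obtain ⟨t3, τ, s1, s2, s3, s4, s5⟩ := epilogue_exec hV rfl q3.regE q3.regn
  refine ⟨_, τ, .seq p1 (.seq q1 s1), ?_, ?_⟩
  · refine solvesAPSP_of_isTreeOutput (S.adj_iff hG) fun x hx => ?_
    obtain ⟨vis, hvis⟩ := r2 x hx
    change IsTreeOutput n x S.script.adj vis (fun y => S2.out (x * n + y))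
      (fun y => S2.out (n * n + (x * n + y))) at hvis
    have hsq : n * n + n * n ≤ V.E * V.E := by
      have : (2 * n) * (2 * n) ≤ V.E * V.E := Nat.mul_le_mul (by
        change 2 * n ≤ 3 * m + 2 * n + 10; omega) (by change 2 * n ≤ 3 * m + 2 * n + 10; omega)
      nlinarith
    have hD : ∀ y < n, τ.mem (τ.regs 0 + x * n + y) = S2.out (x * n + y) := by
      intro y hy
      have := mul_add_lt_sq hx hy
      rw [s3, s4, add_assoc, q3.out _ (by omega)]
    have hP : ∀ y < n, τ.mem (τ.regs 1 + x * n + y) = S2.out (n * n + (x * n + y)) := by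
      intro y hy
      have := mul_add_lt_sq hx hy
      rw [s3, s5, add_assoc, add_assoc]
      exact q3.out (n * n + (x * n + y)) (by omega)
    refine ⟨vis, hvis.src, fun y hy hyv => ?_, fun y hy hyv z hz hyz => ?_, fun y hy hyv => ?_⟩
    · rw [hD y hy, hP y hy]
      rcases hvis.parent y hy hyv with h | ⟨h1, h2, h3⟩
      · exact Or.inl h
      · right
        rw [hD _ h2]
        exact ⟨h1, h2, h3⟩
    · rw [hD y hy, hD z hz]
      exact hvis.closed y hy hyv z hz hyz
    · rw [hD y hy, hP y hy]
      exact hvis.unvis y hy hyv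
  · have hb := r3.trans (timeBound_le V (S.width 1))
    change t2 ≤ 20 * m + 1000 * ((S.width 1 + 1) * (n + 1) ^ 2 * (Nat.clog 2 (n + 2) + 1)) at hb
    have hL : Nat.clog 2 (n + 2) + 1 ≤
        (S.width 1 + 1) * (n + 1) ^ 2 * (Nat.clog 2 (n + 2) + 1) :=
      Nat.le_mul_of_pos_left _ (by positivity)
    have := Nat.mul_le_mul_left mainCmd.stepCost hb
    rw [add_mul, one_mul]
    omega

/-! ### Comparison with the bound of the theorem -/

theorem clog_add_two_le {n : ℕ} (hn : 2 ≤ n) :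
    ((Nat.clog 2 (n + 2) + 1 : ℕ) : ℝ) ≤ 4 * Real.logb 2 n := by
  have h1 : Nat.clog 2 (n + 2) ≤ Nat.log 2 n + 2 := by
    refine Nat.clog_le_of_le_pow ?_
    have := Nat.lt_pow_succ_log_self (b := 2) (by norm_num) n
    rw [pow_succ]
    have h2 : n < 2 ^ (Nat.log 2 n + 1) := this
    omega
  have h2 : ((Nat.log 2 n : ℕ) : ℝ) ≤ Real.logb 2 n := by
    simpa using Real.natLog_le_logb n 2
  have h3 : 1 ≤ Nat.log 2 n := Nat.log_pos (by norm_num) hn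
  have h4 : Nat.clog 2 (n + 2) + 1 ≤ 4 * Nat.log 2 n := by omega
  calc ((Nat.clog 2 (n + 2) + 1 : ℕ) : ℝ) ≤ ((4 * Nat.log 2 n : ℕ) : ℝ) := by exact_mod_cast h4
    _ = 4 * (Nat.log 2 n : ℝ) := by push_cast; ring
    _ ≤ _ := by linarith

theorem bound_le {n d : ℕ} (hn : 2 ≤ n) (hd : 1 ≤ d) :
    (((d + 1) * (n + 1) ^ 2 * (Nat.clog 2 (n + 2) + 1) : ℕ) : ℝ) ≤
      32 * (d * (n : ℝ) ^ 2 * Real.logb 2 n) := by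
  have h1 : (d + 1) * (n + 1) ^ 2 ≤ 8 * (d * n ^ 2) := by
    calc (d + 1) * (n + 1) ^ 2 ≤ (2 * d) * (2 * n) ^ 2 := by gcongr <;> omega
      _ = 8 * (d * n ^ 2) := by ring
  have h2 := clog_add_two_le hn
  calc (((d + 1) * (n + 1) ^ 2 * (Nat.clog 2 (n + 2) + 1) : ℕ) : ℝ)
      = (((d + 1) * (n + 1) ^ 2 : ℕ) : ℝ) * ((Nat.clog 2 (n + 2) + 1 : ℕ) : ℝ) := by push_cast; ring
    _ ≤ ((8 * (d * n ^ 2) : ℕ) : ℝ) * (4 * Real.logb 2 n) := by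
      refine mul_le_mul (by exact_mod_cast h1) h2 (by positivity) (by positivity)
    _ = _ := by push_cast; ring

end WordRAM

open WordRAM in
theorem theorem8 :
    ∃ (P : WordRAM.Program) (c : ℕ) (C : ℝ),
      ∀ (n : ℕ) (S : MergeWidth.ConstructionSequence (Fin n)) (G : SimpleGraph (Fin n)) (d : ℕ),
        S.Constructs G → S.width 1 = d →
        -- any word length of at least `c * log (n + m + 1)` bits
        ∀ w : ℕ, (n + S.length + 1) ^ c ≤ 2 ^ w →
          ∃ (t : ℕ) (τ : WordRAM.State),
            WordRAM.Exec w P (WordRAM.State.init S.encode) t τ ∧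
            τ.SolvesAPSP G ∧
            (t : ℝ) ≤ C * (S.length + d * (n : ℝ) ^ 2 * Real.logb 2 n) ∧
            (2 ≤ n → S.Irredundant → (t : ℝ) ≤ C * (d * (n : ℝ) ^ 2 * Real.logb 2 n)) := by
  obtain ⟨κ, hκ⟩ : ∃ κ, mainCmd.stepCost + 1 = κ := ⟨_, rfl⟩
  -- The constant is generous: apart from the factor `κ`, the time is at most `20 * m + 32000 * Y`
  -- for `n ≥ 2` and `20 * m + 36000` for `n ≤ 1`, where `m` is the number of instructions and `Y`
  -- is the term with the logarithm.
  refine ⟨apspProgram, 15, 280000 * κ, fun n S G d hG hd w hw => ?_⟩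
  obtain ⟨t, τ, h1, h2, h3⟩ := apspProgram_exec S hG hw
  rw [hκ, hd] at h3
  have hκ0 : (0 : ℝ) ≤ κ := by positivity
  have hlen : (S.length : ℝ) = S.numInstr + 1 := by
    rw [MergeWidth.ConstructionSequence.length]; push_cast; ring
  have hm0 : (0 : ℝ) ≤ S.numInstr := by positivity
  have h3' : (t : ℝ) ≤ κ * (20 * S.numInstr +
      1000 * (((d + 1) * (n + 1) ^ 2 * (Nat.clog 2 (n + 2) + 1) : ℕ) : ℝ)) := by
    exact_mod_cast h3
  set Y := (d : ℝ) * (n : ℝ) ^ 2 * Real.logb 2 n with hY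
  refine ⟨t, τ, h1, h2, ?_, fun hn hirr => ?_⟩
  · refine h3'.trans ?_
    rw [mul_comm (280000 : ℝ), mul_assoc (κ : ℝ)]
    refine mul_le_mul_of_nonneg_left ?_ hκ0
    rw [hlen]
    by_cases hn : 2 ≤ n
    · have hd1 : 1 ≤ d := hd ▸ S.one_le_width (by omega)
      have := bound_le hn hd1
      rw [← hY] at this
      have hY0 : 0 ≤ Y := by
        have : 0 ≤ Real.logb 2 n := Real.logb_nonneg (by norm_num) (by exact_mod_cast (by omega))
        positivity
      linarith
    -- For `n ≤ 1` the main term is zero; the constant cost is covered by the length of the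
    -- sequence, which is at least `1`.
    · have hY0 : Y = 0 := by
        have : n = 0 ∨ n = 1 := by omega
        rcases this with rfl | rfl <;> simp [hY]
      have hX : (d + 1) * (n + 1) ^ 2 * (Nat.clog 2 (n + 2) + 1) ≤ 36 := by
        have hd2 : d ≤ 2 := by
          rw [← hd]
          refine S.width_le.trans ?_
          calc 2 ^ n ≤ 2 ^ 1 := Nat.pow_le_pow_right (by norm_num) (by omega)
            _ = 2 := by norm_num
        have hL : Nat.clog 2 (n + 2) ≤ 2 := Nat.clog_le_of_le_pow (by omega)
        calc (d + 1) * (n + 1) ^ 2 * (Nat.clog 2 (n + 2) + 1)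
            ≤ (2 + 1) * (1 + 1) ^ 2 * (2 + 1) := by gcongr <;> omega
          _ = 36 := by norm_num
      have hX' : (((d + 1) * (n + 1) ^ 2 * (Nat.clog 2 (n + 2) + 1) : ℕ) : ℝ) ≤ 36 := by
        exact_mod_cast hX
      rw [hY0]
      linarith
  · refine h3'.trans ?_
    rw [mul_comm (280000 : ℝ), mul_assoc (κ : ℝ)]
    refine mul_le_mul_of_nonneg_left ?_ hκ0
    have hd1 : 1 ≤ d := hd ▸ S.one_le_width (by omega)
    have h4 := bound_le hn hd1
    rw [← hY] at h4
    have h5 := S.numInstr_le_of_irredundant hirr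
    have h6 : S.numInstr ≤ 5 * n ^ 2 := by
      have := Nat.le_self_pow (show 2 ≠ 0 by norm_num) n
      omega
    have h7 : (S.numInstr : ℝ) ≤ 5 * (n : ℝ) ^ 2 := by exact_mod_cast h6
    have h8 : (1 : ℝ) ≤ Real.logb 2 n := by
      rw [Real.le_logb_iff_rpow_le (by norm_num) (by positivity)]
      simpa using hn
    -- With `d ≥ 1` and `n ≥ 2` the quadratic number of instructions is absorbed by the main term.
    have h9 : (n : ℝ) ^ 2 ≤ Y := by
      have hd1' : (1 : ℝ) ≤ d := by exact_mod_cast hd1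
      have h10 : (1 : ℝ) ≤ d * Real.logb 2 n := one_le_mul_of_one_le_of_one_le hd1' h8
      calc (n : ℝ) ^ 2 = (n : ℝ) ^ 2 * 1 := (mul_one _).symm
        _ ≤ (n : ℝ) ^ 2 * (d * Real.logb 2 n) := by gcongr
        _ = Y := by rw [hY]; ring
    have h11 : (0 : ℝ) ≤ (n : ℝ) ^ 2 := by positivity
    linarith
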